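/- Let $\tau=\{\mathfrak A_n\}_{n\ge 0}$ be a decreasing sequence of $\sigma$-algebras (a filtration) on a Lebesgue probability space $(X,\mu)$ with continuous (atomless) measure, $\mathfrak A_0$ being the $\sigma$-algebra of all measurable sets, and let $\xi_n$ be the measurable partition corresponding to $\mathfrak A_n$. Isomorphisms of filtrations are isomorphisms $\operatorname{mod} 0$ of measure spaces that carry the $n$th $\sigma$-algebra to the $n$th one for all $n$; two filtrations are finitely isomorphic if for every $N$ their fragments $\{\mathfrak A_n\}_{n\le N}$ are isomorphic. The filtration $\tau$ is locally finite if, for every $n$, the conditional measures of $\xi_n$ are a.e. concentrated on finitely many atoms and there are, up to isomorphism and a null set, only finitely many of them; it is ergodic if $\bigcap_n\mathfrak A_n$ is trivial, and Bernoulli if there are independent random variables $\eta_0,\eta_1,\dots$ with $\mathfrak A_n=\sigma(\eta_k,\,k\ge n)$ $\operatorname{mod} 0$ for all $n\ge0$ (Bernoulli filtrations are considered on arbitrary Lebesgue probability spaces). It is $\{r_n\}$-adic if it is locally finite and the conditional measures of $\xi_n$ are a.e. uniform on $r_0r_1\cdots r_{n-1}$ points. Let $\tau$ be locally finite. The type of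 an element of $\xi_n$ is the isomorphism class of the finite measured tree given by its conditional measure and by the partitions induced on it by $\xi_0,\dots,\xi_n$. The graded multigraph $\Gamma(\tau)$ has as vertices of level $n$ the types of elements of $\xi_n$ that occur with positive probability. The edges from a vertex $u$ of level $n$ to a vertex $v$ of level $n+1$ are the subtrees of type $u$ hanging from the root of the tree $v$, and the cotransition probability of such an edge is the measure of the subtree. A measure on the space of infinite paths in $\Gamma(\tau)$ agrees with these cotransition probabilities if, conditionally on the $n$th vertex of a path, the probability of the initial segment of length $n$ is the product of the cotransition probabilities of its edges, for all $n$. An equipped multigraph is minimal if the measured trees of paths leading from the initial vertex to two distinct vertices of the same level are never isomorphic. The $n$th $\sigma$-algebra of the tail filtration of the path space is generated by the edges of a path from level $n$ on. Proposition 4. 0) For every locally finite $\tau$ on a Lebesgue space with continuous measure, $\Gamma(\tau)$ with these cotransition probabilities is a minimal equipped locally finite graded multigraph, the measured tree of paths leading to a vertex $v$ is of type $v$, and there is a unique probability measure $\nu_\tau$ on its path space that agrees with the cotransition probabilities and gives to every vertex $v$ of every level $n$ the $\mu$-measure of the union of the elements of $\xi_n$ of type $v$. The minimal model $\overline\tau$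 of $\tau$ is the tail filtration of the path space of $\Gamma(\tau)$ with the measure $\nu_\tau$. 1) A locally finite filtration $\tau$ on a Lebesgue space with continuous measure is finitely isomorphic to its minimal model $\overline\tau$ if and only if the measure $\nu_\tau$ is continuous; in particular, this is so whenever $\tau$ is ergodic. In general $\tau$ is not isomorphic to $\overline\tau$: there is an ergodic locally finite filtration on a Lebesgue space with continuous measure that is not isomorphic to its minimal model. 2) Two locally finite filtrations $\tau$, $\tau'$ on Lebesgue spaces with continuous measures are finitely isomorphic if and only if their minimal models coincide, i.e. there is an isomorphism of graded multigraphs $\Gamma(\tau)\to\Gamma(\tau')$ that preserves the cotransition probabilities and carries $\nu_\tau$ to $\nu_{\tau'}$. 3) Let $\tau$ be a locally finite filtration on a Lebesgue space with continuous measure. If $\tau$ is $\{r_n\}$-adic, then $\overline\tau$ is Bernoulli, and $\nu_\tau$ is continuous if $r_n\ge2$ for infinitely many $n$. If $\tau$ is finitely isomorphic to a Bernoulli filtration, then $\overline\tau$ is Bernoulli and $\nu_\tau$ is continuous. If $\tau$ is itself Bernoulli, then $\tau$ is ergodic and isomorphic to $\overline\tau$. -/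

import Mathlib

open MeasureTheory ProbabilityTheory Filter
open scoped ENNReal

noncomputable section

/-! ### Decreasing filtrations and isomorphism mod 0 -/

/-- A decreasing sequence `𝔄₀ ⊇ 𝔄₁ ⊇ …` of σ-algebras, `𝔄₀` being the σ-algebra of all
measurable sets. -/
structure DecFiltration (X : Type*) [mX : MeasurableSpace X] where
  alg : ℕ → MeasurableSpace X
  alg_zero : alg 0 = mX
  anti : Antitone alg

/-- The σ-algebra `a` coincides mod 0 with the preimage under `f` of the σ-algebra `b`. -/
def CarriesMod0 {X Y : Type*} [MeasurableSpace X] (μ : Measure X) (f : X → Y)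
    (a : MeasurableSpace X) (b : MeasurableSpace Y) : Prop :=
  (∀ s, MeasurableSet[b] s → ∃ t, MeasurableSet[a] t ∧ f ⁻¹' s =ᵐ[μ] t) ∧
    (∀ t, MeasurableSet[a] t → ∃ s, MeasurableSet[b] s ∧ f ⁻¹' s =ᵐ[μ] t)

/-- `f` is an isomorphism mod 0 of measure spaces with inverse `g`. -/
structure IsIsoMod0 {X Y : Type*} [MeasurableSpace X] [MeasurableSpace Y]
    (μ : Measure X) (ν : Measure Y) (f : X → Y) (g : Y → X) : Prop where
  preserving : MeasurePreserving f μ ν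
  preserving_inv : MeasurePreserving g ν μ
  left_inv : ∀ᵐ x ∂μ, g (f x) = x
  right_inv : ∀ᵐ y ∂ν, f (g y) = y

/-- Isomorphism of filtrations of measure spaces. -/
def FiltIso {X Y : Type*} [MeasurableSpace X] [MeasurableSpace Y]
    (μ : Measure X) (τ : DecFiltration X) (ν : Measure Y) (σ : DecFiltration Y) : Prop :=
  ∃ (f : X → Y) (g : Y → X), IsIsoMod0 μ ν f g ∧
    ∀ n, CarriesMod0 μ f (τ.alg n) (σ.alg n)

/-- Finite isomorphism: for every `N` the fragments of length `N` are isomorphic. -/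
def FinIso {X Y : Type*} [MeasurableSpace X] [MeasurableSpace Y]
    (μ : Measure X) (τ : DecFiltration X) (ν : Measure Y) (σ : DecFiltration Y) : Prop :=
  ∀ N : ℕ, ∃ (f : X → Y) (g : Y → X), IsIsoMod0 μ ν f g ∧
    ∀ n ≤ N, CarriesMod0 μ f (τ.alg n) (σ.alg n)

/-- Ergodicity: the intersection of the σ-algebras is trivial mod 0. -/
def IsErgodicFilt {X : Type*} [MeasurableSpace X] (μ : Measure X) (τ : DecFiltration X) : Prop :=
  ∀ s, (∀ n, MeasurableSet[τ.alg n] s) → μ s = 0 ∨ μ sᶜ = 0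

/-- A Bernoulli filtration: the tail filtration of a sequence of independent random variables. -/
def IsBernoulliFilt {X : Type*} [MeasurableSpace X] (μ : Measure X)
    (τ : DecFiltration X) : Prop :=
  ∃ η : ℕ → X → ℝ, (∀ k, Measurable (η k)) ∧ iIndepFun η μ ∧
    ∀ n, CarriesMod0 μ id (τ.alg n)
      (⨆ (k : ℕ) (_ : n ≤ k), MeasurableSpace.comap (η k) inferInstance)

/-! ### Conditional measures, locally finite filtrations, measured trees -/

/-- The points of positive measure. -/
def atomSet {X : Type*} [MeasurableSpace X] (m : Measure X) : Set X := {y | m {y} ≠ 0}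

open Classical in
/-- The unordered family of the masses of the atoms (used for measures with finitely many
atoms). -/
def massType {X : Type*} [MeasurableSpace X] (m : Measure X) : Multiset ℝ≥0∞ :=
  if h : (atomSet m).Finite then h.toFinset.val.map (fun y => m {y}) else 0

/-- The conditional measure, on the element containing `x`, of the measurable partition `ξₙ` that
corresponds to `𝔄ₙ`.  Mod 0, two points lie in the same element of `ξₙ` if and only if
their conditional measures coincide, so an element of `ξₙ` can be identified with its
conditional measure. -/
def DecFiltration.cond {X : Type*} [MeasurableSpace X] [StandardBorelSpace X]
    (τ : DecFiltration X) (μ : Measure X) [IsProbabilityMeasure μ] (n : ℕ) (x : X) : Measure X :=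
  condExpKernel μ (τ.alg n) x

/-- Locally finite filtrations: for every `n`, almost all conditional measures of `ξₙ` are
concentrated on finitely many atoms, and there are finitely many types of them. -/
def IsLocallyFiniteFilt {X : Type*} [MeasurableSpace X] [StandardBorelSpace X]
    (μ : Measure X) [IsProbabilityMeasure μ] (τ : DecFiltration X) : Prop :=
  ∀ n, (∀ᵐ x ∂μ, (atomSet (τ.cond μ n x)).Finite ∧
      τ.cond μ n x (atomSet (τ.cond μ n x))ᶜ = 0) ∧
    ∃ F : Set (Multiset ℝ≥0∞), F.Finite ∧ ∀ᵐ x ∂μ, massType (τ.cond μ n x) ∈ F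

/-- An `{rₙ}`-adic filtration: the conditional measures of `ξₙ` are uniform on
`r₀ r₁ ⋯ rₙ₋₁` points. -/
def IsAdicFilt {X : Type*} [MeasurableSpace X] [StandardBorelSpace X]
    (μ : Measure X) [IsProbabilityMeasure μ] (τ : DecFiltration X) (r : ℕ → ℕ) : Prop :=
  IsLocallyFiniteFilt μ τ ∧
    ∀ n, ∀ᵐ x ∂μ, massType (τ.cond μ n x) =
      Multiset.replicate (∏ i ∈ Finset.range n, r i) ((∏ i ∈ Finset.range n, r i : ℕ) : ℝ≥0∞)⁻¹

/-- Isomorphism classes of finite rooted measured trees with leaves at depth `n`: such a tree is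
the unordered family of the subtrees hanging from its root, each of them with its weight and
with the conditional measure on its leaves. -/
def MTree : ℕ → Type
  | 0 => Unit
  | n + 1 => Multiset (ℝ≥0∞ × MTree n)

open Classical in
/-- The measured tree of an element of `ξₙ` with conditional measure `m`, i.e. the isomorphism
class of the hierarchy induced on it by `ξ₀, …, ξₙ₋₁`.  The subtrees of the root are the
elements of `ξₙ₋₁` (identified with their conditional measures `b`) contained in the given one. -/
def DecFiltration.tree {X : Type*} [MeasurableSpace X] [StandardBorelSpace X]
    (τ : DecFiltration X) (μ : Measure X) [IsProbabilityMeasure μ] :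
    (n : ℕ) → Measure X → MTree n
  | 0, _ => ()
  | n + 1, m =>
    if h : (τ.cond μ n '' atomSet m).Finite then
      (h.toFinset.val.map (fun b => (m {y | τ.cond μ n y = b}, DecFiltration.tree τ μ n b)) :
        Multiset (ℝ≥0∞ × MTree n))
    else (0 : Multiset (ℝ≥0∞ × MTree n))

/-- The type of the element of `ξₙ` that contains `x`. -/
def DecFiltration.typ {X : Type*} [MeasurableSpace X] [StandardBorelSpace X]
    (τ : DecFiltration X) (μ : Measure X) [IsProbabilityMeasure μ] (n : ℕ) (x : X) : MTree n :=
  τ.tree μ n (τ.cond μ n x)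

/-! ### Graded multigraphs with cotransition probabilities and their path spaces -/

/-- The data of a graded multigraph with numbers on its edges: `V n` is the `n`-th level, `E n`
is the set of edges that join `V n` to `V (n + 1)`. -/
structure GradedMultigraph where
  V : ℕ → Type
  E : ℕ → Type
  src : {n : ℕ} → E n → V n
  tgt : {n : ℕ} → E n → V (n + 1)
  cot : {n : ℕ} → E n → ℝ≥0∞

namespace GradedMultigraph

/-- The numbers on the edges are an equipment (a system of cotransition probabilities) of a
locally finite graded multigraph with one initial vertex, in which every vertex has a successor
and every vertex but the initial one has a predecessor. -/
structure IsEquipped (Γ : GradedMultigraph) : Prop where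
  finite_V : ∀ n, Finite (Γ.V n)
  finite_E : ∀ n, Finite (Γ.E n)
  initial : ∃! _v : Γ.V 0, True
  succ : ∀ n (u : Γ.V n), ∃ e : Γ.E n, Γ.src e = u
  pred : ∀ n (v : Γ.V (n + 1)), ∃ e : Γ.E n, Γ.tgt e = v
  cot_pos : ∀ n (e : Γ.E n), 0 < Γ.cot e
  cot_sum : ∀ n (v : Γ.V (n + 1)), ∑' e : {e : Γ.E n // Γ.tgt e = v}, Γ.cot e.1 = 1

open Classical in
/-- The measured tree (up to isomorphism), with root `v`, of the paths from the initial vertex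
to `v`. -/
def pathTree (Γ : GradedMultigraph) : (n : ℕ) → Γ.V n → MTree n
  | 0, _ => ()
  | n + 1, v =>
    if h : {e : Γ.E n | Γ.tgt e = v}.Finite then
      (h.toFinset.val.map (fun e => (Γ.cot e, pathTree Γ n (Γ.src e))) :
        Multiset (ℝ≥0∞ × MTree n))
    else (0 : Multiset (ℝ≥0∞ × MTree n))

/-- An equipped multigraph is minimal if the measured trees of paths leading to distinct vertices
of the same level are not isomorphic. -/
def IsMinimal (Γ : GradedMultigraph) : Prop :=
  ∀ n, Function.Injective (Γ.pathTree n)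

/-- The space `T(Γ)` of infinite paths. -/
def Path (Γ : GradedMultigraph) : Type :=
  {p : (n : ℕ) → Γ.E n // ∀ n, Γ.tgt (p n) = Γ.src (p (n + 1))}

/-- The σ-algebra generated by the edges of a path from level `n` on. -/
@[reducible] def tailAlg (Γ : GradedMultigraph) (n : ℕ) : MeasurableSpace Γ.Path :=
  ⨆ (k : ℕ) (_ : n ≤ k), MeasurableSpace.comap (fun p : Γ.Path => p.1 k) ⊤

instance (Γ : GradedMultigraph) : MeasurableSpace Γ.Path := Γ.tailAlg 0

/-- The tail filtration on the path space. -/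
def tail (Γ : GradedMultigraph) : DecFiltration Γ.Path where
  alg := Γ.tailAlg
  alg_zero := rfl
  anti := fun _ _ hmn => iSup₂_le fun k hk =>
    le_iSup₂ (f := fun (k : ℕ) (_ : _ ≤ k) =>
      MeasurableSpace.comap (fun p : Γ.Path => p.1 k) ⊤) k (hmn.trans hk)

/-- A probability measure on the path space agrees with the equipment: given the vertex of level
`n`, the conditional probability of an initial segment of a path is the product of the
cotransition probabilities of its edges. -/
def Agrees (Γ : GradedMultigraph) (ν : Measure Γ.Path) : Prop :=
  ∀ (q : Γ.Path) (n : ℕ), ν {p | ∀ i < n, p.1 i = q.1 i} =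
    (∏ i ∈ Finset.range n, Γ.cot (q.1 i)) * ν {p | Γ.src (p.1 n) = Γ.src (q.1 n)}

/-- Isomorphism of equipped graded multigraphs. -/
structure Iso (Γ Δ : GradedMultigraph) where
  onV : (n : ℕ) → Γ.V n ≃ Δ.V n
  onE : (n : ℕ) → Γ.E n ≃ Δ.E n
  src_comm : ∀ n (e : Γ.E n), Δ.src (onE n e) = onV n (Γ.src e)
  tgt_comm : ∀ n (e : Γ.E n), Δ.tgt (onE n e) = onV (n + 1) (Γ.tgt e)
  cot_comm : ∀ n (e : Γ.E n), Δ.cot (onE n e) = Γ.cot e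

/-- The map of path spaces induced by an isomorphism of graphs. -/
def Iso.onPath {Γ Δ : GradedMultigraph} (φ : Iso Γ Δ) (p : Γ.Path) : Δ.Path :=
  ⟨fun n => φ.onE n (p.1 n), fun n => by rw [φ.tgt_comm, φ.src_comm, p.2 n]⟩

end GradedMultigraph

/-! ### The minimal model -/

section

variable {X : Type*} [MeasurableSpace X] [StandardBorelSpace X]
  (μ : Measure X) [IsProbabilityMeasure μ] (τ : DecFiltration X)

open Classical in
/-- The multigraph `Γ(τ)`.  The vertices of level `n` are the types of elements of `ξₙ` that occur
with positive probability.  The edges that join `u` to `v` correspond to the subtrees of type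
`u` hanging from the root of `v` (counted with multiplicity), and the cotransition probability
of an edge is the weight of the subtree. -/
def minimalGraph : GradedMultigraph where
  V n := {t : MTree n // μ {x | τ.typ μ n x = t} ≠ 0}
  E n := (u : {t : MTree n // μ {x | τ.typ μ n x = t} ≠ 0}) ×
    (v : {t : MTree (n + 1) // μ {x | τ.typ μ (n + 1) x = t} ≠ 0}) ×
    (w : ℝ≥0∞) × Fin (Multiset.count (α := ℝ≥0∞ × MTree n) (w, u.1) v.1)
  src e := e.1
  tgt e := e.2.1
  cot e := e.2.2.1

/-- `ν` is a probability measure on the path space of `Γ(τ)` that agrees with the equipment, and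
the `ν`-measure of every vertex is the `μ`-measure of the set of points of the respective type. -/
structure IsMinimalMeasure (ν : Measure (minimalGraph μ τ).Path) : Prop where
  prob : IsProbabilityMeasure ν
  agrees : (minimalGraph μ τ).Agrees ν
  vertex : ∀ n (v : (minimalGraph μ τ).V n),
    ν {p | (minimalGraph μ τ).src (p.1 n) = v} = μ {x | τ.typ μ n x = v.1}

open Classical in
/-- The path measure of the minimal model (the measure determined by `IsMinimalMeasure`). -/
def minimalMeasure : Measure (minimalGraph μ τ).Path :=
  if h : ∃ ν, IsMinimalMeasure μ τ ν then h.choose else 0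

/-- The minimal model of `τ`, as a filtration: the tail filtration of `Γ(τ)`. -/
def minimalModel : DecFiltration (minimalGraph μ τ).Path := (minimalGraph μ τ).tail

end

/-- The minimal models of two filtrations, regarded as equipped multigraphs with measures on the
path spaces, coincide. -/
def SameMinimalModel {X Y : Type*} [MeasurableSpace X] [StandardBorelSpace X]
    [MeasurableSpace Y] [StandardBorelSpace Y]
    (μ : Measure X) [IsProbabilityMeasure μ] (τ : DecFiltration X)
    (μ' : Measure Y) [IsProbabilityMeasure μ'] (τ' : DecFiltration Y) : Prop :=
  ∃ φ : GradedMultigraph.Iso (minimalGraph μ τ) (minimalGraph μ' τ'),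
    (minimalMeasure μ τ).map φ.onPath = minimalMeasure μ' τ'

end

/-! The proof rests on codings (`IsCoding`). A coding of a fragment of `τ` by an equipped multigraph
attaches vertices `v n` and edges `e n` to the points so that, given the σ-algebra of level `n + 1`,
an edge ending at the current vertex has its cotransition probability as conditional probability,
and level `n` is generated mod 0 by level `n + 1` and `e n`. A coding by a multigraph with finite
edge sets and nonzero cotransition probabilities determines the conditional measures: inside an
element of level `n + 1` the edges distinguish the elements of level `n`, so the type of an element
is the tree of paths leading to its vertex (`IsCoding.ae_typ_eq`). Conversely, every locally finite
filtration is coded by `Γ(τ)` (`DecFiltration.isCoding_minimalGraph`): subtrees of equal weight and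
type are numbered measurably by means of a real code of the elements. The image measure on the path
space is the path measure of the minimal model, and the tail filtration is coded by its own edges.

Parts 1 and 2 follow from `IsCoding.exists_iso`: on atomless spaces, two fragments coded by the same
multigraph with the same law of the final vertex are isomorphic. The elements of level `N` are
finite, so level `N` is atomless on each vertex and can be described by a uniform coordinate; the
coordinate, the vertex and the edges then have the same joint law on both sides. Conversely, types
are invariant under isomorphisms, and their measures determine the minimal model. If `τ` is ergodic,
then over a single path every measurable set agrees with a tail set, so the fibre of the path is
indivisible and therefore null.

For adic and Bernoulli filtrations there is one vertex at each level; then the edges are independent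
and the minimal model is Bernoulli. If `τ` itself is Bernoulli, its independent variables are
discrete and serve as edges, so the path generates everything and the path map is an isomorphism.

The counterexample is a skew shift over three letters of distinct probabilities with an additional
Boolean coordinate. The weights recognize the letters, so an isomorphism with the minimal model
would be a function of the letters alone and could not see the Boolean coordinate. Ergodicity holds
because a single letter already flips that coordinate with probability one half. -/

/-! ### σ-algebras mod 0 -/

namespace DecFiltration

/-- The σ-algebra of the sets that coincide mod 0 with a set of `τ.alg n`. -/
@[reducible] def algMod {X : Type*} [MeasurableSpace X] (τ : DecFiltration X) (μ : Measure X)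
    (n : ℕ) : MeasurableSpace X :=
  eventuallyMeasurableSpace (τ.alg n) (ae μ)

section

variable {X : Type*} [mX : MeasurableSpace X] {μ : Measure X} {τ : DecFiltration X} {n m : ℕ}

lemma alg_le (τ : DecFiltration X) (n : ℕ) : τ.alg n ≤ mX :=
  (τ.anti (Nat.zero_le n)).trans τ.alg_zero.le

lemma alg_le_algMod (τ : DecFiltration X) (μ : Measure X) (n : ℕ) : τ.alg n ≤ τ.algMod μ n :=
  le_eventuallyMeasurableSpace

lemma algMod_anti (τ : DecFiltration X) (μ : Measure X) : Antitone (τ.algMod μ) := by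
  rintro a b hab s ⟨t, ht, hst⟩
  exact ⟨t, τ.anti hab _ ht, hst⟩

lemma nullMeasurableSet_of_algMod {s : Set X} (hs : MeasurableSet[τ.algMod μ n] s) :
    NullMeasurableSet s μ := by
  obtain ⟨t, ht, hst⟩ := hs
  exact ⟨t, τ.alg_le n _ ht, hst⟩

lemma algMod_congr {s t : Set X} (ht : MeasurableSet[τ.algMod μ n] t) (hst : s =ᵐ[μ] t) :
    MeasurableSet[τ.algMod μ n] s :=
  EventuallyMeasurableSet.congr ht hst

lemma algMod_zero_of_measurableSet {s : Set X} (hs : MeasurableSet s) :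
    MeasurableSet[τ.algMod μ 0] s :=
  ⟨s, by rw [τ.alg_zero]; exact hs, EventuallyEq.rfl⟩

end

/-! ### Conditional measures -/

section

variable {X : Type*} [mX : MeasurableSpace X] [StandardBorelSpace X]
  {μ : Measure X} [IsProbabilityMeasure μ] {τ : DecFiltration X} {n m : ℕ}

instance (τ : DecFiltration X) (μ : Measure X) [IsProbabilityMeasure μ] (n : ℕ) (x : X) :
    IsProbabilityMeasure (τ.cond μ n x) := by
  unfold DecFiltration.cond; infer_instance

lemma measurable_cond (τ : DecFiltration X) (μ : Measure X) [IsProbabilityMeasure μ] (n : ℕ)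
    {s : Set X} (hs : MeasurableSet s) : Measurable[τ.alg n] (fun x => τ.cond μ n x s) :=
  measurable_condExpKernel hs

lemma measurable_cond' (τ : DecFiltration X) (μ : Measure X) [IsProbabilityMeasure μ] (n : ℕ)
    {s : Set X} (hs : MeasurableSet s) : Measurable (fun x => τ.cond μ n x s) :=
  (measurable_cond τ μ n hs).mono (τ.alg_le n) le_rfl

/-- The defining property of conditional measures, read off from the disintegration of `μ` along the
diagonal by evaluating it on the rectangle `A ×ˢ s`. -/
lemma setLIntegral_cond {A s : Set X} (hA : MeasurableSet[τ.alg n] A) (hs : MeasurableSet s) :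
    ∫⁻ x in A, τ.cond μ n x s ∂μ = μ (A ∩ s) := by
  have hm := τ.alg_le n
  have h := compProd_trim_condExpKernel (μ := μ) hm
  have h2 := congrArg (fun M => M (A ×ˢ s)) h
  have hdiag : @Measurable X (X × X) mX ((τ.alg n).prod mX) Function.diag :=
    @Measurable.prodMk X mX X X (τ.alg n) mX id id (measurable_id'' hm) measurable_id
  have hprod : @MeasurableSet (X × X) ((τ.alg n).prod mX) (A ×ˢ s) :=
    @MeasurableSet.prod X X (τ.alg n) mX A s hA hs
  rw [Measure.map_apply hdiag hprod] at h2
  rw [@Measure.compProd_apply_prod X X (τ.alg n) mX _ _ _ _ A s hA hs] at h2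
  rw [restrict_trim hm _ hA, lintegral_trim hm (measurable_condExpKernel hs)] at h2
  refine h2.trans (congrArg μ ?_)
  ext x; simp

lemma lintegral_cond {s : Set X} (hs : MeasurableSet s) :
    ∫⁻ x, τ.cond μ n x s ∂μ = μ s := by
  simpa using setLIntegral_cond (μ := μ) (τ := τ) (n := n) (A := Set.univ)
    (@MeasurableSet.univ _ (τ.alg n)) hs

lemma ae_cond_ae {P : X → Prop} (h : ∀ᵐ y ∂μ, P y) (n : ℕ) :
    ∀ᵐ x ∂μ, ∀ᵐ y ∂(τ.cond μ n x), P y := by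
  set s := toMeasurable μ {y | ¬ P y}
  have hs : MeasurableSet s := measurableSet_toMeasurable _ _
  have h0 : ∫⁻ x, τ.cond μ n x s ∂μ = 0 := by
    rw [lintegral_cond hs, measure_toMeasurable]; exact h
  rw [lintegral_eq_zero_iff (measurable_cond' τ μ n hs)] at h0
  filter_upwards [h0] with x hx
  exact measure_mono_null (subset_toMeasurable _ _) hx

/-- Integrating the conditional measure of `Bᶜ` over `B` gives `μ (B ∩ Bᶜ) = 0`, so mod 0 each
element of the partition lies in `B` or in its complement. -/
lemma ae_cond_mem_iff {A : Set X} (hA : MeasurableSet[τ.algMod μ n] A) :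
    ∀ᵐ x ∂μ, ∀ᵐ y ∂(τ.cond μ n x), (y ∈ A ↔ x ∈ A) := by
  have key : ∀ B : Set X, MeasurableSet[τ.alg n] B →
      ∀ᵐ x ∂μ, x ∈ B → τ.cond μ n x Bᶜ = 0 := by
    intro B hB
    have hB' : MeasurableSet Bᶜ := (τ.alg_le n _ hB).compl
    have h0 : ∫⁻ x in B, τ.cond μ n x Bᶜ ∂μ = 0 := by
      rw [setLIntegral_cond hB hB']; simp
    rw [lintegral_eq_zero_iff (measurable_cond' τ μ n hB')] at h0
    exact (ae_restrict_iff' (τ.alg_le n _ hB)).1 h0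
  obtain ⟨B, hB, hAB⟩ := hA
  filter_upwards [key B hB, key Bᶜ hB.compl, hAB, ae_cond_ae (τ := τ) hAB n] with x h1 h2 h3 h4
  have h3' : x ∈ A ↔ x ∈ B := h3.to_iff
  by_cases hx : x ∈ B
  · filter_upwards [h4, h1 hx] with y hy hy'
    have : y ∈ A ↔ y ∈ B := hy.to_iff
    have hyB : y ∈ B := by simpa using hy'
    tauto
  · filter_upwards [h4, h2 hx] with y hy hy'
    have : y ∈ A ↔ y ∈ B := hy.to_iff
    have hyB : y ∉ B := by simpa using hy'
    tauto

/-- A countable separating family reduces this to `ae_cond_mem_iff` with a single null set. -/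
lemma ae_cond_eq_of_measurable {Z : Type*} [MeasurableSpace Z]
    [MeasurableSpace.CountablySeparated Z] {F : X → Z}
    (hF : Measurable[τ.algMod μ n] F) :
    ∀ᵐ x ∂μ, ∀ᵐ y ∂(τ.cond μ n x), F y = F x := by
  obtain ⟨S, hS, hsep⟩ := exists_seq_separating Z (p := MeasurableSet) MeasurableSet.univ Set.univ
  have : ∀ᵐ x ∂μ, ∀ i, ∀ᵐ y ∂(τ.cond μ n x), (F y ∈ S i ↔ F x ∈ S i) :=
    ae_all_iff.2 fun i => ae_cond_mem_iff (hF (hS i))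
  filter_upwards [this] with x hx
  filter_upwards [ae_all_iff.2 hx] with y hy
  exact hsep _ trivial _ trivial hy

/-- A real function that separates the elements of the `n`-th partition. -/
noncomputable def code (τ : DecFiltration X) (μ : Measure X) [IsProbabilityMeasure μ] (n : ℕ) (x : X) : ℝ :=
  embeddingReal (ℚ → ℝ≥0∞) fun q => τ.cond μ n x (embeddingReal X ⁻¹' Set.Iic (q : ℝ))

/-- A countable generating π-system: probability measures on `X` are compared through countably many
values, so that a.e. equalities of values combine into a.e. equality of measures. -/
lemma generateFrom_Iic_rat_comap :
    mX = MeasurableSpace.generateFrom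
      (Set.preimage (embeddingReal X) '' (⋃ a : ℚ, {Set.Iic (a : ℝ)})) := by
  rw [← MeasurableSpace.comap_generateFrom, ← Real.borel_eq_generateFrom_Iic_rat,
    ← BorelSpace.measurable_eq]
  exact (measurableEmbedding_embeddingReal X).comap_eq.symm

lemma isPiSystem_Iic_rat_comap :
    IsPiSystem (Set.preimage (embeddingReal X) '' (⋃ a : ℚ, {Set.Iic (a : ℝ)})) := by
  have := Real.isPiSystem_Iic_rat.comap (embeddingReal X)
  exact this

lemma measurable_code (τ : DecFiltration X) (μ : Measure X) [IsProbabilityMeasure μ] (n : ℕ) :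
    Measurable[τ.alg n] (τ.code μ n) := by
  refine (measurableEmbedding_embeddingReal _).measurable.comp ?_
  refine @measurable_pi_lambda _ _ _ (τ.alg n) _ _ fun q => ?_
  exact measurable_cond τ μ n ((measurableEmbedding_embeddingReal X).measurable measurableSet_Iic)

lemma code_eq_iff {x y : X} : τ.code μ n x = τ.code μ n y ↔ τ.cond μ n x = τ.cond μ n y := by
  constructor
  · intro h
    have h' := (measurableEmbedding_embeddingReal _).injective h
    refine ext_of_generate_finite _ generateFrom_Iic_rat_comap isPiSystem_Iic_rat_comap ?_ (by simp)
    rintro _ ⟨s, hs, rfl⟩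
    obtain ⟨q, hq⟩ := Set.mem_iUnion.1 hs
    rw [Set.mem_singleton_iff.1 hq]
    exact congrFun h' q
  · intro h; simp only [code, h]

lemma ae_cond_cond_eq (τ : DecFiltration X) (μ : Measure X) [IsProbabilityMeasure μ] (n : ℕ) :
    ∀ᵐ x ∂μ, ∀ᵐ y ∂(τ.cond μ n x), τ.cond μ n y = τ.cond μ n x := by
  have := ae_cond_eq_of_measurable (μ := μ) (τ := τ) (n := n)
    ((measurable_code τ μ n).mono (alg_le_algMod τ μ n) le_rfl)
  simpa only [code_eq_iff] using this

/-- The map `x ↦ cond n x s` is a function of the code. -/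
lemma measurable_cond_comap_code {s : Set X} (hs : MeasurableSet s) :
    Measurable[MeasurableSpace.comap (τ.code μ n) inferInstance] (fun x => τ.cond μ n x s) := by
  have : @Measurable _ _ (MeasurableSpace.comap (τ.code μ n) inferInstance) _
      (fun x => τ.cond μ n x) := by
    refine @Measurable.measure_of_isPiSystem_of_isProbabilityMeasure _ _
      (MeasurableSpace.comap (τ.code μ n) inferInstance) _ (fun x => τ.cond μ n x) _ _
      generateFrom_Iic_rat_comap isPiSystem_Iic_rat_comap ?_
    rintro _ ⟨s, hs, rfl⟩
    obtain ⟨q, hq⟩ := Set.mem_iUnion.1 hs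
    rw [Set.mem_singleton_iff.1 hq]
    have h1 : Measurable[MeasurableSpace.comap (τ.code μ n) inferInstance]
        (fun x => fun q : ℚ => τ.cond μ n x (embeddingReal X ⁻¹' Set.Iic (q : ℝ))) := by
      have he := measurableEmbedding_embeddingReal (ℚ → ℝ≥0∞)
      rw [measurable_iff_comap_le]
      conv_lhs => rw [← he.comap_eq, MeasurableSpace.comap_comp]
      exact le_rfl
    exact (measurable_pi_apply q).comp h1
  exact (Measure.measurable_coe hs).comp this

/-- Mod 0, every set of the `n`-th σ-algebra is determined by the code. -/
lemma exists_code_preimage {A : Set X} (hA : MeasurableSet[τ.algMod μ n] A) :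
    ∃ C : Set ℝ, MeasurableSet C ∧ A =ᵐ[μ] τ.code μ n ⁻¹' C := by
  obtain ⟨B, hB, hAB⟩ := hA
  -- Mod 0, `B` is the set of points whose conditional measure gives `B` full mass, and the
  -- conditional measure is a function of the code.
  have hm : MeasurableSet[MeasurableSpace.comap (τ.code μ n) inferInstance]
      ((fun x => τ.cond μ n x B) ⁻¹' {1}) :=
    measurable_cond_comap_code (τ.alg_le n _ hB) (measurableSet_singleton _)
  obtain ⟨C, hC, hC'⟩ := hm
  refine ⟨C, hC, ?_⟩
  rw [hC']
  refine hAB.trans ?_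
  filter_upwards [ae_cond_mem_iff (alg_le_algMod τ μ n _ hB)] with x hx
  refine propext ⟨fun h => ?_, fun h => ?_⟩
  · have h' : x ∈ B := h
    change τ.cond μ n x B = 1
    refine (prob_compl_eq_zero_iff (τ.alg_le n _ hB)).1 ?_
    filter_upwards [hx] with y hy
    simp [hy, h']
  · by_contra hx'
    have hx' : x ∉ B := hx'
    have : τ.cond μ n x B = 0 := by
      rw [← compl_compl B]
      filter_upwards [hx] with y hy
      simp [hy, hx']
    have h1 : τ.cond μ n x B = 1 := h
    simp [this] at h1

/-- The tower property. -/
lemma ae_cond_tower (τ : DecFiltration X) (μ : Measure X) [IsProbabilityMeasure μ] (h : n ≤ m) :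
    ∀ᵐ x ∂μ, ∀ s, MeasurableSet s → τ.cond μ m x s = ∫⁻ y, τ.cond μ n y s ∂(τ.cond μ m x) := by
  -- The mixture of the conditional measures of level `n` under that of level `m`. It suffices to
  -- compare it with the latter on the preimages of rational half-lines.
  set ρ : X → Measure X := fun x => (τ.cond μ m x).bind (fun y => τ.cond μ n y)
  have hmeas : Measurable (fun y => τ.cond μ n y) :=
    Measure.measurable_of_measurable_coe _ fun s hs => measurable_cond' τ μ n hs
  have hρ : ∀ x s, MeasurableSet s → ρ x s = ∫⁻ y, τ.cond μ n y s ∂(τ.cond μ m x) :=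
    fun x s hs => Measure.bind_apply hs hmeas.aemeasurable
  have hq : ∀ q : ℚ, ∀ᵐ x ∂μ, τ.cond μ m x (embeddingReal X ⁻¹' Set.Iic (q : ℝ)) =
      ρ x (embeddingReal X ⁻¹' Set.Iic (q : ℝ)) := by
    intro q
    set s := embeddingReal X ⁻¹' Set.Iic (q : ℝ)
    have hs : MeasurableSet s :=
      (measurableEmbedding_embeddingReal X).measurable measurableSet_Iic
    have hm := τ.alg_le m
    have hmm : Measurable[τ.alg m] (fun x => ρ x s) := by
      have h1 : Measurable[τ.alg m] (fun x => τ.cond μ m x) :=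
        @Measure.measurable_of_measurable_coe _ _ _ (τ.alg m) _ fun s hs => measurable_cond τ μ m hs
      simp only [hρ _ _ hs]
      exact (Measure.measurable_lintegral (measurable_cond' τ μ n hs)).comp h1
    have := @ae_eq_of_forall_setLIntegral_eq_of_sigmaFinite X (τ.alg m) (μ.trim hm) _
      (fun x => τ.cond μ m x s) (fun x => ρ x s) (measurable_cond τ μ m hs) hmm ?_
    · exact ae_eq_of_ae_eq_trim this
    intro A hA _
    rw [restrict_trim hm _ hA, lintegral_trim hm (measurable_cond τ μ m hs), lintegral_trim hm hmm,
      setLIntegral_cond hA hs]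
    -- `A` also belongs to the finer σ-algebra of level `n`, so both sides become integrals of the
    -- level `n` conditional mass over `A`; the indicator of `A` is constant on almost every element
    -- of level `m`.
    rw [← setLIntegral_cond (τ := τ) (n := n) (τ.anti h _ hA) hs]
    simp only [hρ _ _ hs]
    have hf : Measurable (fun y => A.indicator (fun y => τ.cond μ n y s) y) :=
      (measurable_cond' τ μ n hs).indicator (hm _ hA)
    rw [← lintegral_indicator (hm _ hA), ← lintegral_indicator (hm _ hA)]
    have hbind : ∀ f : X → ℝ≥0∞, Measurable f →
        ∫⁻ x, ∫⁻ y, f y ∂(τ.cond μ m x) ∂μ = ∫⁻ y, f y ∂μ := by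
      intro f hf
      have hmm' : Measurable (fun y => τ.cond μ m y) :=
        Measure.measurable_of_measurable_coe _ fun s hs => measurable_cond' τ μ m hs
      have : μ.bind (fun y => τ.cond μ m y) = μ := by
        ext s hs
        rw [Measure.bind_apply hs hmm'.aemeasurable, lintegral_cond hs]
      rw [← Measure.lintegral_bind hmm'.aemeasurable hf.aemeasurable, this]
    rw [← hbind _ hf]
    refine lintegral_congr_ae ?_
    filter_upwards [ae_cond_mem_iff (alg_le_algMod τ μ m _ hA)] with x hx
    by_cases hxA : x ∈ A
    · rw [Set.indicator_of_mem hxA]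
      refine lintegral_congr_ae ?_
      filter_upwards [hx] with y hy
      rw [Set.indicator_of_mem (hy.2 hxA)]
    · rw [Set.indicator_of_notMem hxA]
      refine (lintegral_congr_ae (g := fun _ => (0 : ℝ≥0∞)) ?_).trans lintegral_zero
      filter_upwards [hx] with y hy
      rw [Set.indicator_of_notMem (fun h => hxA (hy.1 h))]
  filter_upwards [ae_all_iff.2 hq] with x hx s hs
  have : τ.cond μ m x = ρ x := by
    have hprob : ρ x Set.univ = 1 := by
      rw [hρ _ _ MeasurableSet.univ]; simp
    have : IsProbabilityMeasure (ρ x) := ⟨hprob⟩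
    refine ext_of_generate_finite _ generateFrom_Iic_rat_comap isPiSystem_Iic_rat_comap ?_ (by simp)
    rintro _ ⟨s, hs, rfl⟩
    obtain ⟨q, hq⟩ := Set.mem_iUnion.1 hs
    rw [Set.mem_singleton_iff.1 hq]
    exact hx q
  rw [this, hρ x s hs]
  rw [← this]

end

end DecFiltration

/-! ### Isomorphisms mod 0 -/

/-- `CarriesMod0` is insensitive to null sets, so the σ-algebra of the source may be saturated by
them. -/
lemma carriesMod0_iff {X Y : Type*} {a : MeasurableSpace X} {b : MeasurableSpace Y}
    [MeasurableSpace X] {μ : Measure X} {f : X → Y} :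
    CarriesMod0 μ f a b ↔ (∀ s, MeasurableSet[b] s →
      MeasurableSet[eventuallyMeasurableSpace a (ae μ)] (f ⁻¹' s)) ∧
      ∀ t, MeasurableSet[eventuallyMeasurableSpace a (ae μ)] t →
        ∃ s, MeasurableSet[b] s ∧ f ⁻¹' s =ᵐ[μ] t := by
  constructor
  · rintro ⟨h1, h2⟩
    refine ⟨h1, ?_⟩
    rintro t ⟨t', ht', h⟩
    obtain ⟨s, hs, hs'⟩ := h2 t' ht'
    exact ⟨s, hs, hs'.trans h.symm⟩
  · rintro ⟨h1, h2⟩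
    exact ⟨h1, fun t ht => h2 t ⟨t, ht, EventuallyEq.rfl⟩⟩

namespace IsIsoMod0

variable {X Y : Type*} {a : MeasurableSpace X} {b : MeasurableSpace Y} [MeasurableSpace X] [MeasurableSpace Y] {μ : Measure X} {ν : Measure Y}
  {f : X → Y} {g : Y → X}

lemma symm (h : IsIsoMod0 μ ν f g) : IsIsoMod0 ν μ g f :=
  ⟨h.preserving_inv, h.preserving, h.right_inv, h.left_inv⟩

lemma preimage_preimage (h : IsIsoMod0 μ ν f g) (s : Set X) : f ⁻¹' (g ⁻¹' s) =ᵐ[μ] s := by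
  filter_upwards [h.left_inv] with x hx
  refine propext ⟨fun hs => ?_, fun hs => ?_⟩
  · have : g (f x) ∈ s := hs
    rwa [hx] at this
  · change g (f x) ∈ s
    rwa [hx]

lemma preimage_ae_eq (h : IsIsoMod0 μ ν f g) {s t : Set Y} (hst : s =ᵐ[ν] t) :
    f ⁻¹' s =ᵐ[μ] f ⁻¹' t :=
  h.preserving.quasiMeasurePreserving.preimage_ae_eq hst

lemma measure_preimage (h : IsIsoMod0 μ ν f g) {s : Set Y} (hs : NullMeasurableSet s ν) :
    μ (f ⁻¹' s) = ν s :=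
  h.preserving.measure_preimage hs

lemma carries_symm (h : IsIsoMod0 μ ν f g)
    (hc : CarriesMod0 μ f a b) : CarriesMod0 ν g b a := by
  constructor
  · intro s hs
    obtain ⟨t, ht, hst⟩ := hc.2 s hs
    refine ⟨t, ht, ?_⟩
    exact (h.symm.preimage_ae_eq hst.symm).trans (h.symm.preimage_preimage t)
  · intro t ht
    obtain ⟨s, hs, hst⟩ := hc.1 t ht
    exact ⟨s, hs, (h.symm.preimage_ae_eq hst.symm).trans (h.symm.preimage_preimage t)⟩

/-- Mod 0, the fibre over `y` is contained in the single point `g y`. -/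
lemma nullSingleton (h : IsIsoMod0 μ ν f g) [MeasurableSingletonClass Y]
    [NullSingletonClass μ] : NullSingletonClass ν := by
  refine ⟨fun y => ?_⟩
  rw [← h.preserving.measure_preimage (measurableSet_singleton y).nullMeasurableSet]
  have : f ⁻¹' {y} ≤ᵐ[μ] ({g y} : Set X) := by
    filter_upwards [h.left_inv] with x hx hxy
    have : f x = y := hxy
    rw [this] at hx
    exact hx.symm
  exact le_antisymm ((measure_mono_ae this).trans (measure_singleton _).le) zero_le

end IsIsoMod0

/-- A measurable map that generates the σ-algebra mod 0 is injective on a set of full measure. -/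
lemma exists_injOn_of_carries {X Z : Type*} [MeasurableSpace X] [MeasurableSpace.CountablySeparated X]
    [MeasurableSpace Z] {μ : Measure X} {Φ : X → Z}
    (h : ∀ t : Set X, MeasurableSet t → ∃ s, MeasurableSet s ∧ Φ ⁻¹' s =ᵐ[μ] t) :
    ∃ X₀ : Set X, MeasurableSet X₀ ∧ μ X₀ᶜ = 0 ∧ Set.InjOn Φ X₀ := by
  -- Each set of a countable separating family is matched by a preimage under `Φ`; off the union of
  -- the exceptional null sets `Φ` inherits the separation.
  obtain ⟨S, hS, hsep⟩ := exists_seq_separating X (p := MeasurableSet) MeasurableSet.univ Set.univ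
  choose B hB hBS using fun i => h (S i) (hS i)
  have hN : ∀ᵐ x ∂μ, ∀ i, (Φ x ∈ B i ↔ x ∈ S i) := ae_all_iff.2 fun i => (hBS i).mem_iff
  refine ⟨(toMeasurable μ {x | ¬ ∀ i, (Φ x ∈ B i ↔ x ∈ S i)})ᶜ,
    (measurableSet_toMeasurable _ _).compl, ?_, ?_⟩
  · rw [compl_compl, measure_toMeasurable]; exact hN
  · intro x hx y hy hxy
    have hx' : ∀ i, (Φ x ∈ B i ↔ x ∈ S i) := by
      by_contra hc; exact hx (subset_toMeasurable _ _ hc)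
    have hy' : ∀ i, (Φ y ∈ B i ↔ y ∈ S i) := by
      by_contra hc; exact hy (subset_toMeasurable _ _ hc)
    refine hsep _ trivial _ trivial fun i => ?_
    rw [← hx' i, ← hy' i, hxy]

/-- A measurable map from a standard Borel space that is injective mod 0 has an inverse mod 0. -/
lemma exists_inverse_of_injOn {X Z : Type*} [MeasurableSpace X] [StandardBorelSpace X] [Nonempty X]
    [MeasurableSpace Z] [StandardBorelSpace Z]
    {μ : Measure X} {Φ : X → Z} (hΦ : Measurable Φ) {X₀ : Set X}
    (hX₀ : MeasurableSet X₀) (h0 : μ X₀ᶜ = 0) (hinj : Set.InjOn Φ X₀) :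
    ∃ Θ : Z → X, Measurable Θ ∧ ∀ᵐ x ∂μ, Θ (Φ x) = x := by
  classical
  have : StandardBorelSpace X₀ := hX₀.standardBorel
  -- By the Lusin–Souslin theorem an injective measurable map of standard Borel spaces is an
  -- embedding, so its inverse extends measurably to all of `Z`.
  have hemb : MeasurableEmbedding (fun x : X₀ => Φ x) :=
    Measurable.measurableEmbedding (hΦ.comp measurable_subtype_coe)
      (fun a b hab => Subtype.ext (hinj a.2 b.2 hab))
  obtain ⟨Θ, hΘ, hΘ'⟩ := hemb.exists_measurable_extend (measurable_subtype_coe (p := (· ∈ X₀)))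
    (fun _ => inferInstance)
  refine ⟨Θ, hΘ, ?_⟩
  have : ∀ᵐ x ∂μ, x ∈ X₀ := h0
  filter_upwards [this] with x hx
  exact congrFun hΘ' ⟨x, hx⟩

/-- Two maps to a space `Z` with the same distribution that generate the σ-algebras mod 0 give rise
to an isomorphism mod 0; it carries to each other the preimages of the same σ-algebra of `Z`. -/
lemma exists_iso_of_map_eq {ι X Y Z : Type*} {a : ι → MeasurableSpace X}
    {b : ι → MeasurableSpace Y} {c : ι → MeasurableSpace Z} [MeasurableSpace X] [StandardBorelSpace X]
    [MeasurableSpace Y] [StandardBorelSpace Y] [mZ : MeasurableSpace Z]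
    [StandardBorelSpace Z]
    {μ : Measure X} [IsProbabilityMeasure μ] {ν : Measure Y} [IsProbabilityMeasure ν]
    {Φ : X → Z} {Ψ : Y → Z} (hΦ : Measurable Φ) (hΨ : Measurable Ψ)
    (hmap : μ.map Φ = ν.map Ψ)
    (hΦg : ∀ t : Set X, MeasurableSet t → ∃ s, MeasurableSet s ∧ Φ ⁻¹' s =ᵐ[μ] t)
    (hΨg : ∀ t : Set Y, MeasurableSet t → ∃ s, MeasurableSet s ∧ Ψ ⁻¹' s =ᵐ[ν] t) :
    ∃ (f : X → Y) (g : Y → X), IsIsoMod0 μ ν f g ∧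
      ∀ i, CarriesMod0 μ Φ (a i) (c i) → CarriesMod0 ν Ψ (b i) (c i) →
        CarriesMod0 μ f (a i) (b i) := by
  have hX : Nonempty X := nonempty_of_isProbabilityMeasure μ
  have hY : Nonempty Y := nonempty_of_isProbabilityMeasure ν
  obtain ⟨X₀, hX₀, hX0, hXi⟩ := exists_injOn_of_carries hΦg
  obtain ⟨Y₀, hY₀, hY0, hYi⟩ := exists_injOn_of_carries hΨg
  obtain ⟨Θ, hΘ, hΘΦ⟩ := exists_inverse_of_injOn hΦ hX₀ hX0 hXi
  obtain ⟨Ξ, hΞ, hΞΨ⟩ := exists_inverse_of_injOn hΨ hY₀ hY0 hYi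
  have hXm : Measure.map Θ (μ.map Φ) = μ := by
    rw [Measure.map_map hΘ hΦ]
    exact (Measure.map_congr (g := id) hΘΦ).trans Measure.map_id
  have hYm : Measure.map Ξ (ν.map Ψ) = ν := by
    rw [Measure.map_map hΞ hΨ]
    exact (Measure.map_congr (g := id) hΞΨ).trans Measure.map_id
  have hset : ∀ {u : Z → X}, Measurable u → MeasurableSet {z | Φ (u z) = z} := fun hu =>
    measurableSet_eq_fun (hΦ.comp hu) measurable_id
  have hset' : ∀ {u : Z → Y}, Measurable u → MeasurableSet {z | Ψ (u z) = z} := fun hu =>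
    measurableSet_eq_fun (hΨ.comp hu) measurable_id
  have hZ1 : ∀ᵐ z ∂(μ.map Φ), Φ (Θ z) = z := by
    rw [ae_map_iff hΦ.aemeasurable (hset hΘ)]
    filter_upwards [hΘΦ] with x hx; rw [hx]
  have hZ2 : ∀ᵐ z ∂(ν.map Ψ), Ψ (Ξ z) = z := by
    rw [ae_map_iff hΨ.aemeasurable (hset' hΞ)]
    filter_upwards [hΞΨ] with x hx; rw [hx]
  -- The set where `Ψ ∘ Ξ` is the identity has full measure for the common distribution, so almost
  -- all values of `Φ` are values of `Ψ`.
  have hXZ : ∀ᵐ x ∂μ, Ψ (Ξ (Φ x)) = Φ x := by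
    have := hZ2; rw [← hmap] at this
    exact ae_of_ae_map hΦ.aemeasurable this
  have hYZ : ∀ᵐ y ∂ν, Φ (Θ (Ψ y)) = Ψ y := by
    have := hZ1; rw [hmap] at this
    exact ae_of_ae_map hΨ.aemeasurable this
  refine ⟨Ξ ∘ Φ, Θ ∘ Ψ, ⟨⟨hΞ.comp hΦ, ?_⟩, ⟨hΘ.comp hΨ, ?_⟩, ?_, ?_⟩, ?_⟩
  · rw [← Measure.map_map hΞ hΦ, hmap, hYm]
  · rw [← Measure.map_map hΘ hΨ, ← hmap, hXm]
  · filter_upwards [hXZ, hΘΦ] with x hx hx'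
    simp only [Function.comp_apply, hx, hx']
  · filter_upwards [hYZ, hΞΨ] with x hx hx'
    simp only [Function.comp_apply, hx, hx']
  · intro i h1 h2
    have hpres : MeasurePreserving (Ξ ∘ Φ) μ ν :=
      ⟨hΞ.comp hΦ, by rw [← Measure.map_map hΞ hΦ, hmap, hYm]⟩
    have hpre : ∀ B : Set Z, (Ξ ∘ Φ) ⁻¹' (Ψ ⁻¹' B) =ᵐ[μ] Φ ⁻¹' B := by
      intro B
      filter_upwards [hXZ] with x hx
      change (Ψ (Ξ (Φ x)) ∈ B) = (Φ x ∈ B)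
      rw [hx]
    constructor
    · intro s hs
      obtain ⟨B, hB, hBs⟩ := h2.2 s hs
      obtain ⟨t, ht, hBt⟩ := h1.1 B hB
      refine ⟨t, ht, ?_⟩
      exact (hpres.quasiMeasurePreserving.preimage_ae_eq hBs.symm).trans ((hpre B).trans hBt)
    · intro t ht
      obtain ⟨B, hB, hBt⟩ := h1.2 t ht
      obtain ⟨s, hs, hBs⟩ := h2.1 B hB
      refine ⟨s, hs, ?_⟩
      exact (hpres.quasiMeasurePreserving.preimage_ae_eq hBs.symm).trans ((hpre B).trans hBt)

/-! ### Weights of the parts of an element and masses of points -/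

namespace DecFiltration

variable {X : Type*} [mX : MeasurableSpace X] [StandardBorelSpace X]
  {μ : Measure X} [IsProbabilityMeasure μ] {τ : DecFiltration X} {n m : ℕ}

/-- For a null measurable set `s`, the function `x ↦ cond n x s` coincides a.e. with an
`alg n`-measurable function. -/
lemma ae_cond_congr {s t : Set X} (h : s =ᵐ[μ] t) :
    ∀ᵐ x ∂μ, τ.cond μ n x s = τ.cond μ n x t := by
  filter_upwards [ae_cond_ae (τ := τ) h n] with x hx
  exact measure_congr hx

/-- Conditional masses are determined by their averages over the sets of the σ-algebra. The density
needed later is constant on one set and zero elsewhere. -/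
lemma ae_cond_eq_of_forall {s C : Set X} {c : ℝ≥0∞} (hs : NullMeasurableSet s μ)
    (hC : MeasurableSet[τ.algMod μ n] C)
    (h : ∀ A, MeasurableSet[τ.algMod μ n] A → μ (A ∩ s) = c * μ (A ∩ C)) :
    ∀ᵐ x ∂μ, τ.cond μ n x s = C.indicator (fun _ => c) x := by
  obtain ⟨t, ht, hst⟩ := hs
  obtain ⟨D, hD, hCD⟩ := hC
  have hm := τ.alg_le n
  have h1 : (fun x => τ.cond μ n x t) =ᵐ[μ] D.indicator (fun _ => c) := by
    refine ae_eq_of_ae_eq_trim (hm := hm) (@ae_eq_of_forall_setLIntegral_eq_of_sigmaFinite X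
      (τ.alg n) (μ.trim hm) _ _ _ (measurable_cond τ μ n ht)
      ((@measurable_const _ _ _ (τ.alg n) c).indicator hD) ?_)
    intro A hA _
    rw [restrict_trim hm _ hA, lintegral_trim hm (measurable_cond τ μ n ht),
      lintegral_trim hm ((@measurable_const _ _ _ (τ.alg n) c).indicator hD),
      setLIntegral_cond hA ht, lintegral_indicator (hm _ hD), lintegral_const,
      Measure.restrict_apply MeasurableSet.univ, Measure.restrict_apply' (hm _ hA)]
    have := h A (alg_le_algMod τ μ n _ hA)
    rw [measure_congr ((EventuallyEq.refl _ A).inter hst),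
      measure_congr ((EventuallyEq.refl _ A).inter hCD)] at this
    rw [this, Set.univ_inter, Set.inter_comm]
  filter_upwards [h1, ae_cond_congr (n := n) (τ := τ) hst, hCD.mem_iff] with x hx1 hx2 hx3
  rw [hx2, hx1]
  by_cases hx : x ∈ C
  · rw [Set.indicator_of_mem hx, Set.indicator_of_mem (hx3.1 hx)]
  · rw [Set.indicator_of_notMem hx, Set.indicator_of_notMem (fun h => hx (hx3.2 h))]

lemma ae_cond_zero_self (τ : DecFiltration X) (μ : Measure X) [IsProbabilityMeasure μ] :
    ∀ᵐ x ∂μ, τ.cond μ 0 x {x} = 1 := by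
  have h := ae_cond_eq_of_measurable (μ := μ) (τ := τ) (n := 0) (F := (id : X → X))
    (fun s hs => algMod_zero_of_measurableSet hs)
  filter_upwards [h] with x hx
  refine (prob_compl_eq_zero_iff (measurableSet_singleton x)).1 ?_
  exact hx

/-- The conditional measure, given the element of the `n + 1`-st partition, of the element of the
`n`-th one that contains `x`. -/
noncomputable def weight (τ : DecFiltration X) (μ : Measure X) [IsProbabilityMeasure μ] (n : ℕ)
    (x : X) : ℝ≥0∞ :=
  τ.cond μ (n + 1) x {y | τ.cond μ n y = τ.cond μ n x}

lemma measurableSet_cond_eq (τ : DecFiltration X) (μ : Measure X) [IsProbabilityMeasure μ] (n : ℕ)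
    (x : X) : MeasurableSet {y | τ.cond μ n y = τ.cond μ n x} := by
  simp only [← code_eq_iff]
  exact (measurable_code τ μ n).mono (τ.alg_le n) le_rfl (measurableSet_singleton (τ.code μ n x))

/-- In the tower property only the part containing `x` contributes to the mass of `{x}`: the
conditional measures of the other parts do not charge `x`. -/
lemma ae_cond_succ_singleton (τ : DecFiltration X) (μ : Measure X) [IsProbabilityMeasure μ]
    (n : ℕ) : ∀ᵐ x ∂μ, τ.cond μ (n + 1) x {x} = τ.weight μ n x * τ.cond μ n x {x} := by
  filter_upwards [ae_cond_tower τ μ (Nat.le_succ n),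
    ae_cond_ae (τ := τ) (ae_cond_cond_eq τ μ n) (n + 1)] with x hx hx2
  rw [hx _ (measurableSet_singleton x)]
  have : ∫⁻ y, τ.cond μ n y {x} ∂τ.cond μ (n + 1) x =
      ∫⁻ y, Set.indicator {y | τ.cond μ n y = τ.cond μ n x} (fun _ => τ.cond μ n x {x}) y
        ∂τ.cond μ (n + 1) x := by
    refine lintegral_congr_ae ?_
    filter_upwards [hx2] with y hy
    by_cases hxy : τ.cond μ n y = τ.cond μ n x
    · rw [Set.indicator_of_mem (by exact hxy), hxy]
    · rw [Set.indicator_of_notMem (by exact hxy)]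
      refine measure_mono_null ?_ hy
      rintro _ rfl h
      exact hxy h.symm
  rw [this, lintegral_indicator (measurableSet_cond_eq τ μ n x), lintegral_const,
    Measure.restrict_apply MeasurableSet.univ, Set.univ_inter, mul_comm]
  rfl

lemma ae_cond_singleton (τ : DecFiltration X) (μ : Measure X) [IsProbabilityMeasure μ]
    (n : ℕ) : ∀ᵐ x ∂μ, τ.cond μ n x {x} = ∏ i ∈ Finset.range n, τ.weight μ i x := by
  induction n with
  | zero => simpa using ae_cond_zero_self τ μ
  | succ n ih =>
    filter_upwards [ih, ae_cond_succ_singleton τ μ n] with x h1 h2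
    rw [h2, h1, Finset.prod_range_succ, mul_comm]

end DecFiltration

/-! ### Measures with finitely many atoms -/

section Atoms

variable {X : Type*} [MeasurableSpace X] {m : Measure X}

lemma mem_of_mem_atomSet {G : Set X} (hG : m Gᶜ = 0) {y : X} (hy : y ∈ atomSet m) : y ∈ G := by
  by_contra h
  exact hy (measure_mono_null (Set.singleton_subset_iff.2 h) hG)

lemma forall_atomSet_of_ae {P : X → Prop} (h : ∀ᵐ y ∂m, P y) : ∀ y ∈ atomSet m, P y :=
  fun _ hy => mem_of_mem_atomSet (G := {y | P y}) h hy

lemma ae_of_forall_atomSet (h0 : m (atomSet m)ᶜ = 0) {P : X → Prop}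
    (h : ∀ y ∈ atomSet m, P y) : ∀ᵐ y ∂m, P y :=
  measure_mono_null (fun y hy hya => hy (h y hya)) h0

lemma exists_atom_of_measure_ne_zero (h0 : m (atomSet m)ᶜ = 0) {s : Set X} (hs : m s ≠ 0) :
    ∃ y ∈ atomSet m, y ∈ s := by
  by_contra! h
  exact hs (measure_mono_null (fun y hy hya => h y hya hy) h0)

lemma atomSet_finite_of_finite {G : Set X} (hG : G.Finite) (h : m Gᶜ = 0) :
    (atomSet m).Finite ∧ m (atomSet m)ᶜ = 0 := by
  have hsub : atomSet m ⊆ G := fun y hy => mem_of_mem_atomSet h hy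
  refine ⟨hG.subset hsub, ?_⟩
  have : (atomSet m)ᶜ ⊆ Gᶜ ∪ ⋃ y ∈ G \ atomSet m, {y} := by
    intro y hy
    by_cases hyG : y ∈ G
    · exact Or.inr (by simp; exact ⟨hyG, hy⟩)
    · exact Or.inl hyG
  refine measure_mono_null this (measure_union_null h ?_)
  refine (measure_biUnion_null_iff (hG.subset Set.sdiff_subset).countable).2 fun y hy => ?_
  by_contra hne
  exact hy.2 hne

open Classical in
lemma measure_eq_sum_atoms [MeasurableSingletonClass X] (hfin : (atomSet m).Finite)
    (h0 : m (atomSet m)ᶜ = 0) (s : Set X) :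
    m s = ∑ y ∈ hfin.toFinset, if y ∈ s then m {y} else 0 := by
  have h1 : m s = m (s ∩ atomSet m) := by
    refine le_antisymm ?_ (measure_mono Set.inter_subset_left)
    calc m s ≤ m (s ∩ atomSet m ∪ (atomSet m)ᶜ) := by
          refine measure_mono fun y hy => ?_
          by_cases h : y ∈ atomSet m
          · exact Or.inl ⟨hy, h⟩
          · exact Or.inr h
      _ ≤ _ := (measure_union_le _ _).trans (by rw [h0, add_zero])
  have h2 : s ∩ atomSet m = ((hfin.toFinset.filter (· ∈ s) : Finset X) : Set X) := by
    ext y; simp [and_comm]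
  rw [h1, h2, ← sum_measure_singleton, Finset.sum_filter]

end Atoms

/-- All these multisets lie below `K` copies of the finite set `M`, and lower intervals of multisets
are finite. -/
lemma multiset_finite_of_card_le {α : Type*} {M : Set α} (hM : M.Finite) (K : ℕ) :
    {s : Multiset α | (∀ a ∈ s, a ∈ M) ∧ s.card ≤ K}.Finite := by
  classical
  refine (Set.finite_Iic (K • hM.toFinset.val)).subset ?_
  rintro s ⟨hs, hK⟩
  rw [Set.mem_Iic, Multiset.le_iff_count]
  intro a
  by_cases ha : a ∈ s
  · rw [Multiset.count_nsmul, Multiset.count_eq_one_of_mem hM.toFinset.nodup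
      (by simpa using hs a ha), mul_one]
    exact (Multiset.count_le_card _ _).trans hK
  · simp [Multiset.count_eq_zero_of_notMem ha]

/-! ### Codings of filtrations by equipped multigraphs -/

/-- The maps `v n`, `e n` code the fragment of length `N` of the filtration `τ` by paths of the
equipped multigraph `Γ`: the `n`-th σ-algebra is generated by `e n` and the next one, and the
conditional distribution of `e n` given the next σ-algebra is given by the equipment. -/
structure IsCoding {X : Type*} [MeasurableSpace X] (μ : Measure X) (τ : DecFiltration X)
    (Γ : GradedMultigraph) (N : ℕ) (v : (n : ℕ) → X → Γ.V n) (e : (n : ℕ) → X → Γ.E n) :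
    Prop where
  meas_v : ∀ n ≤ N, ∀ a, MeasurableSet[τ.algMod μ n] (v n ⁻¹' {a})
  meas_e : ∀ n < N, ∀ a, MeasurableSet[τ.algMod μ n] (e n ⁻¹' {a})
  src : ∀ n < N, ∀ᵐ x ∂μ, Γ.src (e n x) = v n x
  tgt : ∀ n < N, ∀ᵐ x ∂μ, Γ.tgt (e n x) = v (n + 1) x
  law : ∀ n < N, ∀ a A, MeasurableSet[τ.algMod μ (n + 1)] A →
    μ (A ∩ e n ⁻¹' {a}) = Γ.cot a * μ (A ∩ v (n + 1) ⁻¹' {Γ.tgt a})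
  gen : ∀ n < N, ∀ a A, MeasurableSet[τ.algMod μ n] A →
    ∃ B, MeasurableSet[τ.algMod μ (n + 1)] B ∧ (A ∩ e n ⁻¹' {a} : Set X) =ᵐ[μ] (B ∩ e n ⁻¹' {a} : Set X)

/-- The edge sets are finite and the cotransition probabilities do not vanish. -/
structure GradedMultigraph.IsFinitePos (Γ : GradedMultigraph) : Prop where
  finite_E : ∀ n, Finite (Γ.E n)
  cot_ne : ∀ n (e : Γ.E n), Γ.cot e ≠ 0

namespace IsCoding

section

variable {X : Type*} [mX : MeasurableSpace X] {μ : Measure X} {τ : DecFiltration X}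
  {Γ : GradedMultigraph} {N : ℕ} {v : (n : ℕ) → X → Γ.V n} {e : (n : ℕ) → X → Γ.E n}

/-- Codings are transported by isomorphisms mod 0. -/
lemma comp_iso {Y : Type*} [MeasurableSpace Y] {ν : Measure Y} {σ : DecFiltration Y}
    (h : IsCoding μ τ Γ N v e) {f : Y → X} {g : X → Y} (hf : IsIsoMod0 ν μ f g)
    (hc : ∀ n ≤ N, CarriesMod0 ν f (σ.alg n) (τ.alg n)) :
    IsCoding ν σ Γ N (fun n y => v n (f y)) (fun n y => e n (f y)) := by
  have hpre : ∀ n ≤ N, ∀ s, MeasurableSet[τ.algMod μ n] s →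
      MeasurableSet[σ.algMod ν n] (f ⁻¹' s) := by
    rintro n hn s ⟨t, ht, hst⟩
    obtain ⟨u, hu, htu⟩ := (hc n hn).1 t ht
    exact ⟨u, hu, (hf.preimage_ae_eq hst).trans htu⟩
  have hpre' : ∀ n ≤ N, ∀ s, MeasurableSet[σ.algMod ν n] s →
      ∃ t, MeasurableSet[τ.algMod μ n] t ∧ s =ᵐ[ν] f ⁻¹' t := by
    rintro n hn s ⟨t, ht, hst⟩
    obtain ⟨u, hu, htu⟩ := (hc n hn).2 t ht
    exact ⟨u, τ.alg_le_algMod μ n _ hu, hst.trans htu.symm⟩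
  refine ⟨fun n hn a => hpre n hn _ (h.meas_v n hn a), fun n hn a => hpre n hn.le _ (h.meas_e n hn a),
    fun n hn => hf.preserving.quasiMeasurePreserving.ae (h.src n hn),
    fun n hn => hf.preserving.quasiMeasurePreserving.ae (h.tgt n hn), ?_, ?_⟩
  · intro n hn a A hA
    obtain ⟨B, hB, hAB⟩ := hpre' (n + 1) hn A hA
    have h1 := h.law n hn a B hB
    have hn1 : NullMeasurableSet (B ∩ e n ⁻¹' {a}) μ :=
      (τ.nullMeasurableSet_of_algMod hB).inter (τ.nullMeasurableSet_of_algMod (h.meas_e n hn a))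
    have hn2 : NullMeasurableSet (B ∩ v (n + 1) ⁻¹' {Γ.tgt a}) μ :=
      (τ.nullMeasurableSet_of_algMod hB).inter (τ.nullMeasurableSet_of_algMod (h.meas_v (n + 1) hn _))
    rw [← hf.measure_preimage hn1, ← hf.measure_preimage hn2] at h1
    have e1 : ν (A ∩ (fun y => e n (f y)) ⁻¹' {a}) = ν (f ⁻¹' (B ∩ e n ⁻¹' {a})) :=
      measure_congr (hAB.inter (EventuallyEq.refl _ _))
    have e2 : ν (A ∩ (fun y => v (n + 1) (f y)) ⁻¹' {Γ.tgt a}) =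
        ν (f ⁻¹' (B ∩ v (n + 1) ⁻¹' {Γ.tgt a})) :=
      measure_congr (hAB.inter (EventuallyEq.refl _ _))
    rw [e1, e2, h1]
  · intro n hn a A hA
    obtain ⟨A', hA', hAA⟩ := hpre' n hn.le A hA
    obtain ⟨B, hB, hBA⟩ := h.gen n hn a A' hA'
    refine ⟨f ⁻¹' B, hpre _ hn _ hB, ?_⟩
    exact (hAA.inter (EventuallyEq.refl _ _)).trans (hf.preimage_ae_eq hBA)

/-- The conditional probabilities of initial segments of paths. -/
lemma law_cyl (h : IsCoding μ τ Γ N v e) {n : ℕ} (hn : n ≤ N) (q : (i : ℕ) → Γ.E i)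
    (w : (i : ℕ) → Γ.V i) (hs : ∀ i < n, Γ.src (q i) = w i) (ht : ∀ i < n, Γ.tgt (q i) = w (i + 1))
    {A : Set X} (hA : MeasurableSet[τ.algMod μ n] A) (h0 : n = 0 → ∀ᵐ x ∂μ, v 0 x = w 0) :
    μ (A ∩ {x | ∀ i < n, e i x = q i}) =
      (∏ i ∈ Finset.range n, Γ.cot (q i)) * μ (A ∩ v n ⁻¹' {w n}) := by
  induction n generalizing A with
  | zero =>
    simp only [not_lt_zero, IsEmpty.forall_iff, implies_true, Set.ofPred_true, Set.inter_univ,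
      Finset.range_zero, Finset.prod_empty, one_mul]
    refine measure_congr ?_
    filter_upwards [h0 rfl] with x hx
    refine propext ⟨fun h => ⟨h, hx⟩, fun h => h.1⟩
  | succ n ih =>
    have e1 : A ∩ {x | ∀ i < n + 1, e i x = q i} =
        (A ∩ e n ⁻¹' {q n}) ∩ {x | ∀ i < n, e i x = q i} := by
      ext x
      simp only [Set.mem_inter_iff, Set.mem_ofPred_eq, Nat.forall_lt_succ_right, Set.mem_preimage,
        Set.mem_singleton_iff]
      tauto
    have hA' : MeasurableSet[τ.algMod μ n] (A ∩ e n ⁻¹' {q n}) :=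
      (τ.algMod_anti μ (Nat.le_succ n) _ hA).inter (h.meas_e n hn _)
    have e2 : (A ∩ e n ⁻¹' {q n} ∩ v n ⁻¹' {w n} : Set X) =ᵐ[μ] (A ∩ e n ⁻¹' {q n} : Set X) := by
      filter_upwards [h.src n hn] with x hx
      refine propext ⟨fun h => h.1, fun h => ⟨h, ?_⟩⟩
      have h2 : e n x = q n := h.2
      change v n x = w n
      rw [← hx, h2, hs n (Nat.lt_succ_self n)]
    -- For `n = 0` the induction hypothesis would require the assumption on the initial vertex,
    -- which is only available when the word is empty; the passage from length 0 to length 1 follows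
    -- directly from `law`.
    rcases Nat.eq_zero_or_pos n with rfl | hpos
    · rw [e1]
      have e3 : A ∩ e 0 ⁻¹' {q 0} ∩ {x | ∀ i < 0, e i x = q i} = A ∩ e 0 ⁻¹' {q 0} := by
        ext x; simp
      rw [e3, h.law 0 hn _ _ hA, ht 0 (Nat.lt_succ_self 0)]
      simp
    · rw [e1, ih (Nat.le_of_succ_le hn) (fun i hi => hs i (hi.trans (Nat.lt_succ_self n)))
        (fun i hi => ht i (hi.trans (Nat.lt_succ_self n))) hA' (fun h => by omega),
        measure_congr e2, h.law n hn _ _ hA, ht n (Nat.lt_succ_self n), Finset.prod_range_succ,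
        mul_assoc]

/-- Mod 0, on an initial cylinder every set belongs to the `n`-th σ-algebra. -/
lemma gen_cyl (h : IsCoding μ τ Γ N v e) {n : ℕ} (hn : n ≤ N) (q : (i : ℕ) → Γ.E i)
    {A : Set X} (hA : MeasurableSet[τ.algMod μ 0] A) :
    ∃ B, MeasurableSet[τ.algMod μ n] B ∧
      (A ∩ {x | ∀ i < n, e i x = q i} : Set X) =ᵐ[μ] (B ∩ {x | ∀ i < n, e i x = q i} : Set X) := by
  induction n with
  | zero => exact ⟨A, hA, EventuallyEq.rfl⟩
  | succ n ih =>
    obtain ⟨B, hB, hAB⟩ := ih (Nat.le_of_succ_le hn)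
    obtain ⟨C, hC, hBC⟩ := h.gen n hn (q n) B hB
    refine ⟨C, hC, ?_⟩
    filter_upwards [hAB.mem_iff, hBC.mem_iff] with x h1 h2
    simp only [Set.mem_inter_iff, Set.mem_ofPred_eq, Set.mem_preimage, Set.mem_singleton_iff] at h1 h2
    refine propext ?_
    change (x ∈ A ∧ ∀ i < n + 1, e i x = q i) ↔ (x ∈ C ∧ ∀ i < n + 1, e i x = q i)
    rw [Nat.forall_lt_succ_right]
    tauto

end

section

variable {X : Type*} [mX : MeasurableSpace X] [StandardBorelSpace X] {μ : Measure X}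
  [IsProbabilityMeasure μ] {τ : DecFiltration X}
  {Γ : GradedMultigraph} {N : ℕ} {v : (n : ℕ) → X → Γ.V n} {e : (n : ℕ) → X → Γ.E n}

lemma ae_cond_edge (h : IsCoding μ τ Γ N v e) (hΓ : Γ.IsFinitePos) {n : ℕ} (hn : n < N) :
    ∀ᵐ x ∂μ, ∀ a : Γ.E n, τ.cond μ (n + 1) x (e n ⁻¹' {a}) =
      (v (n + 1) ⁻¹' {Γ.tgt a}).indicator (fun _ => Γ.cot a) x := by
  have := hΓ.finite_E n
  refine ae_all_iff.2 fun a => ?_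
  exact DecFiltration.ae_cond_eq_of_forall (τ.nullMeasurableSet_of_algMod (h.meas_e n hn a))
    (h.meas_v (n + 1) hn _) fun A hA => h.law n hn a A hA

lemma ae_cond_edge_const (h : IsCoding μ τ Γ N v e) (hΓ : Γ.IsFinitePos) {n : ℕ} (hn : n < N) :
    ∀ᵐ x ∂μ, ∀ᵐ y ∂(τ.cond μ n x), e n y = e n x := by
  have := hΓ.finite_E n
  have := ae_all_iff.2 fun a => DecFiltration.ae_cond_mem_iff (h.meas_e n hn a)
  filter_upwards [this] with x hx
  filter_upwards [hx (e n x)] with y hy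
  exact hy.2 rfl

/-- In almost every element of the `n + 1`-st partition, the elements of the `n`-th partition are
distinguished by the edges. -/
lemma ae_exists_edge_iff (h : IsCoding μ τ Γ N v e) (hΓ : Γ.IsFinitePos) {n : ℕ} (hn : n < N) :
    ∀ᵐ x ∂μ, ∃ G : Set X, τ.cond μ (n + 1) x Gᶜ = 0 ∧ x ∈ G ∧
      ∀ y ∈ G, ∀ y' ∈ G, (e n y = e n y' ↔ τ.cond μ n y = τ.cond μ n y') := by
  have := hΓ.finite_E n
  -- On the fibre of an edge, `gen` replaces sets of level `n` by sets of level `n + 1`, which are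
  -- constant on an element of level `n + 1`. Applied to countably many sets separating the values
  -- of the code, this shows that in such an element the edge determines the code.
  obtain ⟨S, hS, hsep⟩ := exists_seq_separating ℝ (p := MeasurableSet) MeasurableSet.univ Set.univ
  have hA : ∀ j, MeasurableSet[τ.algMod μ n] (τ.code μ n ⁻¹' S j) := fun j =>
    τ.alg_le_algMod μ n _ (τ.measurable_code μ n (hS j))
  choose B hB hAB using fun j a => h.gen n hn a _ (hA j)
  have hgood : ∀ᵐ y ∂μ, (∀ᵐ z ∂(τ.cond μ n y), e n z = e n y) ∧
      ∀ j a, e n y = a → (τ.code μ n y ∈ S j ↔ y ∈ B j a) := by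
    have h2 : ∀ᵐ y ∂μ, ∀ j a, e n y = a → (τ.code μ n y ∈ S j ↔ y ∈ B j a) := by
      refine ae_all_iff.2 fun j => ae_all_iff.2 fun a => ?_
      filter_upwards [(hAB j a).mem_iff] with y hy hya
      simp only [Set.mem_inter_iff, Set.mem_preimage, Set.mem_singleton_iff, hya, and_true] at hy
      exact hy
    exact (h.ae_cond_edge_const hΓ hn).and h2
  have hB' : ∀ᵐ x ∂μ, ∀ᵐ y ∂(τ.cond μ (n + 1) x), ∀ j a, (y ∈ B j a ↔ x ∈ B j a) := by
    have : ∀ᵐ x ∂μ, ∀ j a, ∀ᵐ y ∂(τ.cond μ (n + 1) x), (y ∈ B j a ↔ x ∈ B j a) :=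
      ae_all_iff.2 fun j => ae_all_iff.2 fun a => DecFiltration.ae_cond_mem_iff (hB j a)
    filter_upwards [this] with x hx
    exact ae_all_iff.2 fun j => ae_all_iff.2 fun a => hx j a
  filter_upwards [hgood, hB', DecFiltration.ae_cond_ae (τ := τ) hgood (n + 1)] with x h1 h2 h3
  refine ⟨{y | ((∀ᵐ z ∂(τ.cond μ n y), e n z = e n y) ∧
      ∀ j a, e n y = a → (τ.code μ n y ∈ S j ↔ y ∈ B j a)) ∧ ∀ j a, (y ∈ B j a ↔ x ∈ B j a)},
    h3.and h2, ⟨h1, fun _ _ => Iff.rfl⟩, ?_⟩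
  rintro y ⟨⟨hy1, hy2⟩, hy3⟩ y' ⟨⟨hy1', hy2'⟩, hy3'⟩
  constructor
  · intro he
    rw [← DecFiltration.code_eq_iff]
    refine hsep _ trivial _ trivial fun j => ?_
    rw [hy2 j _ rfl, hy2' j _ rfl, he, hy3, hy3']
  -- The common conditional measure is concentrated both on the edge of `y` and on that of `y'`, so
  -- some point carries both.
  · intro hc
    rw [hc] at hy1
    obtain ⟨z, hz, hz'⟩ := (hy1.and hy1').exists
    rw [← hz, hz']

/-- The part containing `x` is, mod 0, the fibre of the edge `e n x`. The weight depends on the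
filtration only, so all codings of this kind show the same cotransition probabilities along a.e.
point; `SkewShift.not_filtIso` exploits this. -/
lemma ae_weight_eq (h : IsCoding μ τ Γ N v e) (hΓ : Γ.IsFinitePos) {n : ℕ} (hn : n < N) :
    ∀ᵐ x ∂μ, τ.weight μ n x = Γ.cot (e n x) := by
  filter_upwards [h.ae_exists_edge_iff hΓ hn, h.ae_cond_edge hΓ hn, h.tgt n hn]
    with x ⟨G, hG, hxG, hG'⟩ h2 h3
  have : τ.weight μ n x = τ.cond μ (n + 1) x (e n ⁻¹' {e n x}) := by
    refine measure_congr ?_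
    have hG : ∀ᵐ y ∂(τ.cond μ (n + 1) x), y ∈ G := hG
    filter_upwards [hG] with y hy
    exact propext (hG' y hy x hxG).symm
  rw [this, h2, Set.indicator_of_mem]
  exact h3.symm

lemma ae_cond_singleton_eq (h : IsCoding μ τ Γ N v e) (hΓ : Γ.IsFinitePos) {n : ℕ} (hn : n ≤ N) :
    ∀ᵐ x ∂μ, τ.cond μ n x {x} = ∏ i ∈ Finset.range n, Γ.cot (e i x) := by
  have : ∀ᵐ x ∂μ, ∀ i, i < n → τ.weight μ i x = Γ.cot (e i x) := by
    refine ae_all_iff.2 fun i => ?_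
    by_cases hi : i < n
    · filter_upwards [h.ae_weight_eq hΓ (hi.trans_le hn)] with x hx _ using hx
    · exact ae_of_all _ fun x h => absurd h hi
  filter_upwards [this, τ.ae_cond_singleton μ n] with x h1 h2
  rw [h2]
  exact Finset.prod_congr rfl fun i hi => h1 i (Finset.mem_range.1 hi)

/-- Almost every element of the `n`-th partition is finite, and its points are distinguished by the
edges. -/
lemma ae_exists_injOn (h : IsCoding μ τ Γ N v e) (hΓ : Γ.IsFinitePos) {n : ℕ} (hn : n ≤ N) :
    ∀ᵐ x ∂μ, ∃ G : Set X, τ.cond μ n x Gᶜ = 0 ∧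
      Set.InjOn (fun y (i : Fin n) => e i y) G := by
  have := hΓ.finite_E
  have : Nonempty X := nonempty_of_isProbabilityMeasure μ
  obtain ⟨x₀⟩ := this
  obtain ⟨S, hS, hsep⟩ := exists_seq_separating X (p := MeasurableSet) MeasurableSet.univ Set.univ
  -- Finite words are continued by the edges of an arbitrary point; only the first `n` terms matter.
  let ext : ((i : Fin n) → Γ.E i) → (i : ℕ) → Γ.E i :=
    fun q i => if hi : i < n then q ⟨i, hi⟩ else e i x₀
  choose B hB hSB using fun j (q : (i : Fin n) → Γ.E i) =>
    h.gen_cyl hn (ext q) (DecFiltration.algMod_zero_of_measurableSet (hS j))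
  have hgood : ∀ᵐ y ∂μ, ∀ j q, (∀ i : Fin n, e i y = q i) → (y ∈ S j ↔ y ∈ B j q) := by
    refine ae_all_iff.2 fun j => ae_all_iff.2 fun q => ?_
    filter_upwards [(hSB j q).mem_iff] with y hy hyq
    have : y ∈ {x | ∀ i < n, e i x = ext q i} := by
      intro i hi
      simp only [ext, hi, dite_true]
      exact hyq ⟨i, hi⟩
    simpa [Set.mem_inter_iff, this] using hy
  have hB' : ∀ᵐ x ∂μ, ∀ᵐ y ∂(τ.cond μ n x), ∀ j q, (y ∈ B j q ↔ x ∈ B j q) := by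
    have : ∀ᵐ x ∂μ, ∀ j q, ∀ᵐ y ∂(τ.cond μ n x), (y ∈ B j q ↔ x ∈ B j q) :=
      ae_all_iff.2 fun j => ae_all_iff.2 fun a => DecFiltration.ae_cond_mem_iff (hB j a)
    filter_upwards [this] with x hx
    exact ae_all_iff.2 fun j => ae_all_iff.2 fun a => hx j a
  filter_upwards [hB', DecFiltration.ae_cond_ae (τ := τ) hgood n] with x h2 h3
  refine ⟨_, h3.and h2, ?_⟩
  rintro y ⟨hy1, hy2⟩ y' ⟨hy1', hy2'⟩ hyy
  refine hsep _ trivial _ trivial fun j => ?_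
  rw [hy1 j (fun i => e i y) (fun _ => rfl), hy1' j (fun i => e i y') (fun _ => rfl), hy2, hy2']
  have : (fun i : Fin n => e i y) = fun i : Fin n => e i y' := hyy
  rw [this]

lemma ae_finite_atoms (h : IsCoding μ τ Γ N v e) (hΓ : Γ.IsFinitePos) {n : ℕ} (hn : n ≤ N) :
    ∀ᵐ x ∂μ, (atomSet (τ.cond μ n x)).Finite ∧ τ.cond μ n x (atomSet (τ.cond μ n x))ᶜ = 0 := by
  have := hΓ.finite_E
  filter_upwards [h.ae_exists_injOn hΓ hn] with x ⟨G, hG, hGi⟩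
  exact atomSet_finite_of_finite (Set.Finite.of_injOn (t := Set.univ) (fun _ _ => trivial) hGi
    Set.finite_univ) hG

lemma exists_finite_massType (h : IsCoding μ τ Γ N v e) (hΓ : Γ.IsFinitePos) {n : ℕ}
    (hn : n ≤ N) :
    ∃ F : Set (Multiset ℝ≥0∞), F.Finite ∧ ∀ᵐ x ∂μ, massType (τ.cond μ n x) ∈ F := by
  classical
  have := hΓ.finite_E
  -- The mass of an atom is the product of the cotransition probabilities along its word of edges,
  -- and distinct atoms have distinct words; there are finitely many words.
  set M : Set ℝ≥0∞ := Set.range fun q : (i : Fin n) → Γ.E i => ∏ i, Γ.cot (q i)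
  refine ⟨_, multiset_finite_of_card_le (M := M) (Set.finite_range _)
    (Nat.card ((i : Fin n) → Γ.E i)), ?_⟩
  filter_upwards [h.ae_exists_injOn hΓ hn, h.ae_finite_atoms hΓ hn, τ.ae_cond_cond_eq μ n,
    DecFiltration.ae_cond_ae (τ := τ) (h.ae_cond_singleton_eq hΓ hn) n]
    with x ⟨G, hG, hGi⟩ ⟨hfin, h0⟩ hx hx'
  rw [massType, dif_pos hfin]
  constructor
  · intro a ha
    obtain ⟨y, hy, rfl⟩ := Multiset.mem_map.1 ha
    have hy : y ∈ atomSet (τ.cond μ n x) := by simpa using hy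
    have h1 := forall_atomSet_of_ae hx y hy
    have h2 := forall_atomSet_of_ae hx' y hy
    rw [h1] at h2
    exact ⟨fun i => e i y, by rw [h2, Finset.prod_range]⟩
  · rw [Multiset.card_map]
    change hfin.toFinset.card ≤ _
    have := Fintype.ofFinite ((i : Fin n) → Γ.E i)
    rw [Nat.card_eq_fintype_card, ← Finset.card_univ]
    refine Finset.card_le_card_of_injOn (fun y (i : Fin n) => e i y) (fun _ _ => by simp) ?_
    exact hGi.mono fun y hy => mem_of_mem_atomSet hG (by simpa using hy)

/-- The type of an element is the tree of paths that lead to its vertex. -/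
lemma ae_typ_eq (h : IsCoding μ τ Γ N v e) (hΓ : Γ.IsFinitePos) {n : ℕ} (hn : n ≤ N) :
    ∀ᵐ x ∂μ, τ.typ μ n x = Γ.pathTree n (v n x) := by
  classical
  induction n with
  | zero => exact ae_of_all _ fun x => rfl
  | succ n ih =>
    have := hΓ.finite_E n
    filter_upwards [h.ae_exists_edge_iff hΓ hn, h.ae_cond_edge hΓ hn, h.ae_finite_atoms hΓ hn,
      DecFiltration.ae_cond_ae (τ := τ) (ih (Nat.le_of_succ_le hn)) (n + 1),
      DecFiltration.ae_cond_ae (τ := τ) (h.src n hn) (n + 1)]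
      with x ⟨G, hG, hxG, hG'⟩ hedge ⟨hfin, h0⟩ hih hsrc
    set m := τ.cond μ (n + 1) x with hm
    have hGm : ∀ᵐ y ∂m, y ∈ G := hG
    have himg : (τ.cond μ n '' atomSet m).Finite := hfin.image _
    have hpf : {a : Γ.E n | Γ.tgt a = v (n + 1) x}.Finite := Set.toFinite _
    have hatom : ∀ y ∈ atomSet m, y ∈ G := fun y hy => mem_of_mem_atomSet hG hy
    have hmass : ∀ y ∈ atomSet m, m {z | τ.cond μ n z = τ.cond μ n y} = m (e n ⁻¹' {e n y}) := by
      intro y hy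
      refine measure_congr ?_
      filter_upwards [hGm] with z hz
      exact propext (hG' z hz y (hatom y hy)).symm
    have htgt : ∀ y ∈ atomSet m, Γ.tgt (e n y) = v (n + 1) x := by
      intro y hy
      by_contra hne
      have h1 := hedge (e n y)
      rw [Set.indicator_of_notMem (fun h => hne (by simpa using h.symm))] at h1
      exact hy (measure_mono_null (by simp) h1)
    -- An edge that ends at the vertex has nonzero conditional probability, so some atom carries it.
    have hex : ∀ a : Γ.E n, Γ.tgt a = v (n + 1) x → ∃ y ∈ atomSet m, e n y = a := by
      intro a ha
      refine exists_atom_of_measure_ne_zero h0 (s := e n ⁻¹' {a}) ?_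
      rw [hedge a, Set.indicator_of_mem (by simpa using ha.symm)]
      exact hΓ.cot_ne n a
    change DecFiltration.tree τ μ (n + 1) m = _
    refine (dif_pos himg).trans (Eq.trans (Eq.symm ?_) (dif_pos hpf).symm)
    have : Nonempty X := ⟨x⟩
    choose! Y hY hYe using hex
    -- Edges into the vertex correspond one to one to the elements of level `n` inside the given
    -- one: the edge `a` goes to the element of the atom `Y a` that carries it.
    refine Multiset.map_eq_map_of_bij_of_nodup _ _ hpf.toFinset.nodup himg.toFinset.nodup
      (fun a _ => τ.cond μ n (Y a)) ?_ ?_ ?_ ?_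
    · intro a ha
      have ha : Γ.tgt a = v (n + 1) x := by simpa using ha
      have : τ.cond μ n (Y a) ∈ himg.toFinset := by
        rw [Set.Finite.mem_toFinset]; exact ⟨_, hY a ha, rfl⟩
      exact this
    · intro a ha b hb hab
      have ha : Γ.tgt a = v (n + 1) x := by simpa using ha
      have hb : Γ.tgt b = v (n + 1) x := by simpa using hb
      rw [← hYe a ha, ← hYe b hb]
      exact (hG' _ (hatom _ (hY a ha)) _ (hatom _ (hY b hb))).2 hab
    · intro b hb
      have hb : b ∈ himg.toFinset := hb
      rw [Set.Finite.mem_toFinset] at hb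
      obtain ⟨y, hy, rfl⟩ := hb
      have h1 := htgt y hy
      refine ⟨e n y, by simpa using h1, ?_⟩
      exact (hG' _ (hatom _ (hY _ h1)) _ (hatom _ hy)).1 (hYe _ h1)
    · intro a ha
      have ha : Γ.tgt a = v (n + 1) x := by simpa using ha
      have h1 := hmass _ (hY a ha)
      rw [hYe a ha, hedge a, Set.indicator_of_mem (by simpa using ha.symm)] at h1
      have h2 : τ.typ μ n (Y a) = Γ.pathTree n (v n (Y a)) := forall_atomSet_of_ae hih _ (hY a ha)
      have h3 := forall_atomSet_of_ae hsrc _ (hY a ha)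
      rw [← h3, hYe a ha] at h2
      rw [h1, ← h2]
      rfl

end

/-- A filtration coded by a finite multigraph is locally finite. -/
lemma isLocallyFiniteFilt {X : Type*} [MeasurableSpace X] [StandardBorelSpace X] {μ : Measure X}
    [IsProbabilityMeasure μ] {τ : DecFiltration X} {Γ : GradedMultigraph} (hΓ : Γ.IsFinitePos)
    (h : ∀ N, ∃ v e, IsCoding μ τ Γ N v e) : IsLocallyFiniteFilt μ τ := fun n => by
  obtain ⟨v, e, h⟩ := h n
  exact ⟨h.ae_finite_atoms hΓ le_rfl, h.exists_finite_massType hΓ le_rfl⟩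

end IsCoding

/-! ### Ranks in finite subsets of a linear order -/

section Rank

variable {α γ : Type*} [LinearOrder α] [DecidableEq γ]

/-- The number of elements of `B` with the same label as `b` that precede `b`. -/
def Finset.labelRank (B : Finset α) (F : α → γ) (b : α) : ℕ :=
  (B.filter fun b' => F b' = F b ∧ b' < b).card

lemma Finset.labelRank_lt {B : Finset α} {F : α → γ} {b : α} (hb : b ∈ B) :
    B.labelRank F b < Multiset.count (F b) (B.val.map F) := by
  rw [Multiset.count_map]
  change _ < (B.filter fun a => F b = F a).card
  refine Finset.card_lt_card ⟨fun a ha => ?_, fun h => ?_⟩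
  · simp only [Finset.mem_filter] at ha ⊢
    exact ⟨ha.1, ha.2.1.symm⟩
  · have := h (Finset.mem_filter.2 ⟨hb, rfl⟩)
    simp at this

lemma Finset.labelRank_lt_labelRank {B : Finset α} {F : α → γ} {b b' : α} (hb : b ∈ B)
    (hF : F b = F b') (h : b < b') : B.labelRank F b < B.labelRank F b' := by
  refine Finset.card_lt_card ⟨fun a ha => ?_, fun hs => ?_⟩
  · simp only [Finset.mem_filter] at ha ⊢
    exact ⟨ha.1, ha.2.1.trans hF, ha.2.2.trans h⟩
  · have := hs (Finset.mem_filter.2 ⟨hb, hF, h⟩)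
    simp at this

lemma Finset.labelRank_injOn {B : Finset α} {F : α → γ} {b b' : α} (hb : b ∈ B) (hb' : b' ∈ B)
    (hF : F b = F b') (h : B.labelRank F b = B.labelRank F b') : b = b' := by
  rcases lt_trichotomy b b' with hlt | heq | hlt
  · exact absurd h (Finset.labelRank_lt_labelRank hb hF hlt).ne
  · exact heq
  · exact absurd h.symm (Finset.labelRank_lt_labelRank hb' hF.symm hlt).ne

/-- The rank maps the elements labelled `g` injectively into an initial segment of the same
cardinality, hence onto it. -/
lemma Finset.exists_labelRank_eq {B : Finset α} {F : α → γ} {g : γ} {k : ℕ}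
    (hk : k < Multiset.count g (B.val.map F)) : ∃ b ∈ B, F b = g ∧ B.labelRank F b = k := by
  have hc : Multiset.count g (B.val.map F) = (B.filter fun a => F a = g).card := by
    rw [Multiset.count_map]
    change (B.filter fun a => g = F a).card = _
    simp only [eq_comm]
  obtain ⟨b, hb, hbk⟩ := Finset.surj_on_of_inj_on_of_card_le (s := B.filter fun a => F a = g)
    (t := Finset.range (Multiset.count g (B.val.map F))) (fun b _ => B.labelRank F b) (by
      intro b hb
      simp only [Finset.mem_filter] at hb
      rw [Finset.mem_range, ← hb.2]
      exact Finset.labelRank_lt hb.1) (by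
      intro b b' hb hb' h
      simp only [Finset.mem_filter] at hb hb'
      exact Finset.labelRank_injOn hb.1 hb'.1 (hb.2.trans hb'.2.symm) h)
    (by rw [Finset.card_range, hc]) k (Finset.mem_range.2 hk)
  simp only [Finset.mem_filter] at hb
  exact ⟨b, hb.1, hb.2, hbk.symm⟩

end Rank

open Classical in
/-- The measure of a union of fibres of equal measure. -/
lemma measure_fibres_eq_card_mul {X α : Type*} [MeasurableSpace X] [MeasurableSingletonClass X]
    {m : Measure X} (hfin : (atomSet m).Finite) (h0 : m (atomSet m)ᶜ = 0) (c : X → α)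
    (P : α → Prop) {w : ℝ≥0∞} (hw : ∀ b ∈ (hfin.image c).toFinset, P b → m {y | c y = b} = w) :
    m {y | P (c y)} = ((hfin.image c).toFinset.filter P).card * w := by
  rw [measure_eq_sum_atoms hfin h0]
  have : ∀ y ∈ hfin.toFinset, (if y ∈ {y | P (c y)} then m {y} else 0) =
      ∑ b ∈ (hfin.image c).toFinset.filter P, if c y = b then m {y} else 0 := by
    intro y hy
    rw [Finset.sum_ite_eq]
    have : c y ∈ (hfin.image c).toFinset := by
      simp only [Set.Finite.mem_toFinset] at hy ⊢
      exact ⟨y, hy, rfl⟩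
    simp only [Finset.mem_filter, this, true_and, Set.mem_ofPred_eq]
  rw [Finset.sum_congr rfl this, Finset.sum_comm]
  rw [Finset.sum_congr rfl (g := fun _ => w), Finset.sum_const, nsmul_eq_mul]
  intro b hb
  rw [Finset.mem_filter] at hb
  rw [← hw b hb.1 hb.2, measure_eq_sum_atoms hfin h0]
  rfl

/-! ### Finiteness and measurability of types -/

namespace DecFiltration

variable {X : Type*} [mX : MeasurableSpace X] [StandardBorelSpace X]
  {μ : Measure X} [IsProbabilityMeasure μ] {τ : DecFiltration X} {n m : ℕ}

/-- The measured set itself varies with `x`. The first factor carries the σ-algebra of level `n`,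
for which the kernel of level `m ≥ n` is measurable too. -/
lemma measurable_cond_prodMk (τ : DecFiltration X) (μ : Measure X) [IsProbabilityMeasure μ]
    (h : n ≤ m) {t : Set (X × X)} (ht : MeasurableSet[(τ.alg n).prod mX] t) :
    Measurable[τ.alg n] fun x => τ.cond μ m x (Prod.mk x ⁻¹' t) := by
  have hκ : @Measurable X (Measure X) (τ.alg n) _ (fun x => τ.cond μ m x) :=
    @Measure.measurable_of_measurable_coe _ _ _ (τ.alg n) _ fun s hs =>
      (measurable_cond τ μ m hs).mono (τ.anti h) le_rfl
  let κ : @Kernel X X (τ.alg n) mX := @Kernel.mk X X (τ.alg n) mX (fun x => τ.cond μ m x) hκ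
  have : @IsMarkovKernel X X (τ.alg n) mX κ := @IsMarkovKernel.mk X X (τ.alg n) mX κ fun a => by
    change IsProbabilityMeasure (τ.cond μ m a)
    infer_instance
  exact @Kernel.measurable_kernel_prodMk_left X X (τ.alg n) mX κ _ t ht

lemma measurable_cond_comp_code (τ : DecFiltration X) (μ : Measure X) [IsProbabilityMeasure μ]
    (h : n ≤ m) {s : Set X} (hs : MeasurableSet s) {R : Set (ℝ × ℝ)} (hR : MeasurableSet R) :
    Measurable[τ.alg n] fun x => τ.cond μ m x (s ∩ {y | (τ.code μ n x, τ.code μ n y) ∈ R}) := by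
  refine measurable_cond_prodMk τ μ h
    (t := Prod.snd ⁻¹' s ∩ {p : X × X | (τ.code μ n p.1, τ.code μ n p.2) ∈ R}) ?_
  have hfst : @Measurable (X × X) X ((τ.alg n).prod mX) (τ.alg n) Prod.fst :=
    @measurable_fst X X (τ.alg n) mX
  have hsnd : @Measurable (X × X) X ((τ.alg n).prod mX) mX Prod.snd :=
    @measurable_snd X X (τ.alg n) mX
  refine MeasurableSet.inter (hsnd hs) ?_
  have h1 := (measurable_code τ μ n).comp hfst
  have h2 := ((measurable_code τ μ n).mono (τ.alg_le n) le_rfl).comp hsnd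
  exact (h1.prodMk h2) hR

lemma measurable_weight (τ : DecFiltration X) (μ : Measure X) [IsProbabilityMeasure μ] (n : ℕ) :
    Measurable[τ.alg n] (τ.weight μ n) := by
  have := measurable_cond_comp_code τ μ (Nat.le_succ n) (s := Set.univ) MeasurableSet.univ
    (R := {p | p.1 = p.2}) (measurableSet_eq_fun measurable_fst measurable_snd)
  convert this using 2 with x
  unfold weight
  congr 1
  ext y
  simp only [Set.mem_ofPred_eq, Set.univ_inter]
  rw [code_eq_iff, eq_comm]

lemma measurable_cond_self (τ : DecFiltration X) (μ : Measure X) [IsProbabilityMeasure μ] (n : ℕ) :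
    Measurable fun x => τ.cond μ n x {x} := by
  have hκ : Measurable (fun x => τ.cond μ n x) :=
    Measure.measurable_of_measurable_coe _ fun s hs => measurable_cond' τ μ n hs
  let κ : Kernel X X := ⟨fun x => τ.cond μ n x, hκ⟩
  have : IsMarkovKernel κ := ⟨fun a => by
    change IsProbabilityMeasure (τ.cond μ n a)
    infer_instance⟩
  have := Kernel.measurable_kernel_prodMk_left (κ := κ) (t := {p : X × X | p.2 = p.1})
    (measurableSet_eq_fun measurable_snd measurable_fst)
  exact this

lemma ae_of_ae_cond_ae {Q : X → Prop} (hQ : MeasurableSet {x | Q x})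
    (h : ∀ᵐ x ∂μ, ∀ᵐ y ∂(τ.cond μ n x), Q y) : ∀ᵐ x ∂μ, Q x := by
  have : ∫⁻ x, τ.cond μ n x {y | Q y}ᶜ ∂μ = 0 := by
    rw [lintegral_eq_zero_iff (measurable_cond' τ μ n hQ.compl)]
    exact h
  rwa [lintegral_cond hQ.compl] at this

/-- Almost every conditional measure is purely atomic and is the conditional measure of each of its
atoms, so the property holds a.e. for almost every conditional measure. Being measurable, it holds
`μ`-a.e. -/
lemma ae_cond_self_ne_zero (hτ : IsLocallyFiniteFilt μ τ) (n : ℕ) :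
    ∀ᵐ x ∂μ, τ.cond μ n x {x} ≠ 0 := by
  refine ae_of_ae_cond_ae (n := n) (τ := τ)
    ((measurable_cond_self τ μ n) (measurableSet_singleton 0)).compl ?_
  filter_upwards [(hτ n).1, ae_cond_cond_eq τ μ n] with x hx hx'
  filter_upwards [hx', ae_of_forall_atomSet hx.2 (P := (· ∈ atomSet (τ.cond μ n x)))
    fun y hy => hy] with y hy hy'
  rw [hy]; exact hy'

lemma exists_finite_mass (hτ : IsLocallyFiniteFilt μ τ) (n : ℕ) :
    ∃ M : Set ℝ≥0∞, M.Finite ∧ ∀ᵐ x ∂μ, τ.cond μ n x {x} ∈ M := by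
  obtain ⟨F, hF, hF'⟩ := (hτ n).2
  refine ⟨⋃ s ∈ F, {a | a ∈ s}, hF.biUnion fun s _ => Multiset.finite_toSet s, ?_⟩
  filter_upwards [hF', (hτ n).1, ae_cond_self_ne_zero hτ n] with x h1 h2 h3
  refine Set.mem_biUnion h1 ?_
  rw [massType, dif_pos h2.1]
  exact Multiset.mem_map.2 ⟨x, h2.1.mem_toFinset.2 h3, rfl⟩

lemma weight_le_one (τ : DecFiltration X) (μ : Measure X) [IsProbabilityMeasure μ] (n : ℕ) (x : X) :
    τ.weight μ n x ≤ 1 := prob_le_one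

/-- A weight is the quotient of the masses of a point at levels `n + 1` and `n`, and both range over
finite sets. -/
lemma exists_finite_weight (hτ : IsLocallyFiniteFilt μ τ) (n : ℕ) :
    ∃ M : Set ℝ≥0∞, M.Finite ∧ (∀ w ∈ M, w ≠ 0 ∧ w ≤ 1) ∧ ∀ᵐ x ∂μ, τ.weight μ n x ∈ M := by
  obtain ⟨M, hM, hM'⟩ := exists_finite_mass hτ n
  obtain ⟨M1, hM1, hM1'⟩ := exists_finite_mass hτ (n + 1)
  refine ⟨Set.image2 (· / ·) M1 M ∩ {w | w ≠ 0 ∧ w ≤ 1}, (hM1.image2 _ hM).inter_of_left _,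
    fun w hw => hw.2, ?_⟩
  filter_upwards [hM', hM1', ae_cond_self_ne_zero hτ n, ae_cond_self_ne_zero hτ (n + 1),
    ae_cond_succ_singleton τ μ n] with x h1 h2 h3 h4 h5
  refine ⟨⟨_, h2, _, h1, ?_⟩, fun h => h4 (by rw [h5, h, zero_mul]), weight_le_one τ μ n x⟩
  simp only
  rw [h5, ENNReal.mul_div_cancel_right h3 (measure_ne_top _ _)]

lemma exists_finite_card (hτ : IsLocallyFiniteFilt μ τ) (n : ℕ) :
    ∃ K : ℕ, ∀ᵐ x ∂μ, ∀ h : (atomSet (τ.cond μ n x)).Finite, h.toFinset.card ≤ K := by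
  obtain ⟨F, hF, hF'⟩ := (hτ n).2
  obtain ⟨K, hK⟩ := (hF.image Multiset.card).bddAbove
  refine ⟨K, ?_⟩
  filter_upwards [hF'] with x h1 h
  have := hK ⟨_, h1, rfl⟩
  rw [massType, dif_pos h, Multiset.card_map] at this
  exact this

lemma exists_typ_eq_code (τ : DecFiltration X) (μ : Measure X) [IsProbabilityMeasure μ] (n : ℕ) :
    ∃ t : ℝ → MTree n, ∀ y, τ.typ μ n y = t (τ.code μ n y) := by
  classical
  have hne : Nonempty X := nonempty_of_isProbabilityMeasure μ
  have : Function.FactorsThrough (τ.typ μ n) (τ.code μ n) := fun x y h => by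
    simp only [typ, code_eq_iff.1 h]
  refine ⟨Function.extend (τ.code μ n) (τ.typ μ n) (fun _ => τ.typ μ n hne.some), fun y => ?_⟩
  rw [this.extend_apply]

lemma ae_cond_eq_on_atoms (τ : DecFiltration X) (μ : Measure X) [IsProbabilityMeasure μ] (n : ℕ) :
    ∀ᵐ x ∂μ, ∀ y ∈ atomSet (τ.cond μ n x), τ.cond μ n y = τ.cond μ n x := by
  filter_upwards [ae_cond_cond_eq τ μ n] with x hx
  exact forall_atomSet_of_ae hx

open Classical in
/-- The tree of an element of the `n + 1`-st partition, in terms of the code. -/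
lemma tree_succ_eq {x : X} (hfin : (atomSet (τ.cond μ (n + 1) x)).Finite) {t : ℝ → MTree n}
    (ht : ∀ y, τ.typ μ n y = t (τ.code μ n y)) :
    τ.typ μ (n + 1) x = ((hfin.image (τ.code μ n)).toFinset.val.map fun b =>
      (τ.cond μ (n + 1) x {y | τ.code μ n y = b}, t b) : Multiset (ℝ≥0∞ × MTree n)) := by
  have himg := hfin.image (τ.cond μ n)
  refine (dif_pos himg).trans ?_
  have hex : ∀ b ∈ himg.toFinset, ∃ y ∈ atomSet (τ.cond μ (n + 1) x), τ.cond μ n y = b := by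
    intro b hb
    rw [Set.Finite.mem_toFinset] at hb
    exact hb
  have : Nonempty X := ⟨x⟩
  choose! Y hY hYe using hex
  refine Multiset.map_eq_map_of_bij_of_nodup _ _ himg.toFinset.nodup
    (hfin.image (τ.code μ n)).toFinset.nodup (fun b _ => τ.code μ n (Y b)) ?_ ?_ ?_ ?_
  · intro b hb
    have : τ.code μ n (Y b) ∈ (hfin.image (τ.code μ n)).toFinset := by
      rw [Set.Finite.mem_toFinset]; exact ⟨_, hY b hb, rfl⟩
    exact this
  · intro a ha b hb hab
    rw [← hYe a ha, ← hYe b hb]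
    exact code_eq_iff.1 hab
  · intro c hc
    have hc : c ∈ (hfin.image (τ.code μ n)).toFinset := hc
    rw [Set.Finite.mem_toFinset] at hc
    obtain ⟨y, hy, rfl⟩ := hc
    have : τ.cond μ n y ∈ himg.toFinset := by
      rw [Set.Finite.mem_toFinset]; exact ⟨_, hy, rfl⟩
    exact ⟨_, this, code_eq_iff.2 (hYe _ this)⟩
  · intro b hb
    have hb : b ∈ himg.toFinset := hb
    refine Prod.ext ?_ ?_
    · simp only [code_eq_iff, hYe b hb]
    · simp only
      rw [← ht, typ, hYe b hb]

/-- In almost every element of the `n + 1`-st partition, the weights of its parts. -/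
lemma ae_weight_eq_on_atoms (τ : DecFiltration X) (μ : Measure X) [IsProbabilityMeasure μ] (n : ℕ) :
    ∀ᵐ x ∂μ, ∀ y ∈ atomSet (τ.cond μ (n + 1) x),
      τ.weight μ n y = τ.cond μ (n + 1) x {z | τ.code μ n z = τ.code μ n y} := by
  filter_upwards [ae_cond_eq_on_atoms τ μ (n + 1)] with x hx y hy
  rw [weight, hx y hy]
  simp only [code_eq_iff]

-- The parts of weight `w` and type `u` are disjoint and have mass `w` each. Thus multiplicities in
-- a type are expressed by conditional masses, which are measurable.
open Classical in
lemma ae_cond_count (hτ : IsLocallyFiniteFilt μ τ) (n : ℕ) :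
    ∀ᵐ x ∂μ, ∀ w u, τ.cond μ (n + 1) x {y | τ.weight μ n y = w ∧ τ.typ μ n y = u} =
      Multiset.count (α := ℝ≥0∞ × MTree n) (w, u) (τ.typ μ (n + 1) x) * w := by
  obtain ⟨t, ht⟩ := exists_typ_eq_code τ μ n
  filter_upwards [ae_weight_eq_on_atoms τ μ n, (hτ (n + 1)).1] with x hx ⟨hfin, h0⟩ w u
  rw [tree_succ_eq hfin ht]
  set m := τ.cond μ (n + 1) x
  have h1 : m {y | τ.weight μ n y = w ∧ τ.typ μ n y = u} =
      m {y | (m {z | τ.code μ n z = τ.code μ n y}, t (τ.code μ n y)) = (w, u)} := by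
    refine measure_congr ?_
    filter_upwards [ae_of_forall_atomSet h0 hx] with y hy
    refine propext ?_
    change (τ.weight μ n y = w ∧ τ.typ μ n y = u) ↔ (_ = _)
    rw [hy, ht, Prod.mk_inj]
  rw [h1, measure_fibres_eq_card_mul hfin h0 (τ.code μ n)
    (fun b => (m {z | τ.code μ n z = b}, t b) = (w, u)) (w := w), Multiset.count_map]
  · congr 3
    simp only [eq_comm]
    rfl
  · intro b _ hP
    exact (Prod.mk_inj.1 hP).1

/-- Both claims are proved by one induction. A type of level `n + 1` is a multiset of bounded size
of pairs from a finite set, and by `ae_cond_count` it is determined by finitely many conditional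
masses; these can be measured once the types of level `n` are measurable. -/
lemma exists_finite_typ_and_meas (hτ : IsLocallyFiniteFilt μ τ) (n : ℕ) :
    (∃ F : Set (MTree n), F.Finite ∧ ∀ᵐ x ∂μ, τ.typ μ n x ∈ F) ∧
      ∀ t, MeasurableSet[τ.algMod μ n] {x | τ.typ μ n x = t} := by
  classical
  induction n with
  | zero =>
    refine ⟨⟨Set.univ, (Set.finite_singleton ()).subset fun _ _ => rfl, by simp⟩, fun t => ?_⟩
    have : {x | τ.typ μ 0 x = t} = Set.univ := by
      ext x; simp only [Set.mem_ofPred_eq, Set.mem_univ, iff_true]; exact rfl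
    rw [this]
    exact MeasurableSet.univ
  | succ n ih =>
    obtain ⟨⟨F, hF, hF'⟩, hmeas⟩ := ih
    obtain ⟨M, hM, hM01, hM'⟩ := exists_finite_weight hτ n
    obtain ⟨K, hK⟩ := exists_finite_card hτ (n + 1)
    obtain ⟨t, ht⟩ := exists_typ_eq_code τ μ n
    set F' : Set (Multiset (ℝ≥0∞ × MTree n)) := {s | (∀ a ∈ s, a ∈ M ×ˢ F) ∧ s.card ≤ K} with hF'def
    have hfinF : F'.Finite := multiset_finite_of_card_le (hM.prod hF) K
    have haeF : ∀ᵐ x ∂μ, (τ.typ μ (n + 1) x : Multiset (ℝ≥0∞ × MTree n)) ∈ F' := by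
      filter_upwards [(hτ (n + 1)).1, hK, ae_weight_eq_on_atoms τ μ n,
        ae_cond_ae (τ := τ) hF' (n + 1), ae_cond_ae (τ := τ) hM' (n + 1)]
        with x ⟨hfin, h0⟩ hKx hW hFx hMx
      rw [tree_succ_eq hfin ht]
      constructor
      · intro a ha
        obtain ⟨b, hb, rfl⟩ := Multiset.mem_map.1 ha
        have hb : b ∈ (hfin.image (τ.code μ n)).toFinset := hb
        rw [Set.Finite.mem_toFinset] at hb
        obtain ⟨y, hy, rfl⟩ := hb
        refine ⟨?_, ?_⟩
        · simp only
          rw [← hW y hy]; exact forall_atomSet_of_ae hMx y hy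
        · simp only
          rw [← ht]; exact forall_atomSet_of_ae hFx y hy
      · rw [Multiset.card_map]
        refine le_trans ?_ (hKx hfin)
        have : (hfin.image (τ.code μ n)).toFinset = hfin.toFinset.image (τ.code μ n) := by
          ext b; simp
        rw [this]
        exact Finset.card_image_le
    refine ⟨⟨F', hfinF, haeF⟩, fun s => ?_⟩
    by_cases hs : s ∈ F'
    · have hS : ∀ w u, NullMeasurableSet {y | τ.weight μ n y = w ∧ τ.typ μ n y = u} μ := by
        intro w u
        refine NullMeasurableSet.inter ?_ (τ.nullMeasurableSet_of_algMod (hmeas u))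
        exact (((measurable_weight τ μ n).mono (τ.alg_le n) le_rfl)
          (measurableSet_singleton w)).nullMeasurableSet
      choose S hSm hSe using hS
      -- `D` prescribes the conditional masses for all pairs. Weights in `M` are nonzero and finite,
      -- so cancelling them recovers the multiplicities.
      set D : Set X := ⋂ p ∈ M ×ˢ F, {x | τ.cond μ (n + 1) x (S p.1 p.2) =
        Multiset.count (α := ℝ≥0∞ × MTree n) p s * p.1} with hDdef
      have hD : MeasurableSet[τ.alg (n + 1)] D := by
        refine MeasurableSet.biInter (hM.prod hF).countable fun p _ => ?_
        exact measurable_cond τ μ (n + 1) (hSm p.1 p.2) (measurableSet_singleton _)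
      refine ⟨_, hD, ?_⟩
      have hcS : ∀ᵐ x ∂μ, ∀ p ∈ M ×ˢ F, τ.cond μ (n + 1) x
          {y | τ.weight μ n y = p.1 ∧ τ.typ μ n y = p.2} = τ.cond μ (n + 1) x (S p.1 p.2) :=
        (ae_ball_iff (hM.prod hF).countable).2 fun p _ => ae_cond_congr (hSe p.1 p.2)
      filter_upwards [haeF, ae_cond_count hτ n, hcS] with x h1 h2 h3
      refine propext ?_
      change (τ.typ μ (n + 1) x = s) ↔ x ∈ D
      simp only [hDdef, Set.mem_iInter, Set.mem_ofPred_eq]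
      constructor
      · intro h p hp
        rw [← h3 p hp, h2, h]
      · intro h
        refine Multiset.ext.2 fun p => ?_
        by_cases hp : p ∈ M ×ˢ F
        · have h4 := h p hp
          rw [← h3 p hp, h2] at h4
          have hp1 := hM01 p.1 hp.1
          have h5 := (ENNReal.mul_left_inj hp1.1 (hp1.2.trans_lt ENNReal.one_lt_top).ne).1 h4
          exact_mod_cast h5
        · rw [Multiset.count_eq_zero_of_notMem (fun h => hp (h1.1 p h)),
            Multiset.count_eq_zero_of_notMem (fun h => hp (hs.1 p h))]
    · refine algMod_congr (t := ∅) (@MeasurableSet.empty _ (τ.algMod μ (n + 1))) ?_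
      filter_upwards [haeF] with x hx
      refine propext ⟨fun h => hs ?_, fun h => h.elim⟩
      have h : τ.typ μ (n + 1) x = s := h
      rw [← h]; exact hx

lemma exists_finite_typ (hτ : IsLocallyFiniteFilt μ τ) (n : ℕ) :
    ∃ F : Set (MTree n), F.Finite ∧ ∀ᵐ x ∂μ, τ.typ μ n x ∈ F :=
  (exists_finite_typ_and_meas hτ n).1

lemma measurableSet_typ (hτ : IsLocallyFiniteFilt μ τ) (n : ℕ) (t : MTree n) :
    MeasurableSet[τ.algMod μ n] {x | τ.typ μ n x = t} :=
  (exists_finite_typ_and_meas hτ n).2 t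

/-- Almost every type occurs with positive probability. -/
lemma ae_typ_pos (hτ : IsLocallyFiniteFilt μ τ) (n : ℕ) :
    ∀ᵐ x ∂μ, μ {y | τ.typ μ n y = τ.typ μ n x} ≠ 0 := by
  obtain ⟨F, hF, hF'⟩ := exists_finite_typ hτ n
  have : ∀ᵐ x ∂μ, ∀ t ∈ F, μ {y | τ.typ μ n y = t} = 0 → τ.typ μ n x ≠ t := by
    refine (ae_ball_iff hF.countable).2 fun t _ => ?_
    by_cases h : μ {y | τ.typ μ n y = t} = 0
    · have h' : ∀ᵐ x ∂μ, ¬ (τ.typ μ n x = t) := by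
        rw [ae_iff]; simpa using h
      filter_upwards [h'] with x hx _ using hx
    · exact ae_of_all _ fun x h' => absurd h' h
  filter_upwards [hF', this] with x h1 h2 h3
  exact h2 _ h1 h3 rfl

end DecFiltration

/-! ### Labelling the parts of an element by the edges of the minimal graph -/

namespace DecFiltration

variable {X : Type*} [mX : MeasurableSpace X] [StandardBorelSpace X]
  {μ : Measure X} [IsProbabilityMeasure μ] {τ : DecFiltration X} {n m : ℕ}

/-- The converse of `ae_cond_eq_of_forall`, by integrating the conditional masses over `A`. -/
lemma measure_inter_eq_of_ae_cond {s C : Set X} {c : ℝ≥0∞} (hs : NullMeasurableSet s μ)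
    (hC : MeasurableSet[τ.algMod μ n] C)
    (h : ∀ᵐ x ∂μ, τ.cond μ n x s = C.indicator (fun _ => c) x) {A : Set X}
    (hA : MeasurableSet[τ.algMod μ n] A) : μ (A ∩ s) = c * μ (A ∩ C) := by
  obtain ⟨t, ht, hst⟩ := hs
  obtain ⟨D, hD, hCD⟩ := hC
  obtain ⟨A', hA', hAA⟩ := hA
  rw [measure_congr (hAA.inter hst), measure_congr (hAA.inter hCD), ← setLIntegral_cond hA' ht]
  have : ∀ᵐ x ∂(μ.restrict A'), τ.cond μ n x t = D.indicator (fun _ => c) x := by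
    refine ae_restrict_of_ae ?_
    filter_upwards [h, ae_cond_congr (n := n) (τ := τ) hst, hCD.mem_iff] with x hx1 hx2 hx3
    rw [← hx2, hx1]
    by_cases hx : x ∈ C
    · rw [Set.indicator_of_mem hx, Set.indicator_of_mem (hx3.1 hx)]
    · rw [Set.indicator_of_notMem hx, Set.indicator_of_notMem (fun h => hx (hx3.2 h))]
  rw [lintegral_congr_ae this, lintegral_indicator (τ.alg_le n _ hD), lintegral_const,
    Measure.restrict_apply MeasurableSet.univ, Set.univ_inter,
    Measure.restrict_apply (τ.alg_le n _ hD), Set.inter_comm]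

/-- The measure of the union of the parts of the same weight and type as the part of `y` that
precede it. -/
noncomputable def rankMass (τ : DecFiltration X) (μ : Measure X) [IsProbabilityMeasure μ] (n : ℕ)
    (y : X) : ℝ≥0∞ :=
  τ.cond μ (n + 1) y ({z | τ.weight μ n z = τ.weight μ n y ∧ τ.typ μ n z = τ.typ μ n y} ∩
    {z | τ.code μ n z < τ.code μ n y})

-- All the preceding parts that are counted have the weight of `y`. In this way the rank, defined by
-- counting, is replaced by a conditional mass, whose measurability is accessible.
open Classical in
lemma ae_rankMass (t : ℝ → MTree n) (ht : ∀ y, τ.typ μ n y = t (τ.code μ n y)) :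
    ∀ᵐ x ∂μ, ∀ hfin : (atomSet (τ.cond μ (n + 1) x)).Finite,
      τ.cond μ (n + 1) x (atomSet (τ.cond μ (n + 1) x))ᶜ = 0 →
      ∀ y ∈ atomSet (τ.cond μ (n + 1) x), τ.rankMass μ n y =
      ((hfin.image (τ.code μ n)).toFinset.labelRank
        (fun b => (τ.cond μ (n + 1) x {z | τ.code μ n z = b}, t b)) (τ.code μ n y) : ℕ) *
        τ.weight μ n y := by
  filter_upwards [ae_cond_eq_on_atoms τ μ (n + 1), ae_weight_eq_on_atoms τ μ n] with x hx hw hfin h0 y hy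
  rw [rankMass, hx y hy]
  set m := τ.cond μ (n + 1) x
  set F : ℝ → ℝ≥0∞ × MTree n := fun b => (m {z | τ.code μ n z = b}, t b) with hF
  have hFy : ∀ z ∈ atomSet m, F (τ.code μ n z) = (τ.weight μ n z, τ.typ μ n z) := by
    intro z hz
    rw [hw z hz, ht]
  have h1 : m ({z | τ.weight μ n z = τ.weight μ n y ∧ τ.typ μ n z = τ.typ μ n y} ∩
      {z | τ.code μ n z < τ.code μ n y}) =
      m {z | F (τ.code μ n z) = F (τ.code μ n y) ∧ τ.code μ n z < τ.code μ n y} := by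
    refine measure_congr ?_
    filter_upwards [ae_of_forall_atomSet h0 hFy] with z hz
    refine propext ?_
    change ((τ.weight μ n z = τ.weight μ n y ∧ τ.typ μ n z = τ.typ μ n y) ∧
      τ.code μ n z < τ.code μ n y) ↔ (_ ∧ _)
    rw [hz, hFy y hy, Prod.mk_inj]
  rw [h1, measure_fibres_eq_card_mul hfin h0 (τ.code μ n)
    (fun b => F b = F (τ.code μ n y) ∧ b < τ.code μ n y) (w := τ.weight μ n y)]
  · rw [Finset.labelRank]
    congr!
  · intro b hb hP
    have := hP.1
    rw [hFy y hy] at this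
    exact (Prod.mk_inj.1 this).1

/-- The points in a part of type `u`, weight `w` and rank `k` of an element of type `v`. -/
def IsLabelled (τ : DecFiltration X) (μ : Measure X) [IsProbabilityMeasure μ] (n : ℕ)
    (u : MTree n) (v : MTree (n + 1)) (w : ℝ≥0∞) (k : ℕ) (y : X) : Prop :=
  τ.typ μ n y = u ∧ τ.typ μ (n + 1) y = v ∧ τ.weight μ n y = w ∧ τ.rankMass μ n y = k * w

-- In an element of type `v`, ranks number the parts of weight `w` and type `u` without repetitions
-- or gaps, so each label with `k` below the multiplicity belongs to exactly one part. The product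
-- `k * w` determines `k` because weights of parts containing atoms are neither zero nor infinite.
open Classical in
lemma ae_isLabelled (hτ : IsLocallyFiniteFilt μ τ) (n : ℕ) :
    ∀ᵐ x ∂μ, (∃ k, k < Multiset.count (α := ℝ≥0∞ × MTree n) (τ.weight μ n x, τ.typ μ n x)
        (τ.typ μ (n + 1) x) ∧ τ.rankMass μ n x = k * τ.weight μ n x) ∧
      (∀ u v w k, k < Multiset.count (α := ℝ≥0∞ × MTree n) (w, u) v →
        τ.cond μ (n + 1) x {y | τ.IsLabelled μ n u v w k y} =
        {y | τ.typ μ (n + 1) y = v}.indicator (fun _ => w) x) ∧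
      ∀ u v w k, τ.IsLabelled μ n u v w k x → ∀ᵐ y ∂(τ.cond μ (n + 1) x),
        (τ.IsLabelled μ n u v w k y ↔ τ.code μ n y = τ.code μ n x) := by
  obtain ⟨t, ht⟩ := exists_typ_eq_code τ μ n
  filter_upwards [ae_cond_eq_on_atoms τ μ (n + 1), ae_weight_eq_on_atoms τ μ n, ae_rankMass t ht,
    (hτ (n + 1)).1, ae_cond_self_ne_zero hτ (n + 1)] with x hx hw hr ⟨hfin, h0⟩ hxatom
  have hr := hr hfin h0
  set m := τ.cond μ (n + 1) x with hm
  set F : ℝ → ℝ≥0∞ × MTree n := fun b => (m {z | τ.code μ n z = b}, t b) with hF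
  set B := (hfin.image (τ.code μ n)).toFinset with hB
  have hFy : ∀ z ∈ atomSet m, F (τ.code μ n z) = (τ.weight μ n z, τ.typ μ n z) := by
    intro z hz
    rw [hw z hz, ht]
  have hmemB : ∀ z ∈ atomSet m, τ.code μ n z ∈ B := fun z hz => by
    rw [hB, Set.Finite.mem_toFinset]; exact ⟨z, hz, rfl⟩
  have hxA : x ∈ atomSet m := hxatom
  have htyp : ∀ z ∈ atomSet m, τ.typ μ (n + 1) z = τ.typ μ (n + 1) x := fun z hz => by
    rw [typ, typ, hx z hz]
  have htree : τ.typ μ (n + 1) x = (B.val.map F : Multiset (ℝ≥0∞ × MTree n)) :=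
    tree_succ_eq hfin ht
  have hwne : ∀ z ∈ atomSet m, τ.weight μ n z ≠ 0 := fun z hz h => by
    rw [hw z hz] at h
    exact hz (measure_mono_null (by simp) h)
  have hwtop : ∀ z, τ.weight μ n z ≠ ∞ := fun z =>
    ((weight_le_one τ μ n z).trans_lt ENNReal.one_lt_top).ne
  have hrel : ∀ u v w k, ∀ z ∈ atomSet m, (τ.IsLabelled μ n u v w k z ↔
      τ.typ μ (n + 1) x = v ∧ F (τ.code μ n z) = (w, u) ∧
        B.labelRank F (τ.code μ n z) = k) := by
    intro u v w k z hz
    rw [IsLabelled, hFy z hz, hr z hz, htyp z hz, Prod.mk_inj]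
    constructor
    · rintro ⟨h1, h2, h3, h4⟩
      refine ⟨h2, ⟨h3, h1⟩, ?_⟩
      rw [← h3] at h4
      have := (ENNReal.mul_left_inj (hwne z hz) (hwtop z)).1 h4
      exact_mod_cast this
    · rintro ⟨h2, ⟨h3, h1⟩, h4⟩
      refine ⟨h1, h2, h3, ?_⟩
      rw [h4, h3]
  refine ⟨?_, ?_, ?_⟩
  · have hlt := Finset.labelRank_lt (F := F) (hmemB x hxA)
    rw [hFy x hxA] at hlt
    refine ⟨B.labelRank F (τ.code μ n x), ?_, hr x hxA⟩
    rw [htree]; exact hlt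
  · intro u v w k hk
    by_cases hax : τ.typ μ (n + 1) x = v
    · rw [Set.indicator_of_mem (by exact hax)]
      have h1 : m {y | τ.IsLabelled μ n u v w k y} = m {y | F (τ.code μ n y) = (w, u) ∧
          B.labelRank F (τ.code μ n y) = k} := by
        refine measure_congr ?_
        filter_upwards [ae_of_forall_atomSet h0 (hrel u v w k)] with z hz
        refine propext ?_
        change τ.IsLabelled μ n u v w k z ↔ (_ ∧ _)
        rw [hz]
        exact ⟨fun h => h.2, fun h => ⟨hax, h⟩⟩
      rw [h1, measure_fibres_eq_card_mul hfin h0 (τ.code μ n)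
        (fun b => F b = (w, u) ∧ B.labelRank F b = k) (w := w)]
      · have hk : k < Multiset.count (w, u) (B.val.map F) := by
          rw [← hax, htree] at hk
          exact hk
        obtain ⟨b, hb, hbF, hbk⟩ := Finset.exists_labelRank_eq hk
        have : B.filter (fun b => F b = (w, u) ∧ B.labelRank F b = k) = {b} := by
          ext c
          simp only [Finset.mem_filter, Finset.mem_singleton]
          constructor
          · rintro ⟨hc, hcF, hck⟩
            exact Finset.labelRank_injOn hc hb (hcF.trans hbF.symm) (hck.trans hbk.symm)
          · rintro rfl
            exact ⟨hb, hbF, hbk⟩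
        have hcard := congrArg Finset.card this
        rw [Finset.card_singleton] at hcard
        have hcast : ((B.filter (fun b => F b = (w, u) ∧ B.labelRank F b = k)).card : ℝ≥0∞) * w =
            w := by rw [hcard]; simp
        convert hcast
      · intro b _ hP
        exact (Prod.mk_inj.1 hP.1).1
    · rw [Set.indicator_of_notMem (by exact hax)]
      refine measure_mono_null (t := (atomSet m)ᶜ) (fun z hz hzA => ?_) h0
      exact hax ((hrel u v w k z hzA).1 hz).1
  · intro u v w k ha
    refine ae_of_forall_atomSet h0 fun z hz => ?_
    have ha' := (hrel u v w k x hxA).1 ha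
    rw [hrel u v w k z hz]
    constructor
    · rintro ⟨_, h2, h3⟩
      exact Finset.labelRank_injOn (hmemB z hz) (hmemB x hxA) (h2.trans ha'.2.1.symm)
        (h3.trans ha'.2.2.symm)
    · intro h
      rw [h]
      exact ha'

/-- The relation between the points and the edges of the minimal graph. -/
def edgeRel (τ : DecFiltration X) (μ : Measure X) [IsProbabilityMeasure μ] (n : ℕ)
    (a : (minimalGraph μ τ).E n) (y : X) : Prop :=
  τ.IsLabelled μ n a.1.1 a.2.1.1 a.2.2.1 a.2.2.2 y

lemma edgeRel_unique {a b : (minimalGraph μ τ).E n} {y : X} (hw : τ.weight μ n y ≠ 0)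
    (ha : τ.edgeRel μ n a y) (hb : τ.edgeRel μ n b y) : a = b := by
  obtain ⟨⟨u, hu⟩, ⟨v, hv⟩, w, k⟩ := a
  obtain ⟨⟨u', hu'⟩, ⟨v', hv'⟩, w', k'⟩ := b
  obtain ⟨h1, h2, h3, h4⟩ := ha
  obtain ⟨h1', h2', h3', h4'⟩ := hb
  simp only at h1 h2 h3 h4 h1' h2' h3' h4'
  subst h1 h2 h3 h1' h2' h3'
  have hw' : τ.weight μ n y ≠ ∞ := ((weight_le_one τ μ n y).trans_lt ENNReal.one_lt_top).ne
  have : k = k' := by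
    rw [h4] at h4'
    have := (ENNReal.mul_left_inj hw hw').1 h4'
    exact Fin.ext (by exact_mod_cast this)
  rw [this]

/-- The coding of an element of the `n + 1`-st partition by the edges of the minimal graph. -/
lemma ae_edgeRel (hτ : IsLocallyFiniteFilt μ τ) (n : ℕ) :
    ∀ᵐ x ∂μ, (∃ a, τ.edgeRel μ n a x) ∧
      (∀ a : (minimalGraph μ τ).E n, τ.cond μ (n + 1) x {y | τ.edgeRel μ n a y} =
        {y | τ.typ μ (n + 1) y = a.2.1.1}.indicator (fun _ => a.2.2.1) x) ∧
      ∀ a, τ.edgeRel μ n a x → ∀ᵐ y ∂(τ.cond μ (n + 1) x),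
        (τ.edgeRel μ n a y ↔ τ.code μ n y = τ.code μ n x) := by
  filter_upwards [ae_isLabelled hτ n, ae_typ_pos hτ n, ae_typ_pos hτ (n + 1)]
    with x ⟨⟨k, hk, hkr⟩, h2, h3⟩ hpos hpos1
  exact ⟨⟨⟨⟨_, hpos⟩, ⟨_, hpos1⟩, τ.weight μ n x, ⟨k, hk⟩⟩, rfl, rfl, rfl, hkr⟩,
    fun a => h2 _ _ _ _ a.2.2.2.2, fun a ha => h3 _ _ _ _ ha⟩

/-- Once weight and type are fixed, they may be replaced by the constants `w` and `u` inside
`rankMass`; the measured set then depends on `y` only through a comparison of codes. -/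
lemma measurableSet_isLabelled (hτ : IsLocallyFiniteFilt μ τ) (u : MTree n) (v : MTree (n + 1))
    (w : ℝ≥0∞) (k : ℕ) : MeasurableSet[τ.algMod μ n] {y | τ.IsLabelled μ n u v w k y} := by
  have hSn : NullMeasurableSet {z | τ.weight μ n z = w ∧ τ.typ μ n z = u} μ := by
    refine NullMeasurableSet.inter ?_ (τ.nullMeasurableSet_of_algMod (measurableSet_typ hτ n _))
    exact (((measurable_weight τ μ n).mono (τ.alg_le n) le_rfl)
      (measurableSet_singleton _)).nullMeasurableSet
  obtain ⟨S, hS, hSe⟩ := hSn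
  have h1 : MeasurableSet[τ.algMod μ n] {y | τ.cond μ (n + 1) y
      ({z | τ.weight μ n z = w ∧ τ.typ μ n z = u} ∩ {z | τ.code μ n z < τ.code μ n y}) =
        k * w} := by
    refine algMod_congr (t := {y | τ.cond μ (n + 1) y (S ∩ {z | τ.code μ n z < τ.code μ n y}) =
        k * w}) ?_ ?_
    · refine τ.alg_le_algMod μ n _ ?_
      exact measurable_cond_comp_code τ μ (Nat.le_succ n) hS (R := {p | p.2 < p.1})
        (measurableSet_lt measurable_snd measurable_fst) (measurableSet_singleton _)
    · filter_upwards [ae_cond_ae (τ := τ) hSe (n + 1)] with y hy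
      refine propext ?_
      change (_ = _) ↔ (_ = _)
      have e1 : τ.cond μ (n + 1) y ({z | τ.weight μ n z = w ∧ τ.typ μ n z = u} ∩
          {z | τ.code μ n z < τ.code μ n y}) =
          τ.cond μ (n + 1) y (S ∩ {z | τ.code μ n z < τ.code μ n y}) :=
        measure_congr (Filter.EventuallyEq.inter hy (EventuallyEq.refl _ _))
      rw [e1]
  have h2 : {y | τ.IsLabelled μ n u v w k y} = {y | τ.typ μ n y = u} ∩
      ({y | τ.typ μ (n + 1) y = v} ∩ (τ.weight μ n ⁻¹' {w} ∩ {y | τ.cond μ (n + 1) y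
      ({z | τ.weight μ n z = w ∧ τ.typ μ n z = u} ∩ {z | τ.code μ n z < τ.code μ n y}) =
        k * w})) := by
    ext y
    simp only [IsLabelled, rankMass, Set.mem_ofPred_eq, Set.mem_inter_iff, Set.mem_preimage,
      Set.mem_singleton_iff]
    constructor
    · rintro ⟨h1, h2, h3, h4⟩
      rw [h1, h3] at h4
      exact ⟨h1, h2, h3, h4⟩
    · rintro ⟨h1, h2, h3, h4⟩
      rw [h1, h3]
      exact ⟨rfl, h2, rfl, h4⟩
  rw [h2]
  refine MeasurableSet.inter (measurableSet_typ hτ n _) (MeasurableSet.inter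
    (τ.algMod_anti μ (Nat.le_succ n) _ (measurableSet_typ hτ (n + 1) _)) (MeasurableSet.inter ?_ h1))
  exact τ.alg_le_algMod μ n _ (measurable_weight τ μ n (measurableSet_singleton _))

lemma measurableSet_edgeRel (hτ : IsLocallyFiniteFilt μ τ) (a : (minimalGraph μ τ).E n) :
    MeasurableSet[τ.algMod μ n] {y | τ.edgeRel μ n a y} :=
  measurableSet_isLabelled hτ _ _ _ _

lemma nonempty_minimalGraph_V (hτ : IsLocallyFiniteFilt μ τ) (n : ℕ) :
    Nonempty ((minimalGraph μ τ).V n) := by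
  obtain ⟨x, hx⟩ := (ae_typ_pos hτ n).exists
  exact ⟨⟨_, hx⟩⟩

lemma nonempty_minimalGraph_E (hτ : IsLocallyFiniteFilt μ τ) (n : ℕ) :
    Nonempty ((minimalGraph μ τ).E n) := by
  obtain ⟨x, hx⟩ := (ae_edgeRel hτ n).exists
  exact ⟨hx.1.choose⟩

open Classical in
/-- The vertex of the minimal graph that corresponds to the element of the `n`-th partition. -/
noncomputable def minVertex (hτ : IsLocallyFiniteFilt μ τ) (n : ℕ) (x : X) :
    (minimalGraph μ τ).V n :=
  if h : μ {y | τ.typ μ n y = τ.typ μ n x} ≠ 0 then ⟨τ.typ μ n x, h⟩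
  else (nonempty_minimalGraph_V hτ n).some

open Classical in
/-- The edge of the minimal graph that corresponds to the element of the `n`-th partition. -/
noncomputable def minEdge (hτ : IsLocallyFiniteFilt μ τ) (n : ℕ) (x : X) :
    (minimalGraph μ τ).E n :=
  if h : ∃ a, τ.edgeRel μ n a x then h.choose else (nonempty_minimalGraph_E hτ n).some

lemma ae_minVertex (hτ : IsLocallyFiniteFilt μ τ) (n : ℕ) :
    ∀ᵐ x ∂μ, (minVertex hτ n x).1 = τ.typ μ n x := by
  filter_upwards [ae_typ_pos hτ n] with x hx
  exact congrArg (fun z : {t : MTree n // μ {x | τ.typ μ n x = t} ≠ 0} => z.1) (dif_pos hx)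

lemma ae_weight_ne_zero (hτ : IsLocallyFiniteFilt μ τ) (n : ℕ) :
    ∀ᵐ x ∂μ, τ.weight μ n x ≠ 0 := by
  obtain ⟨M, _, h, hM⟩ := exists_finite_weight hτ n
  filter_upwards [hM] with x hx using (h _ hx).1

lemma ae_minEdge (hτ : IsLocallyFiniteFilt μ τ) (n : ℕ) :
    ∀ᵐ x ∂μ, ∀ a, minEdge hτ n x = a ↔ τ.edgeRel μ n a x := by
  filter_upwards [ae_edgeRel hτ n, ae_weight_ne_zero hτ n] with x ⟨hx, _⟩ hw a
  rw [minEdge, dif_pos hx]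
  constructor
  · rintro rfl; exact hx.choose_spec
  · exact fun h => edgeRel_unique hw hx.choose_spec h

lemma ae_eq_minEdge (hτ : IsLocallyFiniteFilt μ τ) (a : (minimalGraph μ τ).E n) :
    minEdge hτ n ⁻¹' {a} =ᵐ[μ] {y | τ.edgeRel μ n a y} := by
  filter_upwards [ae_minEdge hτ n] with x hx
  exact propext (hx a)

/-- A locally finite filtration is coded by its minimal graph. -/
lemma isCoding_minimalGraph (hτ : IsLocallyFiniteFilt μ τ) (N : ℕ) :
    IsCoding μ τ (minimalGraph μ τ) N (minVertex hτ) (minEdge hτ) := by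
  have hmv : ∀ n (a : (minimalGraph μ τ).V n),
      minVertex hτ n ⁻¹' {a} =ᵐ[μ] {x | τ.typ μ n x = a.1} := fun n a => by
    filter_upwards [ae_minVertex hτ n] with x hx
    refine propext ?_
    change minVertex hτ n x = a ↔ τ.typ μ n x = a.1
    constructor
    · intro h
      rw [← h]; exact hx.symm
    · exact fun h => Subtype.ext (hx.trans h)
  refine ⟨fun n _ a => algMod_congr (measurableSet_typ hτ n a.1) (hmv n a),
    fun n _ a => algMod_congr (measurableSet_edgeRel hτ a) (ae_eq_minEdge hτ a), ?_, ?_, ?_, ?_⟩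
  · intro n _
    filter_upwards [ae_minEdge hτ n, ae_minVertex hτ n] with x h1 h2
    refine Subtype.ext ?_
    rw [h2]
    exact ((h1 _).1 rfl).1.symm
  · intro n _
    filter_upwards [ae_minEdge hτ n, ae_minVertex hτ (n + 1)] with x h1 h2
    refine Subtype.ext ?_
    rw [h2]
    exact ((h1 _).1 rfl).2.1.symm
  · intro n _ a A hA
    rw [measure_congr ((EventuallyEq.refl _ A).inter (ae_eq_minEdge hτ a)),
      measure_congr ((EventuallyEq.refl _ A).inter (hmv (n + 1) _))]
    refine measure_inter_eq_of_ae_cond (τ.nullMeasurableSet_of_algMod (measurableSet_edgeRel hτ a))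
      (measurableSet_typ hτ (n + 1) _) ?_ hA
    filter_upwards [ae_edgeRel hτ n] with x hx
    exact hx.2.1 a
  · intro n _ a A hA
    obtain ⟨C, hC, hAC⟩ := exists_code_preimage hA
    obtain ⟨t, ht, hte⟩ := (τ.nullMeasurableSet_of_algMod hA).inter
      (τ.nullMeasurableSet_of_algMod (measurableSet_edgeRel hτ a))
    -- The required set consists of the elements of level `n + 1` whose part labelled `a` meets `A`
    -- in positive mass. Since `A` has level `n`, that part lies in `A` or misses it, mod 0.
    refine ⟨{x | τ.cond μ (n + 1) x t = 0}ᶜ, τ.alg_le_algMod μ (n + 1) _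
      ((measurable_cond τ μ (n + 1) ht) (measurableSet_singleton 0)).compl, ?_⟩
    filter_upwards [ae_minEdge hτ n, ae_edgeRel hτ n, ae_cond_congr (n := n + 1) (τ := τ) hte,
      hAC.mem_iff, ae_cond_ae (τ := τ) hAC.mem_iff (n + 1), ae_weight_ne_zero hτ n]
      with x h1 h2 h3 h4 h5 h6
    refine propext ?_
    change (x ∈ A ∧ minEdge hτ n x = a) ↔ (¬ (τ.cond μ (n + 1) x t = 0) ∧ minEdge hτ n x = a)
    rw [h1 a, and_congr_left_iff]
    intro ha
    have h7 := h2.2.2 a ha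
    rw [← h3]
    by_cases hxA : x ∈ A
    · simp only [hxA, true_iff]
      have : τ.cond μ (n + 1) x (A ∩ {y | τ.edgeRel μ n a y}) = τ.weight μ n x := by
        refine measure_congr ?_
        filter_upwards [h5, h7] with y hy hy'
        refine propext ?_
        change (y ∈ A ∧ τ.edgeRel μ n a y) ↔ τ.cond μ n y = τ.cond μ n x
        rw [hy', ← code_eq_iff, hy]
        refine ⟨fun h => h.2, fun h => ⟨?_, h⟩⟩
        change τ.code μ n y ∈ C
        rw [h]
        exact h4.1 hxA
      rw [this]
      exact h6
    · simp only [hxA, false_iff, not_not]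
      rw [measure_eq_zero_iff_ae_notMem]
      filter_upwards [h5, h7] with y hy hy' hyA
      have hc := hy'.1 hyA.2
      have : τ.code μ n y ∈ C := hy.1 hyA.1
      rw [hc] at this
      exact hxA (h4.2 this)

end DecFiltration

/-! ### Tails of sequences of σ-algebras -/

lemma iSup_tail_succ {X : Type*} (c : ℕ → MeasurableSpace X) (n : ℕ) :
    (⨆ (k : ℕ) (_ : n ≤ k), c k) = c n ⊔ ⨆ (k : ℕ) (_ : n + 1 ≤ k), c k := by
  refine le_antisymm (iSup₂_le fun k hk => ?_) (sup_le (le_iSup₂_of_le n le_rfl le_rfl)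
    (iSup₂_le fun k hk => le_iSup₂_of_le k (Nat.le_of_succ_le hk) le_rfl))
  rcases Nat.eq_or_lt_of_le hk with rfl | h
  · exact le_sup_left
  · exact le_sup_of_le_right (le_iSup₂_of_le k h le_rfl)

/-- On a fibre of `f`, the sets of `m₁ ⊔ m₂` are traces of sets of `m₂` if this is so for `m₁`. -/
lemma exists_trace_of_sup {X : Type*} {m₁ m₂ : MeasurableSpace X} {D : Set X}
    (h : ∀ s, MeasurableSet[m₁] s → D ⊆ s ∨ D ∩ s = ∅) {A : Set X}
    (hA : MeasurableSet[m₁ ⊔ m₂] A) : ∃ B, MeasurableSet[m₂] B ∧ A ∩ D = B ∩ D := by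
  -- The sets with the same trace on `D` as some set of `m₂` form a σ-algebra; it contains `m₁`,
  -- whose sets contain `D` or miss it.
  let M : MeasurableSpace X :=
    { MeasurableSet' := fun A => ∃ B, MeasurableSet[m₂] B ∧ A ∩ D = B ∩ D
      measurableSet_empty := ⟨∅, @MeasurableSet.empty _ m₂, rfl⟩
      measurableSet_compl := by
        rintro A ⟨B, hB, h⟩
        refine ⟨Bᶜ, hB.compl, ?_⟩
        ext x
        have := Set.ext_iff.1 h x
        simp only [Set.mem_inter_iff, Set.mem_compl_iff] at this ⊢
        tauto
      measurableSet_iUnion := by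
        intro f hf
        choose B hB h using hf
        refine ⟨⋃ i, B i, MeasurableSet.iUnion hB, ?_⟩
        rw [Set.iUnion_inter, Set.iUnion_inter]
        exact Set.iUnion_congr h }
  have hM : m₁ ⊔ m₂ ≤ M := by
    refine sup_le (fun s hs => ?_) fun s hs => ⟨s, hs, rfl⟩
    rcases h s hs with h | h
    · exact ⟨Set.univ, @MeasurableSet.univ _ m₂, by
        rw [Set.univ_inter, Set.inter_eq_right]; exact h⟩
    · exact ⟨∅, @MeasurableSet.empty _ m₂, by rw [Set.inter_comm, h, Set.empty_inter]⟩
  exact hM A hA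

lemma comap_fibre {X Z : Type*} [MeasurableSpace Z] (f : X → Z) (a : Z) {s : Set X}
    (hs : MeasurableSet[MeasurableSpace.comap f inferInstance] s) :
    f ⁻¹' {a} ⊆ s ∨ f ⁻¹' {a} ∩ s = ∅ := by
  obtain ⟨t, ht, rfl⟩ := hs
  by_cases ha : a ∈ t
  · left; rintro x hx; have hx : f x = a := hx; change f x ∈ t; rwa [hx]
  · right; ext x; simp only [Set.mem_inter_iff, Set.mem_preimage, Set.mem_singleton_iff,
      Set.mem_empty_iff_false, iff_false]; rintro ⟨h, h'⟩; rw [h] at h'; exact ha h'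

/-! ### Path spaces -/

namespace GradedMultigraph

variable {Γ : GradedMultigraph}

lemma measurableSet_edge {n k : ℕ} (h : n ≤ k) (s : Set (Γ.E k)) :
    MeasurableSet[Γ.tailAlg n] {p : Γ.Path | p.1 k ∈ s} :=
  (le_iSup₂ (f := fun (k : ℕ) (_ : n ≤ k) =>
    MeasurableSpace.comap (fun p : Γ.Path => p.1 k) ⊤) k h) _ ⟨s, trivial, rfl⟩

lemma measurableSet_edge' (k : ℕ) (s : Set (Γ.E k)) : MeasurableSet {p : Γ.Path | p.1 k ∈ s} :=
  measurableSet_edge (Nat.zero_le k) s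

lemma measurableSet_cyl (q : (i : ℕ) → Γ.E i) (n : ℕ) :
    MeasurableSet {p : Γ.Path | ∀ i < n, p.1 i = q i} := by
  have : {p : Γ.Path | ∀ i < n, p.1 i = q i} = ⋂ i : Fin n, {p : Γ.Path | p.1 i ∈ ({q i} : Set _)} := by
    ext p; simp [Fin.forall_iff]
  rw [this]
  exact MeasurableSet.iInter fun i => measurableSet_edge' _ _

/-- Measurability of maps to the path space with respect to the tail σ-algebras. -/
lemma measurable_tail {X : Type*} {mX : MeasurableSpace X} (hE : ∀ n, Countable (Γ.E n)) {n : ℕ}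
    {f : X → Γ.Path} (hf : ∀ k, n ≤ k → ∀ a, MeasurableSet {x | (f x).1 k = a}) :
    Measurable[mX, Γ.tailAlg n] f := by
  rw [measurable_iff_comap_le, MeasurableSpace.comap_iSup]
  refine iSup_le fun k => ?_
  rw [MeasurableSpace.comap_iSup]
  refine iSup_le fun hk => ?_
  rw [MeasurableSpace.comap_comp]
  rintro _ ⟨s, _, rfl⟩
  have := hE k
  have hs : (fun p : Γ.Path => p.1 k) ∘ f ⁻¹' s = ⋃ a ∈ s, {x | (f x).1 k = a} := by
    ext x; simp
  rw [hs]
  exact MeasurableSet.biUnion (Set.to_countable s) fun a _ => hf k hk a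

lemma standardBorelSpace_path (hE : ∀ n, Countable (Γ.E n)) : StandardBorelSpace Γ.Path := by
  let inst : ∀ n, MeasurableSpace (Γ.E n) := fun n => ⊤
  have hd : ∀ n, DiscreteMeasurableSpace (Γ.E n) := fun n => ⟨fun _ => trivial⟩
  have hS : MeasurableSet {p : (n : ℕ) → Γ.E n | ∀ n, Γ.tgt (p n) = Γ.src (p (n + 1))} := by
    -- Compatibility of two consecutive edges is a countable union of cylinder conditions.
    have : {p : (n : ℕ) → Γ.E n | ∀ n, Γ.tgt (p n) = Γ.src (p (n + 1))} =
        ⋂ n, ⋃ ab : {ab : Γ.E n × Γ.E (n + 1) // Γ.tgt ab.1 = Γ.src ab.2},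
          (fun p => p n) ⁻¹' {ab.1.1} ∩ (fun p => p (n + 1)) ⁻¹' {ab.1.2} := by
      ext p
      simp only [Set.mem_ofPred_eq, Set.mem_iInter, Set.mem_iUnion, Set.mem_inter_iff,
        Set.mem_preimage, Set.mem_singleton_iff]
      refine forall_congr' fun n => ⟨fun h => ⟨⟨(p n, p (n + 1)), h⟩, rfl, rfl⟩, ?_⟩
      rintro ⟨⟨⟨a, b⟩, h⟩, h1, h2⟩
      rw [h1, h2]; exact h
    rw [this]
    refine MeasurableSet.iInter fun n => MeasurableSet.iUnion fun ab => ?_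
    exact ((measurable_pi_apply n) (measurableSet_singleton _)).inter
      ((measurable_pi_apply (n + 1)) (measurableSet_singleton _))
  have hsb := hS.standardBorel
  have heq : (Subtype.instMeasurableSpace : MeasurableSpace
      {p : (n : ℕ) → Γ.E n // ∀ n, Γ.tgt (p n) = Γ.src (p (n + 1))}) = Γ.tailAlg 0 := by
    change MeasurableSpace.comap Subtype.val (⨆ a, MeasurableSpace.comap (fun p : (n : ℕ) → Γ.E n => p a) ⊤) =
      ⨆ (k : ℕ) (_ : 0 ≤ k), _
    rw [MeasurableSpace.comap_iSup]
    refine iSup_congr fun k => ?_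
    rw [MeasurableSpace.comap_comp]
    exact le_antisymm (le_iSup_of_le (Nat.zero_le k) le_rfl) (iSup_le fun _ => le_rfl)
  change @StandardBorelSpace {p : (n : ℕ) → Γ.E n // ∀ n, Γ.tgt (p n) = Γ.src (p (n + 1))}
    (Γ.tailAlg 0)
  rw [← heq]
  exact hsb

/-- A finite measure on the path space is determined by the measures of the cylinders. -/
lemma measure_ext (hE : ∀ n, Countable (Γ.E n)) {ν ν' : Measure Γ.Path} [IsFiniteMeasure ν]
    (h : ∀ (q : Γ.Path) n, ν {p | ∀ i < n, p.1 i = q.1 i} = ν' {p | ∀ i < n, p.1 i = q.1 i})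
    (huniv : ν Set.univ = ν' Set.univ) : ν = ν' := by
  -- Cylinders are indexed by paths; the empty set accounts for words that do not extend to a path.
  set C : Set (Set Γ.Path) := {s | s = ∅ ∨ ∃ (q : Γ.Path) (n : ℕ), s = {p | ∀ i < n, p.1 i = q.1 i}}
  refine ext_of_generate_finite C (le_antisymm ?_ ?_) ?_ ?_ huniv
  · change Γ.tailAlg 0 ≤ _
    refine iSup₂_le fun k _ => ?_
    rintro _ ⟨s, _, rfl⟩
    have : (fun p : Γ.Path => p.1 k) ⁻¹' s =
        ⋃ r : {r : (i : Fin (k + 1)) → Γ.E i // r (Fin.last k) ∈ s},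
          {p : Γ.Path | ∀ i : Fin (k + 1), p.1 i = r.1 i} := by
      ext p
      simp only [Set.mem_preimage, Set.mem_iUnion, Set.mem_ofPred_eq]
      refine ⟨fun hp => ⟨⟨fun i => p.1 i, hp⟩, fun i => rfl⟩, ?_⟩
      rintro ⟨⟨r, hr⟩, hpr⟩
      have : p.1 k = r (Fin.last k) := hpr (Fin.last k)
      rw [this]
      exact hr
    rw [this]
    refine @MeasurableSet.iUnion _ _ (MeasurableSpace.generateFrom C) _ _ fun r => ?_
    refine MeasurableSpace.measurableSet_generateFrom ?_
    rcases Set.eq_empty_or_nonempty {p : Γ.Path | ∀ i : Fin (k + 1), p.1 i = r.1 i} with h | ⟨q, hq⟩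
    · exact Or.inl h
    · refine Or.inr ⟨q, k + 1, ?_⟩
      ext p
      simp only [Set.mem_ofPred_eq, Fin.forall_iff]
      refine forall_congr' fun i => forall_congr' fun hi => ?_
      rw [hq ⟨i, hi⟩]
  · refine MeasurableSpace.generateFrom_le ?_
    rintro s (rfl | ⟨q, n, rfl⟩)
    · exact MeasurableSet.empty
    · exact measurableSet_cyl q.1 n
  · rintro s hs t ht hst
    rcases hs with rfl | ⟨q, n, rfl⟩
    · simp at hst
    rcases ht with rfl | ⟨q', n', rfl⟩
    · simp at hst
    obtain ⟨r, hr, hr'⟩ := hst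
    refine Or.inr ⟨r, max n n', ?_⟩
    ext p
    simp only [Set.mem_inter_iff, Set.mem_ofPred_eq, lt_max_iff] at hr hr' ⊢
    constructor
    · rintro ⟨h1, h2⟩ i (hi | hi)
      · rw [h1 i hi, hr i hi]
      · rw [h2 i hi, hr' i hi]
    · intro h'
      exact ⟨fun i hi => by rw [h' i (Or.inl hi), hr i hi],
        fun i hi => by rw [h' i (Or.inr hi), hr' i hi]⟩
  · rintro s (rfl | ⟨q, n, rfl⟩)
    · simp
    · exact h q n

end GradedMultigraph

/-! ### Codings and path spaces -/

namespace IsCoding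

variable {X : Type*} [mX : MeasurableSpace X] {μ : Measure X} {τ : DecFiltration X}
  {Γ : GradedMultigraph} {N : ℕ} {v : (n : ℕ) → X → Γ.V n} {e : (n : ℕ) → X → Γ.E n}

/-- The map to the path space given by a coding. -/
lemma exists_path [NeZero μ] (hE : ∀ n, Countable (Γ.E n)) (h : ∀ N, IsCoding μ τ Γ N v e) :
    ∃ Φ : X → Γ.Path, Measurable Φ ∧ ∀ᵐ x ∂μ, ∀ n, (Φ x).1 n = e n x := by
  classical
  have hgood : ∀ᵐ x ∂μ, ∀ n, Γ.tgt (e n x) = Γ.src (e (n + 1) x) := by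
    refine ae_all_iff.2 fun n => ?_
    filter_upwards [(h (n + 2)).tgt n (by omega), (h (n + 2)).src (n + 1) (by omega)] with x h1 h2
    rw [h1, h2]
  obtain ⟨x₀, hx₀⟩ := hgood.exists
  let π : X → Γ.Path := fun x => if hx : ∀ n, Γ.tgt (e n x) = Γ.src (e (n + 1) x) then
    ⟨fun n => e n x, hx⟩ else ⟨fun n => e n x₀, hx₀⟩
  have hπ : ∀ᵐ x ∂μ, ∀ n, (π x).1 n = e n x := by
    filter_upwards [hgood] with x hx n
    have : π x = ⟨fun n => e n x, hx⟩ := dif_pos hx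
    rw [this]
  -- The edges are measurable only mod 0, so `π` is null measurable; it is afterwards replaced by a
  -- measurable map that coincides with it a.e.
  have hnull : NullMeasurable π μ := by
    refine GradedMultigraph.measurable_tail (mX := (inferInstance : MeasurableSpace (NullMeasurableSpace X μ)))
      (n := 0) hE fun k _ a => ?_
    have h1 : NullMeasurableSet (e k ⁻¹' {a}) μ :=
      τ.nullMeasurableSet_of_algMod ((h (k + 1)).meas_e k (by omega) a)
    refine h1.congr ?_
    filter_upwards [hπ] with x hx
    refine propext ?_
    change e k x = a ↔ (π x).1 k = a
    rw [hx]
  have := GradedMultigraph.standardBorelSpace_path hE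
  obtain ⟨Φ, hΦ, hΦe⟩ := hnull.aemeasurable
  refine ⟨Φ, hΦ, ?_⟩
  filter_upwards [hπ, hΦe] with x h1 h2 n
  rw [← h2, h1]

section

variable {Φ : X → Γ.Path}

lemma ae_src_path (h : ∀ N, IsCoding μ τ Γ N v e) (hΦe : ∀ᵐ x ∂μ, ∀ n, (Φ x).1 n = e n x) :
    ∀ᵐ x ∂μ, ∀ n, Γ.src ((Φ x).1 n) = v n x := by
  have := ae_all_iff.2 fun n => (h (n + 1)).src n (by omega)
  filter_upwards [this, hΦe] with x h1 h2 n
  rw [h2, h1]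

lemma measurableSet_preimage_tail (hE : ∀ n, Countable (Γ.E n)) (h : ∀ N, IsCoding μ τ Γ N v e)
    (hΦe : ∀ᵐ x ∂μ, ∀ n, (Φ x).1 n = e n x) {n : ℕ} {s : Set Γ.Path}
    (hs : MeasurableSet[Γ.tailAlg n] s) : MeasurableSet[τ.algMod μ n] (Φ ⁻¹' s) := by
  have : Measurable[τ.algMod μ n, Γ.tailAlg n] Φ := by
    refine GradedMultigraph.measurable_tail (mX := τ.algMod μ n) hE fun k hk a => ?_
    refine DecFiltration.algMod_congr (τ.algMod_anti μ hk _ ((h (k + 1)).meas_e k (by omega) a)) ?_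
    filter_upwards [hΦe] with x hx
    refine propext ?_
    change (Φ x).1 k = a ↔ e k x = a
    rw [hx]
  exact this hs

lemma agrees_map (h : ∀ N, IsCoding μ τ Γ N v e) (hV : ∀ a b : Γ.V 0, a = b)
    (hΦ : Measurable Φ) (hΦe : ∀ᵐ x ∂μ, ∀ n, (Φ x).1 n = e n x) : Γ.Agrees (μ.map Φ) := by
  intro q n
  have hsrcm : MeasurableSet {p : Γ.Path | Γ.src (p.1 n) = Γ.src (q.1 n)} :=
    GradedMultigraph.measurableSet_edge' n {a | Γ.src a = Γ.src (q.1 n)}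
  rw [Measure.map_apply hΦ (GradedMultigraph.measurableSet_cyl q.1 n),
    Measure.map_apply hΦ hsrcm]
  have := (h n).law_cyl le_rfl q.1 (fun i => Γ.src (q.1 i)) (fun _ _ => rfl) (fun i _ => q.2 i)
    (A := Set.univ) MeasurableSet.univ (fun _ => ae_of_all _ fun x => hV _ _)
  rw [Set.univ_inter, Set.univ_inter] at this
  have e1 : μ (Φ ⁻¹' {p | ∀ i < n, p.1 i = q.1 i}) = μ {x | ∀ i < n, e i x = q.1 i} := by
    refine measure_congr ?_
    filter_upwards [hΦe] with x hx
    refine propext ?_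
    change (∀ i < n, (Φ x).1 i = q.1 i) ↔ (∀ i < n, e i x = q.1 i)
    simp only [hx]
  have e2 : μ (Φ ⁻¹' {p | Γ.src (p.1 n) = Γ.src (q.1 n)}) = μ (v n ⁻¹' {Γ.src (q.1 n)}) := by
    refine measure_congr ?_
    filter_upwards [ae_src_path h hΦe] with x hx
    refine propext ?_
    change Γ.src ((Φ x).1 n) = Γ.src (q.1 n) ↔ v n x = Γ.src (q.1 n)
    rw [hx]
  rw [e1, e2, this]

lemma map_vertex (h : ∀ N, IsCoding μ τ Γ N v e)
    (hΦ : Measurable Φ) (hΦe : ∀ᵐ x ∂μ, ∀ n, (Φ x).1 n = e n x) (n : ℕ) (a : Γ.V n) :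
    μ.map Φ {p | Γ.src (p.1 n) = a} = μ (v n ⁻¹' {a}) := by
  have hsrcm : MeasurableSet {p : Γ.Path | Γ.src (p.1 n) = a} :=
    GradedMultigraph.measurableSet_edge' n {b | Γ.src b = a}
  rw [Measure.map_apply hΦ hsrcm]
  refine measure_congr ?_
  filter_upwards [ae_src_path h hΦe] with x hx
  refine propext ?_
  change Γ.src ((Φ x).1 n) = a ↔ v n x = a
  rw [hx]

/-- The tail filtration of the path space is coded by the edges. -/
lemma tail_of_map (hE : ∀ n, Countable (Γ.E n)) (h : ∀ N, IsCoding μ τ Γ N v e)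
    (hΦ : Measurable Φ) (hΦe : ∀ᵐ x ∂μ, ∀ n, (Φ x).1 n = e n x) (N : ℕ) :
    IsCoding (μ.map Φ) Γ.tail Γ N (fun n p => Γ.src (p.1 n)) (fun n p => p.1 n) := by
  refine ⟨fun n _ a => Γ.tail.alg_le_algMod _ n _ ?_, fun n _ a => Γ.tail.alg_le_algMod _ n _ ?_,
    fun n _ => ae_of_all _ fun _ => rfl, fun n _ => ae_of_all _ fun p => p.2 n, ?_, ?_⟩
  · exact GradedMultigraph.measurableSet_edge le_rfl {b | Γ.src b = a}
  · exact GradedMultigraph.measurableSet_edge le_rfl {a}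
  · rintro n hn a A ⟨B, hB, hAB⟩
    have hBm : MeasurableSet B := Γ.tail.alg_le (n + 1) _ hB
    rw [measure_congr (hAB.inter (EventuallyEq.refl _ ((fun p : Γ.Path => p.1 n) ⁻¹' {a}))),
      measure_congr (hAB.inter (EventuallyEq.refl _
        ((fun p : Γ.Path => Γ.src (p.1 (n + 1))) ⁻¹' {Γ.tgt a})))]
    have hm1 : MeasurableSet (B ∩ (fun p : Γ.Path => p.1 n) ⁻¹' {a}) :=
      hBm.inter (GradedMultigraph.measurableSet_edge' n {a})
    have hm2 : MeasurableSet (B ∩ (fun p : Γ.Path => Γ.src (p.1 (n + 1))) ⁻¹' {Γ.tgt a}) :=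
      hBm.inter (GradedMultigraph.measurableSet_edge' (n + 1) {b | Γ.src b = Γ.tgt a})
    rw [Measure.map_apply hΦ hm1, Measure.map_apply hΦ hm2]
    have := (h N).law n hn a _ (measurableSet_preimage_tail hE h hΦe hB)
    have e1 : μ (Φ ⁻¹' (B ∩ (fun p : Γ.Path => p.1 n) ⁻¹' {a})) = μ (Φ ⁻¹' B ∩ e n ⁻¹' {a}) := by
      refine measure_congr ?_
      filter_upwards [hΦe] with x hx
      refine propext ?_
      change (Φ x ∈ B ∧ (Φ x).1 n = a) ↔ (Φ x ∈ B ∧ e n x = a)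
      rw [hx]
    have e2 : μ (Φ ⁻¹' (B ∩ (fun p : Γ.Path => Γ.src (p.1 (n + 1))) ⁻¹' {Γ.tgt a})) =
        μ (Φ ⁻¹' B ∩ v (n + 1) ⁻¹' {Γ.tgt a}) := by
      refine measure_congr ?_
      filter_upwards [ae_src_path h hΦe] with x hx
      refine propext ?_
      change (Φ x ∈ B ∧ Γ.src ((Φ x).1 (n + 1)) = Γ.tgt a) ↔ (Φ x ∈ B ∧ v (n + 1) x = Γ.tgt a)
      rw [hx]
    rw [e1, e2, this]
  · rintro n hn a A ⟨B, hB, hAB⟩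
    have hB' : MeasurableSet[Γ.tailAlg n] B := hB
    rw [GradedMultigraph.tailAlg, iSup_tail_succ] at hB'
    obtain ⟨C, hC, hBC⟩ := exists_trace_of_sup (D := (fun p : Γ.Path => p.1 n) ⁻¹' {a})
      (fun s hs => @comap_fibre _ _ ⊤ (fun p : Γ.Path => p.1 n) a s hs) hB'
    refine ⟨C, Γ.tail.alg_le_algMod _ (n + 1) _ hC, ?_⟩
    rw [← hBC]
    exact hAB.inter (EventuallyEq.refl _ _)

end

/-- The cotransition probabilities of the edges that lead to a vertex. -/
lemma sum_cot [IsFiniteMeasure μ] (h : IsCoding μ τ Γ N v e) {n : ℕ} (hn : n < N)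
    [Finite (Γ.E n)] (a : Γ.V (n + 1)) (ha : μ (v (n + 1) ⁻¹' {a}) ≠ 0) :
    ∑' b : {b : Γ.E n // Γ.tgt b = a}, Γ.cot b.1 = 1 := by
  classical
  have hva : NullMeasurableSet (v (n + 1) ⁻¹' {a}) μ :=
    τ.nullMeasurableSet_of_algMod (h.meas_v (n + 1) hn a)
  have h1 : μ (v (n + 1) ⁻¹' {a}) = ∑' b : Γ.E n, μ (v (n + 1) ⁻¹' {a} ∩ e n ⁻¹' {b}) := by
    rw [← measure_iUnion₀]
    · congr 1; ext x; simp
    · intro b c hbc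
      refine Disjoint.aedisjoint ?_
      rw [Set.disjoint_left]
      rintro x ⟨_, hx⟩ ⟨_, hx'⟩
      have hx : e n x = b := hx
      have hx' : e n x = c := hx'
      exact hbc (hx.symm.trans hx')
    · exact fun b => hva.inter (τ.nullMeasurableSet_of_algMod (h.meas_e n hn b))
  have h2 : ∀ b : Γ.E n, μ (v (n + 1) ⁻¹' {a} ∩ e n ⁻¹' {b}) =
      ({b | Γ.tgt b = a}.indicator Γ.cot b) * μ (v (n + 1) ⁻¹' {a}) := by
    intro b
    rw [h.law n hn b _ (h.meas_v (n + 1) hn a)]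
    by_cases hb : Γ.tgt b = a
    · rw [Set.indicator_of_mem (by exact hb), hb, Set.inter_self]
    · rw [Set.indicator_of_notMem (by exact hb), zero_mul]
      have : v (n + 1) ⁻¹' {a} ∩ v (n + 1) ⁻¹' {Γ.tgt b} = ∅ := by
        ext x
        simp only [Set.mem_inter_iff, Set.mem_preimage, Set.mem_singleton_iff,
          Set.mem_empty_iff_false, iff_false]
        rintro ⟨h1, h2⟩; exact hb (h2.symm.trans h1)
      rw [this]; simp
  simp only [h2] at h1
  rw [ENNReal.tsum_mul_right] at h1
  have h3 : (∑' b : Γ.E n, {b | Γ.tgt b = a}.indicator Γ.cot b) = 1 := by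
    have := (ENNReal.mul_left_inj ha (measure_ne_top μ _)).1 (h1.symm.trans (one_mul _).symm)
    exact this
  rw [← h3]
  exact tsum_subtype {b | Γ.tgt b = a} Γ.cot

end IsCoding

/-! ### The minimal graph and its path measure -/

namespace DecFiltration

variable {X : Type*} [mX : MeasurableSpace X] [StandardBorelSpace X]
  {μ : Measure X} [IsProbabilityMeasure μ] {τ : DecFiltration X} {n m : ℕ}

lemma finite_minimalGraph_V (hτ : IsLocallyFiniteFilt μ τ) (n : ℕ) :
    Finite ((minimalGraph μ τ).V n) := by
  obtain ⟨F, hF, hF'⟩ := exists_finite_typ hτ n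
  have : {t : MTree n | μ {x | τ.typ μ n x = t} ≠ 0} ⊆ F := by
    intro t ht
    by_contra hn
    refine ht (measure_mono_null (t := {x | ¬ τ.typ μ n x ∈ F}) (fun x hx hxF => hn ?_) hF')
    have hx : τ.typ μ n x = t := hx
    rw [← hx]; exact hxF
  exact (hF.subset this).to_subtype

open Classical in
lemma finite_minimalGraph_E (hτ : IsLocallyFiniteFilt μ τ) (n : ℕ) :
    Finite ((minimalGraph μ τ).E n) := by
  have h0 := finite_minimalGraph_V hτ n
  have h1 := finite_minimalGraph_V hτ (n + 1)
  have : Finite {t : MTree n // μ {x | τ.typ μ n x = t} ≠ 0} := h0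
  have : Finite {t : MTree (n + 1) // μ {x | τ.typ μ (n + 1) x = t} ≠ 0} := h1
  have key : ∀ (u : MTree n) (s : Multiset (ℝ≥0∞ × MTree n)),
      Finite ((w : ℝ≥0∞) × Fin (Multiset.count (w, u) s)) := by
    intro u s
    have hmem : ∀ a : (w : ℝ≥0∞) × Fin (Multiset.count (w, u) s), (a.1, u) ∈ s := fun a =>
      Multiset.count_pos.1 (Nat.pos_of_ne_zero (fun h => (Fin.cast h a.2).elim0))
    have hfin : Finite {p : ℝ≥0∞ × MTree n // p ∈ s} := (Multiset.finite_toSet s)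
    refine Finite.of_injective (β := {p : ℝ≥0∞ × MTree n // p ∈ s} × Fin (Multiset.card s))
      (fun a => (⟨(a.1, u), hmem a⟩, ⟨a.2, a.2.2.trans_le (Multiset.count_le_card _ _)⟩)) ?_
    rintro ⟨w, k⟩ ⟨w', k'⟩ h
    simp only [Prod.mk.injEq, Subtype.mk.injEq, and_true, Fin.mk.injEq] at h
    obtain ⟨rfl, h⟩ := h
    rw [Fin.ext h]
  have : ∀ (u : {t : MTree n // μ {x | τ.typ μ n x = t} ≠ 0})
    (v : {t : MTree (n + 1) // μ {x | τ.typ μ (n + 1) x = t} ≠ 0}),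
    Finite ((w : ℝ≥0∞) × Fin (Multiset.count (α := ℝ≥0∞ × MTree n) (w, u.1) v.1)) :=
    fun u v => key u.1 v.1
  have hfin : Finite ((u : {t : MTree n // μ {x | τ.typ μ n x = t} ≠ 0}) ×
    (v : {t : MTree (n + 1) // μ {x | τ.typ μ (n + 1) x = t} ≠ 0}) ×
    (w : ℝ≥0∞) × Fin (Multiset.count (α := ℝ≥0∞ × MTree n) (w, u.1) v.1)) := inferInstance
  exact hfin

lemma ae_mem_typ_succ (n : ℕ) (hτ : IsLocallyFiniteFilt μ τ) :
    ∀ᵐ x ∂μ, ∀ s : Multiset (ℝ≥0∞ × MTree n), τ.typ μ (n + 1) x = s → ∀ p ∈ s, p.1 ≠ 0 := by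
  obtain ⟨t, ht⟩ := exists_typ_eq_code τ μ n
  filter_upwards [(hτ (n + 1)).1] with x ⟨hfin, h0⟩ s hs p hp
  rw [tree_succ_eq hfin ht] at hs
  subst hs
  obtain ⟨b, hb, rfl⟩ := Multiset.mem_map.1 hp
  have hb : b ∈ (hfin.image (τ.code μ n)).toFinset := hb
  rw [Set.Finite.mem_toFinset] at hb
  obtain ⟨y, hy, rfl⟩ := hb
  intro h
  exact hy (measure_mono_null (by simp) h)

open Classical in
lemma minimalGraph_cot_ne (hτ : IsLocallyFiniteFilt μ τ) (n : ℕ) (a : (minimalGraph μ τ).E n) :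
    (minimalGraph μ τ).cot a ≠ 0 := by
  have key : ∀ (u : MTree n) (v : MTree (n + 1)) (w : ℝ≥0∞) (k : ℕ),
      μ {x | τ.typ μ (n + 1) x = v} ≠ 0 →
      k < Multiset.count (α := ℝ≥0∞ × MTree n) (w, u) v → w ≠ 0 := by
    intro u v w k hv hk
    have hfreq : ∃ᵐ x ∂μ, τ.typ μ (n + 1) x = v := by
      rw [frequently_ae_iff]; exact hv
    obtain ⟨x, hx, hx'⟩ := (hfreq.and_eventually (ae_mem_typ_succ n hτ)).exists
    exact hx' v hx (w, u) (Multiset.count_pos.1 (Nat.zero_le k |>.trans_lt hk))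
  exact key a.1.1 a.2.1.1 a.2.2.1 a.2.2.2 a.2.1.2 a.2.2.2.2

lemma isFinitePos_minimalGraph (hτ : IsLocallyFiniteFilt μ τ) : (minimalGraph μ τ).IsFinitePos :=
  ⟨finite_minimalGraph_E hτ, minimalGraph_cot_ne hτ⟩

lemma measure_minVertex_preimage (hτ : IsLocallyFiniteFilt μ τ) (n : ℕ)
    (a : (minimalGraph μ τ).V n) : μ (minVertex hτ n ⁻¹' {a}) = μ {x | τ.typ μ n x = a.1} := by
  refine measure_congr ?_
  filter_upwards [ae_minVertex hτ n] with x hx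
  refine propext ?_
  change minVertex hτ n x = a ↔ τ.typ μ n x = a.1
  constructor
  · intro h
    rw [← h]; exact hx.symm
  · exact fun h => Subtype.ext (hx.trans h)

/-- Vertices have positive measure by definition, so a.e. statements about points yield statements
about every vertex. -/
lemma exists_minVertex_eq (hτ : IsLocallyFiniteFilt μ τ) (n : ℕ) (a : (minimalGraph μ τ).V n)
    {P : X → Prop} (hP : ∀ᵐ x ∂μ, P x) : ∃ x, minVertex hτ n x = a ∧ P x := by
  have hfreq : ∃ᵐ x ∂μ, minVertex hτ n x = a := by
    rw [frequently_ae_iff]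
    have := measure_minVertex_preimage hτ n a
    change μ (minVertex hτ n ⁻¹' {a}) ≠ 0
    rw [this]; exact a.2
  exact (hfreq.and_eventually hP).exists

/-- For a.e. point over `a`, the type is the vertex itself and also, by `IsCoding.ae_typ_eq`, the
tree of paths leading to it. This makes minimality immediate. -/
lemma pathTree_minimalGraph (hτ : IsLocallyFiniteFilt μ τ) (n : ℕ) (a : (minimalGraph μ τ).V n) :
    (minimalGraph μ τ).pathTree n a = a.1 := by
  obtain ⟨x, hx, h1, h2⟩ := exists_minVertex_eq hτ n a ((ae_minVertex hτ n).and
    ((isCoding_minimalGraph hτ n).ae_typ_eq (isFinitePos_minimalGraph hτ) le_rfl))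
  rw [hx] at h1 h2
  rw [h1, h2]

lemma isMinimal_minimalGraph (hτ : IsLocallyFiniteFilt μ τ) : (minimalGraph μ τ).IsMinimal := by
  intro n a b hab
  rw [pathTree_minimalGraph hτ, pathTree_minimalGraph hτ] at hab
  exact Subtype.ext hab

lemma minimalGraph_V_zero (a b : (minimalGraph μ τ).V 0) : a = b := Subtype.ext rfl

lemma isEquipped_minimalGraph (hτ : IsLocallyFiniteFilt μ τ) : (minimalGraph μ τ).IsEquipped where
  finite_V := finite_minimalGraph_V hτ
  finite_E := finite_minimalGraph_E hτ
  initial := by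
    obtain ⟨a⟩ := nonempty_minimalGraph_V hτ 0
    exact ⟨a, trivial, fun b _ => minimalGraph_V_zero b a⟩
  succ n a := by
    obtain ⟨x, hx, h⟩ := exists_minVertex_eq hτ n a
      ((isCoding_minimalGraph hτ (n + 1)).src n (Nat.lt_succ_self n))
    exact ⟨_, h.trans hx⟩
  pred n a := by
    obtain ⟨x, hx, h⟩ := exists_minVertex_eq hτ (n + 1) a
      ((isCoding_minimalGraph hτ (n + 1)).tgt n (Nat.lt_succ_self n))
    exact ⟨_, h.trans hx⟩
  cot_pos n a := pos_iff_ne_zero.2 (minimalGraph_cot_ne hτ n a)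
  cot_sum n a := by
    have := finite_minimalGraph_E hτ n
    refine (isCoding_minimalGraph hτ (n + 1)).sum_cot (Nat.lt_succ_self n) a ?_
    rw [measure_minVertex_preimage]
    exact a.2

lemma countable_minimalGraph_E (hτ : IsLocallyFiniteFilt μ τ) (n : ℕ) :
    Countable ((minimalGraph μ τ).E n) :=
  have := finite_minimalGraph_E hτ n
  inferInstance

/-- The distribution of the path of a point, for a coding by the minimal graph. -/
lemma isMinimalMeasure_map {v : (n : ℕ) → X → (minimalGraph μ τ).V n}
    {e : (n : ℕ) → X → (minimalGraph μ τ).E n}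
    (h : ∀ N, IsCoding μ τ (minimalGraph μ τ) N v e)
    (hv : ∀ n, ∀ᵐ x ∂μ, (v n x).1 = τ.typ μ n x)
    {Φ : X → (minimalGraph μ τ).Path} (hΦ : Measurable Φ)
    (hΦe : ∀ᵐ x ∂μ, ∀ n, (Φ x).1 n = e n x) : IsMinimalMeasure μ τ (μ.map Φ) where
  prob := Measure.isProbabilityMeasure_map hΦ.aemeasurable
  agrees := IsCoding.agrees_map h minimalGraph_V_zero hΦ hΦe
  vertex n a := by
    rw [IsCoding.map_vertex h hΦ hΦe]
    refine measure_congr ?_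
    filter_upwards [hv n] with x hx
    refine propext ?_
    change v n x = a ↔ τ.typ μ n x = a.1
    constructor
    · intro h
      rw [← h]; exact hx.symm
    · exact fun h => Subtype.ext (hx.trans h)

/-- Agreement with the equipment expresses the measure of a cylinder through the measure of a
vertex, which is prescribed. -/
lemma IsMinimalMeasure.eq (hτ : IsLocallyFiniteFilt μ τ) {ν ν' : Measure (minimalGraph μ τ).Path}
    (h : IsMinimalMeasure μ τ ν) (h' : IsMinimalMeasure μ τ ν') : ν = ν' := by
  have := h.prob
  have := h'.prob
  refine GradedMultigraph.measure_ext (countable_minimalGraph_E hτ) (fun q n => ?_) (by simp)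
  rw [h.agrees, h'.agrees, h.vertex, h'.vertex]

lemma exists_minPath (hτ : IsLocallyFiniteFilt μ τ) :
    ∃ Φ : X → (minimalGraph μ τ).Path, Measurable Φ ∧ ∀ᵐ x ∂μ, ∀ n, (Φ x).1 n = minEdge hτ n x :=
  IsCoding.exists_path (countable_minimalGraph_E hτ) (isCoding_minimalGraph hτ)

lemma isMinimalMeasure_minimalMeasure (hτ : IsLocallyFiniteFilt μ τ) :
    IsMinimalMeasure μ τ (minimalMeasure μ τ) := by
  obtain ⟨Φ, hΦ, hΦe⟩ := exists_minPath hτ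
  have hex : ∃ ν, IsMinimalMeasure μ τ ν :=
    ⟨_, isMinimalMeasure_map (isCoding_minimalGraph hτ) (ae_minVertex hτ) hΦ hΦe⟩
  rw [minimalMeasure, dif_pos hex]
  exact hex.choose_spec

lemma minimalMeasure_unique (hτ : IsLocallyFiniteFilt μ τ) {ν : Measure (minimalGraph μ τ).Path}
    (h : IsMinimalMeasure μ τ ν) : ν = minimalMeasure μ τ :=
  IsMinimalMeasure.eq hτ h (isMinimalMeasure_minimalMeasure hτ)

lemma standardBorelSpace_minPath (hτ : IsLocallyFiniteFilt μ τ) :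
    StandardBorelSpace (minimalGraph μ τ).Path :=
  GradedMultigraph.standardBorelSpace_path (countable_minimalGraph_E hτ)

/-- The minimal model is coded by its own paths. -/
lemma isCoding_minimalModel (hτ : IsLocallyFiniteFilt μ τ) (N : ℕ) :
    IsCoding (minimalMeasure μ τ) (minimalModel μ τ) (minimalGraph μ τ) N
      (fun n p => (minimalGraph μ τ).src (p.1 n)) (fun n p => p.1 n) := by
  obtain ⟨Φ, hΦ, hΦe⟩ := exists_minPath hτ
  rw [← minimalMeasure_unique hτ
    (isMinimalMeasure_map (isCoding_minimalGraph hτ) (ae_minVertex hτ) hΦ hΦe)]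
  exact IsCoding.tail_of_map (countable_minimalGraph_E hτ) (isCoding_minimalGraph hτ) hΦ hΦe N

end DecFiltration

/-! ### Atomless measures -/

/-- A lower set is an increasing union of half-lines with rational ends, apart from a possible
greatest point, which is null. -/
lemma measure_lowerSet_le {ρ : Measure ℝ} [NullSingletonClass ρ] {L : Set ℝ} (hL : IsLowerSet L)
    {c : ℝ≥0∞} (h : ∀ x ∈ L, ρ (Set.Iic x) ≤ c) : ρ L ≤ c := by
  have hsub : L ⊆ (⋃ q : {q : ℚ // (q : ℝ) ∈ L}, Set.Iic (q : ℝ)) ∪ {x | IsGreatest L x} := by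
    intro x hx
    by_cases hg : IsGreatest L x
    · exact Or.inr hg
    · left
      have : ∃ y ∈ L, x < y := by
        by_contra! hc
        exact hg ⟨hx, hc⟩
      obtain ⟨y, hy, hxy⟩ := this
      obtain ⟨q, hq, hq'⟩ := exists_rat_btwn hxy
      exact Set.mem_iUnion.2 ⟨⟨q, hL hq'.le hy⟩, hq.le⟩
  have hnull : ρ {x | IsGreatest L x} = 0 :=
    Set.Subsingleton.measure_zero (fun x hx y hy => IsGreatest.unique hx hy) _
  refine (measure_mono hsub).trans ((measure_union_le _ _).trans ?_)
  rw [hnull, add_zero, Directed.measure_iUnion]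
  · exact iSup_le fun q => h _ q.2
  · intro q q'
    rcases le_total (q : ℝ) q' with hq | hq
    · exact ⟨q', Set.Iic_subset_Iic.2 hq, subset_rfl⟩
    · exact ⟨q, subset_rfl, Set.Iic_subset_Iic.2 hq⟩

lemma measure_upperSet_le {ρ : Measure ℝ} [NullSingletonClass ρ] {U : Set ℝ} (hU : IsUpperSet U)
    {c : ℝ≥0∞} (h : ∀ x ∈ U, ρ (Set.Ici x) ≤ c) : ρ U ≤ c := by
  have hsub : U ⊆ (⋃ q : {q : ℚ // (q : ℝ) ∈ U}, Set.Ici (q : ℝ)) ∪ {x | IsLeast U x} := by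
    intro x hx
    by_cases hg : IsLeast U x
    · exact Or.inr hg
    · left
      have : ∃ y ∈ U, y < x := by
        by_contra! hc
        exact hg ⟨hx, hc⟩
      obtain ⟨y, hy, hxy⟩ := this
      obtain ⟨q, hq, hq'⟩ := exists_rat_btwn hxy
      exact Set.mem_iUnion.2 ⟨⟨q, hU hq.le hy⟩, hq'.le⟩
  have hnull : ρ {x | IsLeast U x} = 0 :=
    Set.Subsingleton.measure_zero (fun x hx y hy => IsLeast.unique hx hy) _
  refine (measure_mono hsub).trans ((measure_union_le _ _).trans ?_)
  rw [hnull, add_zero, Directed.measure_iUnion]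
  · exact iSup_le fun q => h _ q.2
  · intro q q'
    rcases le_total (q : ℝ) q' with hq | hq
    · exact ⟨q, subset_rfl, Set.Ici_subset_Ici.2 hq⟩
    · exact ⟨q', Set.Ici_subset_Ici.2 hq, subset_rfl⟩

section DistributionFunction

variable (ρ : Measure ℝ) [IsFiniteMeasure ρ]

lemma monotone_measureReal_Iic : Monotone (fun c => ρ.real (Set.Iic c)) :=
  fun _ _ h => measureReal_mono (Set.Iic_subset_Iic.2 h)

variable [NullSingletonClass ρ]

/-- The set is a lower set, which bounds its mass by `t`; its complement is an upper set, which
bounds the remaining mass by the total minus `t`. Together the two bounds force equality. -/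
lemma measure_distribution_le {t : ℝ} (ht : 0 ≤ t) (ht' : t ≤ ρ.real Set.univ) :
    ρ {c | ρ.real (Set.Iic c) ≤ t} = ENNReal.ofReal t := by
  have hmono := monotone_measureReal_Iic ρ
  have h1 : ρ {c | ρ.real (Set.Iic c) ≤ t} ≤ ENNReal.ofReal t := by
    refine measure_lowerSet_le (fun a b hab ha => (hmono hab).trans ha) fun x hx => ?_
    exact ENNReal.le_ofReal_iff_toReal_le (measure_ne_top _ _) ht |>.2 hx
  refine le_antisymm h1 ?_
  have h2 : ρ {c | ρ.real (Set.Iic c) ≤ t}ᶜ ≤ ENNReal.ofReal (ρ.real Set.univ - t) := by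
    refine measure_upperSet_le (fun a b hab ha => fun hb => (show ¬ ρ.real (Set.Iic a) ≤ t from ha)
      (le_trans (hmono hab) hb)) fun x hx => ?_
    refine ENNReal.le_ofReal_iff_toReal_le (measure_ne_top _ _) (sub_nonneg.2 ht') |>.2 ?_
    have hx : ¬ ρ.real (Set.Iic x) ≤ t := hx
    have e1 : ρ (Set.Ici x) = ρ (Set.Iic x)ᶜ := by
      rw [Set.compl_Iic]; exact measure_congr Ioi_ae_eq_Ici.symm
    rw [e1]
    have := measureReal_compl (μ := ρ) (measurableSet_Iic (a := x))
    change ρ.real (Set.Iic x)ᶜ ≤ _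
    rw [this]
    linarith
  have hm : MeasurableSet {c | ρ.real (Set.Iic c) ≤ t} :=
    measurableSet_le hmono.measurable measurable_const
  have h3 := measureReal_compl (μ := ρ) hm
  have h4 : ρ.real {c | ρ.real (Set.Iic c) ≤ t}ᶜ ≤ ρ.real Set.univ - t :=
    ENNReal.toReal_le_of_le_ofReal (sub_nonneg.2 ht') h2
  rw [h3] at h4
  exact ENNReal.ofReal_le_iff_le_toReal (measure_ne_top _ _) |>.2 (by
    change t ≤ ρ.real _
    linarith)

/-- An atomless distribution is transformed to the Lebesgue measure by its distribution function. -/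
lemma map_distribution :
    ρ.map (fun c => ρ.real (Set.Iic c)) = volume.restrict (Set.Ioc 0 (ρ.real Set.univ)) := by
  have hmono := monotone_measureReal_Iic ρ
  have hM : (0 : ℝ) ≤ ρ.real Set.univ := measureReal_nonneg
  refine Measure.ext_of_Iic _ _ fun t => ?_
  rw [Measure.map_apply hmono.measurable measurableSet_Iic,
    Measure.restrict_apply measurableSet_Iic]
  change ρ {c | ρ.real (Set.Iic c) ≤ t} = _
  rcases lt_or_ge t 0 with ht | ht
  · have e1 : {c | ρ.real (Set.Iic c) ≤ t} = ∅ := by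
      ext c
      simp only [Set.mem_ofPred_eq, Set.mem_empty_iff_false, iff_false, not_le]
      exact ht.trans_le measureReal_nonneg
    have e2 : Set.Iic t ∩ Set.Ioc 0 (ρ.real Set.univ) = ∅ := by
      ext c; simp only [Set.mem_inter_iff, Set.mem_Iic, Set.mem_Ioc, Set.mem_empty_iff_false]
      constructor
      · rintro ⟨h1, h2, _⟩; linarith
      · exact fun h => h.elim
    rw [e1, e2]; simp
  · have e2 : Set.Iic t ∩ Set.Ioc 0 (ρ.real Set.univ) = Set.Ioc 0 (min t (ρ.real Set.univ)) := by
      ext c; simp only [Set.mem_inter_iff, Set.mem_Iic, Set.mem_Ioc, le_min_iff]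
      tauto
    have e1 : {c | ρ.real (Set.Iic c) ≤ t} = {c | ρ.real (Set.Iic c) ≤ min t (ρ.real Set.univ)} := by
      ext c
      simp only [Set.mem_ofPred_eq, le_min_iff, iff_self_and]
      exact fun _ => measureReal_mono (Set.subset_univ _)
    rw [e1, e2, measure_distribution_le ρ (le_min ht hM) (min_le_right _ _), Real.volume_Ioc,
      sub_zero]

/-- The distribution function of an atomless distribution generates the σ-algebra mod 0. -/
lemma exists_distribution_preimage {C : Set ℝ} (hC : MeasurableSet C) :
    ∃ D : Set ℝ, MeasurableSet D ∧ (fun c => ρ.real (Set.Iic c)) ⁻¹' D =ᵐ[ρ] C := by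
  have hmono := monotone_measureReal_Iic ρ
  have key : borel ℝ ≤ eventuallyMeasurableSpace
      (MeasurableSpace.comap (fun c => ρ.real (Set.Iic c)) inferInstance) (ae ρ) := by
    rw [borel_eq_generateFrom_Iic]
    refine MeasurableSpace.generateFrom_le ?_
    rintro _ ⟨s, rfl⟩
    refine ⟨{c | ρ.real (Set.Iic c) ≤ ρ.real (Set.Iic s)}, ⟨Set.Iic _, measurableSet_Iic, rfl⟩, ?_⟩
    -- The half-line is contained in this sublevel set and has the same mass, so the two coincide
    -- mod 0 even if the distribution function is not injective.
    refine ae_eq_of_subset_of_measure_ge (fun x hx => hmono hx) ?_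
      measurableSet_Iic.nullMeasurableSet (measure_ne_top _ _)
    rw [measure_distribution_le ρ measureReal_nonneg (measureReal_mono (Set.subset_univ _))]
    exact ENNReal.ofReal_toReal_le
  rw [← BorelSpace.measurable_eq] at key
  obtain ⟨_, ⟨D, hD, rfl⟩, h⟩ := key C hC
  exact ⟨D, hD, h.symm⟩

end DistributionFunction

/-- A set that is not divided by any measurable set has measure zero, for an atomless measure. -/
lemma measure_eq_zero_of_indivisible {X : Type*} [MeasurableSpace X]
    [MeasurableSpace.CountablySeparated X] {μ : Measure X} [NullSingletonClass μ] {T : Set X}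
    (h : ∀ A, MeasurableSet A → μ (T ∩ A) = 0 ∨ μ (T \ A) = 0) : μ T = 0 := by
  obtain ⟨S, hS, hsep⟩ := exists_seq_separating X (p := MeasurableSet) MeasurableSet.univ Set.univ
  -- For each set of the separating family the null one of the two pieces of `T` is discarded; at
  -- most one point survives.
  have hb : ∀ i, ∃ N : Set X, μ N = 0 ∧ ∀ x ∈ T \ N, ∀ y ∈ T \ N, (x ∈ S i ↔ y ∈ S i) := by
    intro i
    rcases h (S i) (hS i) with h | h
    · refine ⟨_, h, fun x hx y hy => ⟨fun hxs => (hx.2 ⟨hx.1, hxs⟩).elim,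
        fun hys => (hy.2 ⟨hy.1, hys⟩).elim⟩⟩
    · refine ⟨_, h, fun x hx y hy => ⟨fun _ => ?_, fun _ => ?_⟩⟩
      · by_contra hc; exact hy.2 ⟨hy.1, hc⟩
      · by_contra hc; exact hx.2 ⟨hx.1, hc⟩
  choose N hN hNS using hb
  have hsub : (T \ ⋃ i, N i).Subsingleton := by
    intro x hx y hy
    refine hsep x trivial y trivial fun i => ?_
    exact hNS i x ⟨hx.1, fun hc => hx.2 (Set.mem_iUnion.2 ⟨i, hc⟩)⟩ y
      ⟨hy.1, fun hc => hy.2 (Set.mem_iUnion.2 ⟨i, hc⟩)⟩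
  refine measure_mono_null (t := (T \ ⋃ i, N i) ∪ ⋃ i, N i) (fun x hx => ?_)
    (measure_union_null (hsub.measure_zero _) (measure_iUnion_null hN))
  by_cases hc : x ∈ ⋃ i, N i
  · exact Or.inr hc
  · exact Or.inl ⟨hx, hc⟩

/-! ### Isomorphism of fragments with the same coding -/

namespace IsCoding

lemma cyl_succ {X : Type*} {Γ : GradedMultigraph} (e : (n : ℕ) → X → Γ.E n) (q : (n : ℕ) → Γ.E n) (n : ℕ) (A : Set X) :
    A ∩ {x | ∀ i < n + 1, e i x = q i} = (A ∩ e n ⁻¹' {q n}) ∩ {x | ∀ i < n, e i x = q i} := by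
  ext x
  simp only [Set.mem_inter_iff, Set.mem_ofPred_eq, Nat.forall_lt_succ_right, Set.mem_preimage,
    Set.mem_singleton_iff]
  tauto

section

variable {X : Type*} [mX : MeasurableSpace X] {μ : Measure X} {τ : DecFiltration X}
  {Γ : GradedMultigraph} {N : ℕ} {v : (n : ℕ) → X → Γ.V n} {e : (n : ℕ) → X → Γ.E n}

lemma measure_eq_zero_of_cyl (hE : ∀ n, Countable (Γ.E n)) (e : (n : ℕ) → X → Γ.E n) (n : ℕ)
    {S : Set X} (h : ∀ x ∈ S, μ (S ∩ {y | ∀ i < n, e i y = e i x}) = 0) : μ S = 0 := by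
  refine measure_mono_null (t := ⋃ r : (i : Fin n) → Γ.E i, S ∩ {y | ∀ i : Fin n, e i y = r i})
    (fun x hx => Set.mem_iUnion.2 ⟨fun i => e i x, hx, fun i => rfl⟩) (measure_iUnion_null fun r => ?_)
  rcases Set.eq_empty_or_nonempty (S ∩ {y | ∀ i : Fin n, e i y = r i}) with h0 | ⟨x, hx, hxr⟩
  · rw [h0]; simp
  · refine measure_mono_null (fun y hy => ?_) (h x hx)
    exact ⟨hy.1, fun i hi => (hy.2 ⟨i, hi⟩).trans (hxr ⟨i, hi⟩).symm⟩

/-- On a cylinder of edges every measurable set is a trace of a set of level `N` (`gen_cyl`), hence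
is determined by the code. So a fibre of the code inside a cylinder is indivisible, and there are
countably many cylinders. -/
lemma measure_code_eq [StandardBorelSpace X] [IsProbabilityMeasure μ] [NullSingletonClass μ]
    (hE : ∀ n, Countable (Γ.E n)) (h : IsCoding μ τ Γ N v e) (c : ℝ) :
    μ (τ.code μ N ⁻¹' {c}) = 0 := by
  refine measure_eq_zero_of_cyl hE e N fun x _ => measure_eq_zero_of_indivisible fun A hA => ?_
  obtain ⟨B, hB, hAB⟩ := h.gen_cyl le_rfl (fun i => e i x)
    (DecFiltration.algMod_zero_of_measurableSet hA)
  obtain ⟨C, hC, hBC⟩ := DecFiltration.exists_code_preimage hB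
  by_cases hc : c ∈ C
  · right
    refine measure_mono_null (t := {y | ¬ ((y ∈ A ∩ {y | ∀ i < N, e i y = e i x} ↔
      y ∈ B ∩ {y | ∀ i < N, e i y = e i x}) ∧ (y ∈ B ↔ y ∈ τ.code μ N ⁻¹' C))}) ?_
      (hAB.mem_iff.and hBC.mem_iff)
    rintro y ⟨⟨hy1, hy2⟩, hyA⟩ ⟨h1, h2⟩
    have hyc : τ.code μ N y = c := hy1
    exact hyA (h1.2 ⟨h2.2 (by change τ.code μ N y ∈ C; rwa [hyc]), hy2⟩).1
  · left
    refine measure_mono_null (t := {y | ¬ ((y ∈ A ∩ {y | ∀ i < N, e i y = e i x} ↔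
      y ∈ B ∩ {y | ∀ i < N, e i y = e i x}) ∧ (y ∈ B ↔ y ∈ τ.code μ N ⁻¹' C))}) ?_
      (hAB.mem_iff.and hBC.mem_iff)
    rintro y ⟨⟨hy1, hy2⟩, hyA⟩ ⟨h1, h2⟩
    have hyc : τ.code μ N y = c := hy1
    have hyC : τ.code μ N y ∈ C := h2.1 (h1.1 ⟨hyA, hy2⟩).1
    rw [hyc] at hyC
    exact hc hyC

lemma measure_eq_tsum {n : ℕ} (hV : Countable (Γ.V n)) (h : IsCoding μ τ Γ N v e) (hn : n ≤ N)
    {D : Set X} (hD : MeasurableSet[τ.algMod μ n] D) : μ D = ∑' a, μ (D ∩ v n ⁻¹' {a}) := by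
  rw [← measure_iUnion₀]
  · congr 1; ext x; simp
  · intro a b hab
    refine Disjoint.aedisjoint (Set.disjoint_left.2 ?_)
    rintro x ⟨_, hx⟩ ⟨_, hx'⟩
    exact hab (hx.symm.trans hx')
  · exact fun a => (τ.nullMeasurableSet_of_algMod hD).inter
      (τ.nullMeasurableSet_of_algMod (h.meas_v n hn a))

lemma measure_edge_vertex (h : IsCoding μ τ Γ N v e) {n : ℕ} (hn : n < N) {A : Set X}
    (hA : MeasurableSet[τ.algMod μ (n + 1)] A) (a : Γ.E n) :
    μ (A ∩ e n ⁻¹' {a} ∩ v n ⁻¹' {Γ.src a}) = Γ.cot a * μ (A ∩ v (n + 1) ⁻¹' {Γ.tgt a}) := by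
  rw [← h.law n hn a A hA]
  refine measure_congr ?_
  filter_upwards [h.src n hn] with x hx
  refine propext ⟨fun h => h.1, fun h => ⟨h, ?_⟩⟩
  have h2 : e n x = a := h.2
  change v n x = Γ.src a
  rw [← hx, h2]

lemma measure_edge_vertex_ne (h : IsCoding μ τ Γ N v e) {n : ℕ} (hn : n < N) (A : Set X)
    {a : Γ.E n} {b : Γ.V n} (hb : Γ.src a ≠ b) : μ (A ∩ e n ⁻¹' {a} ∩ v n ⁻¹' {b}) = 0 := by
  refine measure_mono_null (t := {x | ¬ Γ.src (e n x) = v n x}) ?_ (h.src n hn)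
  rintro x ⟨⟨_, h2⟩, h3⟩ h4
  have h2 : e n x = a := h2
  have h3 : v n x = b := h3
  exact hb (by rw [← h2, h4, h3])

/-- The law of the edges is determined by the law of the final vertex. -/
lemma measure_cyl_eq {Y : Type*} [mY : MeasurableSpace Y] {μ' : Measure Y}
    {τ' : DecFiltration Y} {v' : (n : ℕ) → Y → Γ.V n} {e' : (n : ℕ) → Y → Γ.E n}
    (hV : ∀ n, Countable (Γ.V n))
    (h : IsCoding μ τ Γ N v e) (h' : IsCoding μ' τ' Γ N v' e') {n : ℕ} (hn : n ≤ N) {A : Set X}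
    {A' : Set Y} (hA : MeasurableSet[τ.algMod μ n] A) (hA' : MeasurableSet[τ'.algMod μ' n] A')
    (hAA : ∀ a, μ (A ∩ v n ⁻¹' {a}) = μ' (A' ∩ v' n ⁻¹' {a})) (q : (i : ℕ) → Γ.E i) :
    μ (A ∩ {x | ∀ i < n, e i x = q i}) = μ' (A' ∩ {x | ∀ i < n, e' i x = q i}) := by
  induction n generalizing A A' with
  | zero =>
    simp only [not_lt_zero, IsEmpty.forall_iff, implies_true, Set.ofPred_true, Set.inter_univ]
    rw [h.measure_eq_tsum (hV 0) hn hA, h'.measure_eq_tsum (hV 0) hn hA']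
    exact tsum_congr hAA
  | succ n ih =>
    rw [cyl_succ, cyl_succ]
    refine ih (Nat.le_of_succ_le hn)
      ((τ.algMod_anti μ (Nat.le_succ n) _ hA).inter (h.meas_e n hn _))
      ((τ'.algMod_anti μ' (Nat.le_succ n) _ hA').inter (h'.meas_e n hn _)) fun b => ?_
    -- Fixing the edge `q n` moves the mass at its target, multiplied by the cotransition
    -- probability, to its source, and no other vertex of level `n` is charged.
    by_cases hb : Γ.src (q n) = b
    · subst hb
      rw [h.measure_edge_vertex hn hA, h'.measure_edge_vertex hn hA', hAA]
    · rw [h.measure_edge_vertex_ne hn A hb, h'.measure_edge_vertex_ne hn A' hb]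

end

end IsCoding

namespace IsCoding

section

variable {X : Type*} [mX : MeasurableSpace X] {μ : Measure X} {τ : DecFiltration X}
  {Γ : GradedMultigraph} {N : ℕ} {v : (n : ℕ) → X → Γ.V n} {e : (n : ℕ) → X → Γ.E n}

/-- A real coordinate that, together with the vertex, generates the last σ-algebra of the
fragment, and is uniformly distributed given the vertex. -/
lemma exists_uniform_coordinate [StandardBorelSpace X] [IsProbabilityMeasure μ]
    [NullSingletonClass μ] (hV : ∀ n, Countable (Γ.V n)) (hE : ∀ n, Countable (Γ.E n))
    (h : IsCoding μ τ Γ N v e) :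
    ∃ u : X → ℝ,
      (∀ C, MeasurableSet C → MeasurableSet[τ.algMod μ N] (u ⁻¹' C)) ∧
      (∀ C, MeasurableSet C → ∀ a, μ (u ⁻¹' C ∩ v N ⁻¹' {a}) =
        volume.restrict (Set.Ioc 0 (μ.real (v N ⁻¹' {a}))) C) ∧
      ∀ A, MeasurableSet[τ.algMod μ N] A → ∀ a, ∃ D, MeasurableSet D ∧
        (A ∩ v N ⁻¹' {a} : Set X) =ᵐ[μ] (u ⁻¹' D ∩ v N ⁻¹' {a} : Set X) := by
  have := hV N
  have hcode : Measurable (τ.code μ N) := (τ.measurable_code μ N).mono (τ.alg_le N) le_rfl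
  -- The distribution of the code on each vertex is atomless, so its own distribution function makes
  -- the coordinate uniform on an interval whose length is the measure of the vertex.
  set ρ : Γ.V N → Measure ℝ := fun a => (μ.restrict (v N ⁻¹' {a})).map (τ.code μ N)
  have hvn : ∀ a, NullMeasurableSet (v N ⁻¹' {a}) μ := fun a =>
    τ.nullMeasurableSet_of_algMod (h.meas_v N le_rfl a)
  have hρ : ∀ a C, MeasurableSet C → ρ a C = μ (τ.code μ N ⁻¹' C ∩ v N ⁻¹' {a}) := by
    intro a C hC
    rw [Measure.map_apply hcode hC, Measure.restrict_apply (hcode hC)]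
  have hatom : ∀ a, NullSingletonClass (ρ a) := fun a => ⟨fun c => by
    rw [hρ a _ (measurableSet_singleton c)]
    exact measure_mono_null Set.inter_subset_left (h.measure_code_eq hE c)⟩
  have huniv : ∀ a, (ρ a).real Set.univ = μ.real (v N ⁻¹' {a}) := by
    intro a
    rw [Measure.real, hρ a _ MeasurableSet.univ]
    simp [Measure.real]
  have hmeas : ∀ a, Measurable (fun c => (ρ a).real (Set.Iic c)) := fun a =>
    (monotone_measureReal_Iic (ρ a)).measurable
  set u : X → ℝ := fun x => (ρ (v N x)).real (Set.Iic (τ.code μ N x))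
  have hu : ∀ C a, u ⁻¹' C ∩ v N ⁻¹' {a} =
      τ.code μ N ⁻¹' ((fun c => (ρ a).real (Set.Iic c)) ⁻¹' C) ∩ v N ⁻¹' {a} := by
    intro C a
    ext x
    refine and_congr_left fun hx => ?_
    have hx : v N x = a := hx
    change (ρ (v N x)).real (Set.Iic (τ.code μ N x)) ∈ C ↔ _
    rw [hx]; rfl
  refine ⟨u, fun C hC => ?_, fun C hC a => ?_, fun A hA a => ?_⟩
  · have : u ⁻¹' C = ⋃ a, u ⁻¹' C ∩ v N ⁻¹' {a} := by ext x; simp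
    rw [this]
    refine MeasurableSet.iUnion fun a => ?_
    rw [hu]
    exact (τ.alg_le_algMod μ N _ (τ.measurable_code μ N (hmeas a hC))).inter
      (h.meas_v N le_rfl a)
  · rw [hu, ← hρ a _ (hmeas a hC), ← Measure.map_apply (hmeas a) hC, map_distribution, huniv]
  · obtain ⟨C, hC, hAC⟩ := DecFiltration.exists_code_preimage hA
    obtain ⟨D, hD, hDC⟩ := exists_distribution_preimage (ρ a) hC
    refine ⟨D, hD, ?_⟩
    rw [hu]
    have h1 := ae_of_ae_map hcode.aemeasurable hDC.mem_iff
    rw [ae_restrict_iff'₀ (hvn a)] at h1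
    filter_upwards [h1, hAC.mem_iff] with x h1 h2
    refine propext (and_congr_left fun hx => ?_)
    exact h2.trans (h1 hx).symm

/-- The σ-algebra generated by the first two coordinates and the edges from level `n` on. -/
@[reducible] def codeAlg (Γ : GradedMultigraph) [∀ n, MeasurableSpace (Γ.V n)] [∀ n, MeasurableSpace (Γ.E n)]
    (N n : ℕ) : MeasurableSpace (ℝ × Γ.V N × ((i : Fin N) → Γ.E i)) :=
  (MeasurableSpace.comap (fun z => z.1) inferInstance ⊔
    MeasurableSpace.comap (fun z => z.2.1) inferInstance) ⊔
    ⨆ (i : Fin N) (_ : n ≤ i), MeasurableSpace.comap (fun z => z.2.2 i) inferInstance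

section

variable [∀ n, MeasurableSpace (Γ.V n)] [∀ n, MeasurableSpace (Γ.E n)]

lemma codeAlg_le (n : ℕ) :
    codeAlg Γ N n ≤ (inferInstance : MeasurableSpace (ℝ × Γ.V N × ((i : Fin N) → Γ.E i))) := by
  refine sup_le (sup_le ?_ ?_) (iSup₂_le fun i _ => ?_)
  · exact measurable_iff_comap_le.1 measurable_fst
  · exact measurable_iff_comap_le.1 (measurable_fst.comp measurable_snd)
  · exact measurable_iff_comap_le.1
      ((measurable_pi_apply i).comp (measurable_snd.comp measurable_snd))

lemma codeAlg_anti : Antitone (codeAlg Γ N) := fun _ _ hmn =>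
  sup_le_sup_left (iSup₂_le fun i hi => le_iSup₂ (f := fun (i : Fin N) (_ : _ ≤ (i : ℕ)) =>
    MeasurableSpace.comap (fun z : ℝ × Γ.V N × ((i : Fin N) → Γ.E i) => z.2.2 i) inferInstance)
      i (hmn.trans hi)) _

lemma measurable_codeAlg_edge {n : ℕ} (i : Fin N) (hi : n ≤ i) :
    Measurable[codeAlg Γ N n] (fun z => z.2.2 i) :=
  measurable_iff_comap_le.2 ((le_iSup₂ (f := fun (i : Fin N) (_ : n ≤ (i : ℕ)) =>
    MeasurableSpace.comap (fun z : ℝ × Γ.V N × ((i : Fin N) → Γ.E i) => z.2.2 i) inferInstance)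
      i hi).trans le_sup_right)

variable [∀ n, DiscreteMeasurableSpace (Γ.V n)] [∀ n, DiscreteMeasurableSpace (Γ.E n)]

/-- Downward induction from `N`: the coordinate and the vertex generate the last σ-algebra, and by
`gen` a set of level `k` is glued, along the fibres of the edge `e k`, from sets of level `k + 1`.
-/
lemma carries_codeAlg (hV : ∀ n, Countable (Γ.V n)) (hE : ∀ n, Countable (Γ.E n))
    (h : IsCoding μ τ Γ N v e) {u : X → ℝ}
    (hu : ∀ C, MeasurableSet C → MeasurableSet[τ.algMod μ N] (u ⁻¹' C))
    (hgen : ∀ A, MeasurableSet[τ.algMod μ N] A → ∀ a, ∃ D, MeasurableSet D ∧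
        (A ∩ v N ⁻¹' {a} : Set X) =ᵐ[μ] (u ⁻¹' D ∩ v N ⁻¹' {a} : Set X))
    {Φ : X → ℝ × Γ.V N × ((i : Fin N) → Γ.E i)}
    (hΦ : Φ =ᵐ[μ] fun x => (u x, v N x, fun i => e i x)) {n : ℕ} (hn : n ≤ N) :
    CarriesMod0 μ Φ (τ.alg n) (codeAlg Γ N n) := by
  have := hV N
  have hpre : ∀ s, Φ ⁻¹' s =ᵐ[μ] (fun x => (u x, v N x, fun i : Fin N => e i x)) ⁻¹' s := by
    intro s
    filter_upwards [hΦ] with x hx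
    change (Φ x ∈ s) = (_ ∈ s)
    rw [hx]
  rw [carriesMod0_iff]
  constructor
  · have : Measurable[τ.algMod μ n, codeAlg Γ N n]
        (fun x => (u x, v N x, fun i : Fin N => e i x)) := by
      rw [measurable_iff_comap_le, codeAlg, MeasurableSpace.comap_sup, MeasurableSpace.comap_sup,
        MeasurableSpace.comap_iSup]
      refine sup_le (sup_le ?_ ?_) (iSup_le fun i => ?_)
      · rw [MeasurableSpace.comap_comp]
        rintro _ ⟨s, hs, rfl⟩
        exact τ.algMod_anti μ hn _ (hu s hs)
      · rw [MeasurableSpace.comap_comp]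
        rintro _ ⟨s, hs, rfl⟩
        refine τ.algMod_anti μ hn _ ?_
        have : (fun z : ℝ × Γ.V N × ((i : Fin N) → Γ.E i) => z.2.1) ∘
            (fun x => (u x, v N x, fun i : Fin N => e i x)) ⁻¹' s = ⋃ a ∈ s, v N ⁻¹' {a} := by
          ext x; simp
        rw [this]
        exact MeasurableSet.biUnion s.to_countable fun a _ => h.meas_v N le_rfl a
      · rw [MeasurableSpace.comap_iSup]
        refine iSup_le fun hi => ?_
        rw [MeasurableSpace.comap_comp]
        rintro _ ⟨s, hs, rfl⟩
        refine τ.algMod_anti μ hi _ ?_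
        have := hE i
        have e1 : (fun z : ℝ × Γ.V N × ((i : Fin N) → Γ.E i) => z.2.2 i) ∘
            (fun x => (u x, v N x, fun i : Fin N => e i x)) ⁻¹' s = ⋃ a ∈ s, e i ⁻¹' {a} := by
          ext x; simp
        rw [e1]
        exact MeasurableSet.biUnion s.to_countable fun a _ => h.meas_e i i.2 a
    exact fun s hs => τ.algMod_congr (this hs) (hpre s)
  · have key : ∀ m, m ≤ N → ∀ A, MeasurableSet[τ.algMod μ m] A →
        ∃ s, MeasurableSet[codeAlg Γ N m] s ∧ Φ ⁻¹' s =ᵐ[μ] A := by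
      refine fun m hm => Nat.decreasingInduction' (P := fun m => ∀ A, MeasurableSet[τ.algMod μ m] A →
        ∃ s, MeasurableSet[codeAlg Γ N m] s ∧ Φ ⁻¹' s =ᵐ[μ] A) ?_ hm ?_
      · intro k hk _ ih A hA
        have := hE k
        choose B hB hAB using fun a => h.gen k hk a A hA
        choose s hs hsB using fun a => ih (B a) (hB a)
        refine ⟨⋃ a, s a ∩ (fun z => z.2.2 ⟨k, hk⟩) ⁻¹' {a}, MeasurableSet.iUnion fun a =>
          (codeAlg_anti (Nat.le_succ k) _ (hs a)).inter
            (measurable_codeAlg_edge ⟨k, hk⟩ le_rfl (measurableSet_singleton a)), ?_⟩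
        filter_upwards [hΦ, ae_all_iff.2 fun a => (hAB a).mem_iff,
          ae_all_iff.2 fun a => (hsB a).mem_iff] with x hx h1 h2
        refine propext ?_
        have h3 : (Φ x).2.2 ⟨k, hk⟩ = e k x := by rw [hx]
        change Φ x ∈ (⋃ a, s a ∩ (fun z => z.2.2 ⟨k, hk⟩) ⁻¹' {a}) ↔ x ∈ A
        simp only [Set.mem_iUnion, Set.mem_inter_iff, Set.mem_preimage, Set.mem_singleton_iff, h3]
        have h4 := h1 (e k x)
        simp only [Set.mem_inter_iff, Set.mem_preimage, Set.mem_singleton_iff, and_true] at h4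
        simp only [exists_eq_right']
        exact (h2 _).trans h4.symm
      · intro A hA
        choose D hD hAD using hgen A hA
        refine ⟨⋃ a, (fun z => z.1) ⁻¹' (D a) ∩ (fun z => z.2.1) ⁻¹' {a}, ?_, ?_⟩
        · refine MeasurableSet.iUnion fun a => MeasurableSet.inter ?_ ?_
          · exact (le_sup_left.trans le_sup_left : _ ≤ codeAlg Γ N N) _ ⟨_, hD a, rfl⟩
          · exact (le_sup_right.trans le_sup_left : _ ≤ codeAlg Γ N N) _
              ⟨_, measurableSet_singleton a, rfl⟩
        · filter_upwards [hΦ, ae_all_iff.2 fun a => (hAD a).mem_iff] with x hx h1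
          refine propext ?_
          change Φ x ∈ (⋃ a, (fun z => z.1) ⁻¹' (D a) ∩ (fun z => z.2.1) ⁻¹' {a}) ↔ x ∈ A
          rw [hx]
          have h4 := h1 (v N x)
          simp only [Set.mem_inter_iff, Set.mem_preimage, Set.mem_singleton_iff, and_true] at h4
          simp only [Set.mem_iUnion, Set.mem_inter_iff, Set.mem_preimage, Set.mem_singleton_iff,
            exists_eq_right']
          exact h4.symm
    exact key n hn

lemma aemeasurable_code (hV : ∀ n, Countable (Γ.V n)) (hE : ∀ n, Countable (Γ.E n))
    (h : IsCoding μ τ Γ N v e) {u : X → ℝ}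
    (hu : ∀ C, MeasurableSet C → MeasurableSet[τ.algMod μ N] (u ⁻¹' C)) :
    AEMeasurable (fun x => (u x, v N x, fun i : Fin N => e i x)) μ := by
  refine AEMeasurable.prodMk ?_ (AEMeasurable.prodMk ?_ (aemeasurable_pi_lambda _ fun i => ?_))
  · exact NullMeasurable.aemeasurable fun C hC => τ.nullMeasurableSet_of_algMod (hu C hC)
  · have := hV N
    refine NullMeasurable.aemeasurable fun s _ => ?_
    rw [← Set.biUnion_preimage_singleton]
    exact NullMeasurableSet.biUnion s.to_countable fun a _ =>
      τ.nullMeasurableSet_of_algMod (h.meas_v N le_rfl a)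
  · have := hE i
    refine NullMeasurable.aemeasurable fun s _ => ?_
    rw [← Set.biUnion_preimage_singleton]
    exact NullMeasurableSet.biUnion s.to_countable fun a _ =>
      τ.nullMeasurableSet_of_algMod (h.meas_e i i.2 a)

/-- The vertex and the edges take countably many values. For each of them `measure_cyl_eq` applies
to the set of level `N` cut out by the coordinate and the vertex. -/
lemma map_code_eq {Y : Type*} [mY : MeasurableSpace Y] {μ' : Measure Y}
    {τ' : DecFiltration Y} {v' : (n : ℕ) → Y → Γ.V n} {e' : (n : ℕ) → Y → Γ.E n}
    (hV : ∀ n, Countable (Γ.V n)) (hE : ∀ n, Countable (Γ.E n)) [hne : ∀ n, Nonempty (Γ.E n)]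
    (h : IsCoding μ τ Γ N v e) (h' : IsCoding μ' τ' Γ N v' e') {u : X → ℝ} {u' : Y → ℝ}
    (hu : ∀ C, MeasurableSet C → MeasurableSet[τ.algMod μ N] (u ⁻¹' C))
    (hu' : ∀ C, MeasurableSet C → MeasurableSet[τ'.algMod μ' N] (u' ⁻¹' C))
    (hlaw : ∀ C, MeasurableSet C → ∀ a, μ (u ⁻¹' C ∩ v N ⁻¹' {a}) = μ' (u' ⁻¹' C ∩ v' N ⁻¹' {a})) :
    μ.map (fun x => (u x, v N x, fun i : Fin N => e i x)) =
      μ'.map (fun x => (u' x, v' N x, fun i : Fin N => e' i x)) := by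
  classical
  have hm := h.aemeasurable_code hV hE hu
  have hm' := h'.aemeasurable_code hV hE hu'
  have := hV N
  have hEi : ∀ i : Fin N, Countable (Γ.E i) := fun i => hE i
  refine (Measure.ext_iff_of_iUnion_eq_univ (s := fun w : Γ.V N × ((i : Fin N) → Γ.E i) =>
    Prod.snd ⁻¹' {w}) ?_).2 ?_
  · ext z; simp
  · rintro ⟨a, r⟩
    refine Measure.ext fun S hS => ?_
    have hS' : MeasurableSet (S ∩ (Prod.snd ⁻¹' {(a, r)})) :=
      hS.inter (measurable_snd (measurableSet_singleton _))
    rw [Measure.restrict_apply hS, Measure.restrict_apply hS, Measure.map_apply_of_aemeasurable hm hS',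
      Measure.map_apply_of_aemeasurable hm' hS']
    -- The word `r`, continued arbitrarily beyond `N`.
    set q : (i : ℕ) → Γ.E i := fun i => if hi : i < N then r ⟨i, hi⟩ else Classical.choice (hne i)
    have hq : ∀ i : Fin N, q i = r i := fun i => dif_pos i.2
    set C : Set ℝ := {c | (c, a, r) ∈ S}
    have hC : MeasurableSet C := measurable_prodMk_right hS
    have e1 : ∀ (o : ℝ) (b : Γ.V N) (p : (i : ℕ) → Γ.E i),
        ((o, b, fun i : Fin N => p i) ∈ S ∩ (Prod.snd ⁻¹' {(a, r)}) ↔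
        (o ∈ C ∧ b ∈ ({a} : Set _)) ∧ ∀ i < N, p i = q i) := by
      intro o b p
      simp only [Set.mem_inter_iff, Set.mem_preimage, Set.mem_singleton_iff, Prod.mk.injEq, C,
        Set.mem_ofPred_eq]
      have : (fun i : Fin N => p i) = r ↔ ∀ i < N, p i = q i := by
        rw [funext_iff, Fin.forall_iff]
        refine forall_congr' fun i => forall_congr' fun hi => ?_
        rw [← hq ⟨i, hi⟩]
      rw [← this]
      constructor
      · rintro ⟨h1, h2, h3⟩; rw [h2, h3] at h1; exact ⟨⟨h1, h2⟩, h3⟩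
      · rintro ⟨⟨h1, h2⟩, h3⟩; rw [h2, h3]; exact ⟨h1, rfl, rfl⟩
    have e2 : (fun x => (u x, v N x, fun i : Fin N => e i x)) ⁻¹' (S ∩ (Prod.snd ⁻¹' {(a, r)})) =
        (u ⁻¹' C ∩ v N ⁻¹' {a}) ∩ {x | ∀ i < N, e i x = q i} := by
      ext x; exact e1 _ _ fun i => e i x
    have e2' : (fun x => (u' x, v' N x, fun i : Fin N => e' i x)) ⁻¹' (S ∩ (Prod.snd ⁻¹' {(a, r)})) =
        (u' ⁻¹' C ∩ v' N ⁻¹' {a}) ∩ {x | ∀ i < N, e' i x = q i} := by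
      ext x; exact e1 _ _ fun i => e' i x
    rw [e2, e2']
    refine measure_cyl_eq hV h h' le_rfl ((hu C hC).inter (h.meas_v N le_rfl a))
      ((hu' C hC).inter (h'.meas_v N le_rfl a)) (fun b => ?_) q
    by_cases hb : a = b
    · subst hb
      rw [Set.inter_assoc, Set.inter_self, Set.inter_assoc, Set.inter_self, hlaw C hC]
    · have e3 : u ⁻¹' C ∩ v N ⁻¹' {a} ∩ v N ⁻¹' {b} = ∅ := by
        ext x
        simp only [Set.mem_inter_iff, Set.mem_preimage, Set.mem_singleton_iff,
          Set.mem_empty_iff_false, iff_false, not_and]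
        rintro ⟨_, h2⟩ h3; exact hb (h2.symm.trans h3)
      have e3' : u' ⁻¹' C ∩ v' N ⁻¹' {a} ∩ v' N ⁻¹' {b} = ∅ := by
        ext x
        simp only [Set.mem_inter_iff, Set.mem_preimage, Set.mem_singleton_iff,
          Set.mem_empty_iff_false, iff_false, not_and]
        rintro ⟨_, h2⟩ h3; exact hb (h2.symm.trans h3)
      rw [e3, e3']; simp

end

/-- Two fragments of filtrations of atomless spaces that are coded by the same equipped
multigraph, with the same distribution of the final vertices, are isomorphic. -/
theorem exists_iso {Y : Type*} [mY : MeasurableSpace Y] {μ' : Measure Y}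
    {τ' : DecFiltration Y} {v' : (n : ℕ) → Y → Γ.V n} {e' : (n : ℕ) → Y → Γ.E n}
    [StandardBorelSpace X] [StandardBorelSpace Y] [IsProbabilityMeasure μ] [IsProbabilityMeasure μ']
    [NullSingletonClass μ] [NullSingletonClass μ']
    (hV : ∀ n, Countable (Γ.V n)) (hE : ∀ n, Countable (Γ.E n))
    (h : IsCoding μ τ Γ N v e) (h' : IsCoding μ' τ' Γ N v' e')
    (hvv : ∀ a, μ (v N ⁻¹' {a}) = μ' (v' N ⁻¹' {a})) :
    ∃ (f : X → Y) (g : Y → X), IsIsoMod0 μ μ' f g ∧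
      ∀ n ≤ N, CarriesMod0 μ f (τ.alg n) (τ'.alg n) := by
  let instV : ∀ n, MeasurableSpace (Γ.V n) := fun n => ⊤
  let instE : ∀ n, MeasurableSpace (Γ.E n) := fun n => ⊤
  have hdV : ∀ n, DiscreteMeasurableSpace (Γ.V n) := fun n => ⟨fun _ => trivial⟩
  have hdE : ∀ n, DiscreteMeasurableSpace (Γ.E n) := fun n => ⟨fun _ => trivial⟩
  obtain ⟨u, hu, hlaw, hgen⟩ := h.exists_uniform_coordinate hV hE
  obtain ⟨u', hu', hlaw', hgen'⟩ := h'.exists_uniform_coordinate hV hE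
  have hX : Nonempty X := nonempty_of_isProbabilityMeasure μ
  have hne : ∀ n, Nonempty (Γ.E n) := fun n => hX.map (e n)
  have hm := h.aemeasurable_code hV hE hu
  have hm' := h'.aemeasurable_code hV hE hu'
  have hmap := map_code_eq hV hE h h' hu hu' fun C hC a => by
    rw [hlaw C hC, hlaw' C hC, Measure.real, Measure.real, hvv]
  -- The two coding maps are measurable only mod 0 and are replaced by measurable versions.
  rw [Measure.map_congr hm.ae_eq_mk, Measure.map_congr hm'.ae_eq_mk] at hmap
  have hc : ∀ n ≤ N, CarriesMod0 μ (hm.mk _) (τ.alg n) (codeAlg Γ N n) := fun n hn =>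
    h.carries_codeAlg hV hE hu hgen hm.ae_eq_mk.symm hn
  have hc' : ∀ n ≤ N, CarriesMod0 μ' (hm'.mk _) (τ'.alg n) (codeAlg Γ N n) := fun n hn =>
    h'.carries_codeAlg hV hE hu' hgen' hm'.ae_eq_mk.symm hn
  have hEi : ∀ i : Fin N, Countable (Γ.E i) := fun i => hE i
  obtain ⟨f, g, hfg, hcar⟩ := exists_iso_of_map_eq (a := τ.alg) (b := τ'.alg)
    (c := codeAlg Γ N) hm.measurable_mk hm'.measurable_mk hmap
    (fun t ht => by
      obtain ⟨s, hs, hst⟩ := (hc 0 (Nat.zero_le N)).2 t (by rw [τ.alg_zero]; exact ht)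
      exact ⟨s, codeAlg_le 0 _ hs, hst⟩)
    (fun t ht => by
      obtain ⟨s, hs, hst⟩ := (hc' 0 (Nat.zero_le N)).2 t (by rw [τ'.alg_zero]; exact ht)
      exact ⟨s, codeAlg_le 0 _ hs, hst⟩)
  exact ⟨f, g, hfg, fun n hn => hcar n (hc n hn) (hc' n hn)⟩

end

end IsCoding

/-! ### Isomorphisms of equipped multigraphs -/

namespace GradedMultigraph

open Classical in
/-- The equipped multigraph whose vertices are given types of trees. -/
def ofTypes (P : (n : ℕ) → MTree n → Prop) : GradedMultigraph where
  V n := {t : MTree n // P n t}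
  E n := (u : {t : MTree n // P n t}) × (v : {t : MTree (n + 1) // P (n + 1) t}) ×
    (w : ℝ≥0∞) × Fin (Multiset.count (α := ℝ≥0∞ × MTree n) (w, u.1) v.1)
  src e := e.1
  tgt e := e.2.1
  cot e := e.2.2.1

/-- The identical isomorphism. -/
def Iso.refl (Γ : GradedMultigraph) : Iso Γ Γ where
  onV _ := Equiv.refl _
  onE _ := Equiv.refl _
  src_comm _ _ := rfl
  tgt_comm _ _ := rfl
  cot_comm _ _ := rfl

/-- `minimalGraph` is definitionally of this form. With the predicates as variables, filtrations
with the same types of positive probability get isomorphic graphs by substitution. -/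
lemma exists_iso_ofTypes {P Q : (n : ℕ) → MTree n → Prop} (h : ∀ n t, P n t ↔ Q n t) :
    ∃ φ : Iso (ofTypes P) (ofTypes Q), ∀ n a, (φ.onV n a).1 = a.1 := by
  have : P = Q := funext fun n => funext fun t => propext (h n t)
  subst this
  exact ⟨Iso.refl _, fun _ _ => rfl⟩

variable {Γ Δ : GradedMultigraph}

lemma Iso.onE_symm_path (φ : Iso Γ Δ) (q : Δ.Path) (n : ℕ) :
    Γ.tgt ((φ.onE n).symm (q.1 n)) = Γ.src ((φ.onE (n + 1)).symm (q.1 (n + 1))) := by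
  apply (φ.onV (n + 1)).injective
  rw [← φ.tgt_comm, ← φ.src_comm, Equiv.apply_symm_apply, Equiv.apply_symm_apply, q.2 n]

lemma Iso.measurable_onPath (φ : Iso Γ Δ) (hE : ∀ n, Countable (Δ.E n)) : Measurable φ.onPath := by
  refine measurable_tail hE fun k _ a => ?_
  exact measurableSet_edge' k {b | φ.onE k b = a}

lemma Iso.onPath_preimage_vertex (φ : Iso Γ Δ) (n : ℕ) (a : Δ.V n) :
    φ.onPath ⁻¹' {p | Δ.src (p.1 n) = a} = {p | Γ.src (p.1 n) = (φ.onV n).symm a} := by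
  ext p
  change Δ.src (φ.onE n (p.1 n)) = a ↔ Γ.src (p.1 n) = (φ.onV n).symm a
  rw [φ.src_comm, Equiv.eq_symm_apply]

lemma Iso.map_vertex (φ : Iso Γ Δ) (hE : ∀ n, Countable (Δ.E n)) (ν : Measure Γ.Path) (n : ℕ)
    (a : Δ.V n) :
    ν.map φ.onPath {p | Δ.src (p.1 n) = a} = ν {p | Γ.src (p.1 n) = (φ.onV n).symm a} := by
  have hm : MeasurableSet {p : Δ.Path | Δ.src (p.1 n) = a} :=
    measurableSet_edge' n {b | Δ.src b = a}
  rw [Measure.map_apply (φ.measurable_onPath hE) hm, φ.onPath_preimage_vertex]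

lemma Iso.agrees_map (φ : Iso Γ Δ) (hE : ∀ n, Countable (Δ.E n)) {ν : Measure Γ.Path}
    (h : Γ.Agrees ν) : Δ.Agrees (ν.map φ.onPath) := by
  intro q n
  have hq := h ⟨fun n => (φ.onE n).symm (q.1 n), φ.onE_symm_path q⟩ n
  rw [φ.map_vertex hE, Measure.map_apply (φ.measurable_onPath hE) (measurableSet_cyl q.1 n)]
  have e1 : φ.onPath ⁻¹' {p | ∀ i < n, p.1 i = q.1 i} =
      {p | ∀ i < n, p.1 i = (φ.onE i).symm (q.1 i)} := by
    ext p
    change (∀ i < n, φ.onE i (p.1 i) = q.1 i) ↔ ∀ i < n, p.1 i = (φ.onE i).symm (q.1 i)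
    simp only [Equiv.eq_symm_apply]
  have e2 : Γ.src ((φ.onE n).symm (q.1 n)) = (φ.onV n).symm (Δ.src (q.1 n)) := by
    apply (φ.onV n).injective
    rw [← φ.src_comm, Equiv.apply_symm_apply, Equiv.apply_symm_apply]
  have e3 : ∀ i, Γ.cot ((φ.onE i).symm (q.1 i)) = Δ.cot (q.1 i) := fun i => by
    rw [← φ.cot_comm, Equiv.apply_symm_apply]
  rw [e1, ← e2, hq]
  simp only [e3]

end GradedMultigraph

lemma IsCoding.comp_graphIso {X : Type*} [mX : MeasurableSpace X] {μ : Measure X}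
    {τ : DecFiltration X} {Γ Δ : GradedMultigraph} {N : ℕ} {v : (n : ℕ) → X → Γ.V n}
    {e : (n : ℕ) → X → Γ.E n} (h : IsCoding μ τ Γ N v e) (φ : GradedMultigraph.Iso Γ Δ) :
    IsCoding μ τ Δ N (fun n x => φ.onV n (v n x)) (fun n x => φ.onE n (e n x)) := by
  have hv : ∀ n a, (fun x => φ.onV n (v n x)) ⁻¹' {a} = v n ⁻¹' {(φ.onV n).symm a} := by
    intro n a; ext x
    exact (Equiv.eq_symm_apply _).symm
  have he : ∀ n a, (fun x => φ.onE n (e n x)) ⁻¹' {a} = e n ⁻¹' {(φ.onE n).symm a} := by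
    intro n a; ext x
    exact (Equiv.eq_symm_apply _).symm
  refine ⟨fun n hn a => ?_, fun n hn a => ?_, fun n hn => ?_, fun n hn => ?_, fun n hn a A hA => ?_,
    fun n hn a A hA => ?_⟩
  · rw [hv]; exact h.meas_v n hn _
  · rw [he]; exact h.meas_e n hn _
  · filter_upwards [h.src n hn] with x hx
    rw [φ.src_comm, hx]
  · filter_upwards [h.tgt n hn] with x hx
    rw [φ.tgt_comm, hx]
  · obtain ⟨b, rfl⟩ := (φ.onE n).surjective a
    rw [he, hv, h.law n hn _ A hA, φ.tgt_comm, φ.cot_comm, Equiv.symm_apply_apply,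
      Equiv.symm_apply_apply]
  · rw [he]; exact h.gen n hn _ A hA

/-! ### Finite isomorphism and the minimal model -/

namespace DecFiltration

section

variable {X : Type*} [mX : MeasurableSpace X] [StandardBorelSpace X]
  {μ : Measure X} [IsProbabilityMeasure μ] {τ : DecFiltration X}

lemma countable_minimalGraph_V (hτ : IsLocallyFiniteFilt μ τ) (n : ℕ) :
    Countable ((minimalGraph μ τ).V n) :=
  have := finite_minimalGraph_V hτ n
  inferInstance

lemma minVertex_preimage_eq (hτ : IsLocallyFiniteFilt μ τ) (n : ℕ) (a : (minimalGraph μ τ).V n) :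
    μ (minVertex hτ n ⁻¹' {a}) =
      minimalMeasure μ τ {p | (minimalGraph μ τ).src (p.1 n) = a} := by
  rw [measure_minVertex_preimage, (isMinimalMeasure_minimalMeasure hτ).vertex]

/-- Continuity is preserved already by an isomorphism of the fragments with `N = 0`. Conversely, the
filtration and its model are coded by the same graph with the same vertex laws, and
`IsCoding.exists_iso` applies. -/
lemma finIso_minimalModel_iff [NullSingletonClass μ] (hτ : IsLocallyFiniteFilt μ τ) :
    FinIso μ τ (minimalMeasure μ τ) (minimalModel μ τ) ↔
      NullSingletonClass (minimalMeasure μ τ) := by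
  have := standardBorelSpace_minPath hτ
  have := (isMinimalMeasure_minimalMeasure hτ).prob
  constructor
  · intro h
    obtain ⟨f, g, hfg, -⟩ := h 0
    exact hfg.nullSingleton
  · intro h N
    exact (isCoding_minimalGraph hτ N).exists_iso (countable_minimalGraph_V hτ)
      (countable_minimalGraph_E hτ) (isCoding_minimalModel hτ N) (minVertex_preimage_eq hτ N)

/-- Over the path `p`, a measurable set `B` agrees mod 0 with a set `C n` of level `n`, for every
`n`, and so with the upper limit of the `C n`. The upper limit belongs to all the σ-algebras
exactly, not merely mod 0, so ergodicity makes it trivial. Thus the fibre over `p` is indivisible.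
-/
lemma nullSingleton_minimalMeasure_of_ergodic [NullSingletonClass μ]
    (hτ : IsLocallyFiniteFilt μ τ) (he : IsErgodicFilt μ τ) :
    NullSingletonClass (minimalMeasure μ τ) := by
  have := standardBorelSpace_minPath hτ
  obtain ⟨Φ, hΦ, hΦe⟩ := exists_minPath hτ
  rw [← minimalMeasure_unique hτ
    (isMinimalMeasure_map (isCoding_minimalGraph hτ) (ae_minVertex hτ) hΦ hΦe)]
  refine ⟨fun p => ?_⟩
  rw [Measure.map_apply hΦ (measurableSet_singleton p)]
  refine measure_eq_zero_of_indivisible fun B hB => ?_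
  have hex : ∀ n, ∃ C, MeasurableSet[τ.alg n] C ∧ ∀ᵐ x ∂μ, Φ x = p → (x ∈ B ↔ x ∈ C) := by
    intro n
    obtain ⟨D, ⟨C, hC, hDC⟩, hBD⟩ := (isCoding_minimalGraph hτ n).gen_cyl le_rfl p.1
      (algMod_zero_of_measurableSet hB)
    refine ⟨C, hC, ?_⟩
    filter_upwards [hDC.mem_iff, hBD.mem_iff, hΦe] with x h1 h2 h3 hp
    have h4 : ∀ i < n, minEdge hτ i x = p.1 i := fun i _ => by rw [← h3, hp]
    simp only [Set.mem_inter_iff, Set.mem_ofPred_eq] at h2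
    tauto
  choose C hC hBC using hex
  have hBC := ae_all_iff.2 hBC
  have hL : ∀ m, MeasurableSet[τ.alg m] {x | ∃ᶠ n in atTop, x ∈ C n} := by
    intro m
    have e1 : {x | ∃ᶠ n in atTop, x ∈ C n} = ⋂ k : ℕ, ⋃ n : ℕ, C (max m k + n) := by
      ext x
      simp only [Set.mem_ofPred_eq, frequently_atTop, Set.mem_iInter, Set.mem_iUnion]
      refine ⟨fun h k => ?_, fun h k => ?_⟩
      · obtain ⟨n, hn, hx⟩ := h (max m k)
        exact ⟨n - max m k, by rwa [Nat.add_sub_cancel' hn]⟩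
      · obtain ⟨n, hx⟩ := h k
        exact ⟨_, by omega, hx⟩
    rw [e1]
    exact MeasurableSet.iInter fun k => MeasurableSet.iUnion fun n =>
      τ.anti (by omega) _ (hC (max m k + n))
  rcases he _ hL with h | h
  · left
    refine measure_mono_null (t := {x | ¬ ∀ n, Φ x = p → (x ∈ B ↔ x ∈ C n)} ∪
      {x | ∃ᶠ n in atTop, x ∈ C n}) ?_ (measure_union_null hBC h)
    rintro x ⟨hx, hxB⟩
    by_cases hc : ∀ n, Φ x = p → (x ∈ B ↔ x ∈ C n)
    · exact Or.inr (Frequently.of_forall fun n => (hc n hx).1 hxB)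
    · exact Or.inl hc
  · right
    refine measure_mono_null (t := {x | ¬ ∀ n, Φ x = p → (x ∈ B ↔ x ∈ C n)} ∪
      {x | ∃ᶠ n in atTop, x ∈ C n}ᶜ) ?_ (measure_union_null hBC h)
    rintro x ⟨hx, hxB⟩
    by_cases hc : ∀ n, Φ x = p → (x ∈ B ↔ x ∈ C n)
    · refine Or.inr fun hf => ?_
      obtain ⟨n, hn⟩ := Frequently.exists hf
      exact hxB ((hc n hx).2 hn)
    · exact Or.inl hc

end

section

variable {X Y : Type*} [mX : MeasurableSpace X] [StandardBorelSpace X]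
  [mY : MeasurableSpace Y] [StandardBorelSpace Y]
  {μ : Measure X} [IsProbabilityMeasure μ] {τ : DecFiltration X}
  {μ' : Measure Y} [IsProbabilityMeasure μ'] {τ' : DecFiltration Y}

/-- The isomorphism pulls the coding of `τ'` by its minimal graph back to a coding of `τ`, and a
coding determines the types. -/
lemma ae_typ_eq_of_iso (hτ' : IsLocallyFiniteFilt μ' τ') {n : ℕ} {f : X → Y} {g : Y → X}
    (hf : IsIsoMod0 μ μ' f g) (hc : ∀ m ≤ n, CarriesMod0 μ f (τ.alg m) (τ'.alg m)) :
    ∀ᵐ x ∂μ, τ.typ μ n x = τ'.typ μ' n (f x) := by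
  filter_upwards [((isCoding_minimalGraph hτ' n).comp_iso hf hc).ae_typ_eq
    (isFinitePos_minimalGraph hτ') le_rfl,
    hf.preserving.quasiMeasurePreserving.ae (ae_minVertex hτ' n)] with x h1 h2
  rw [h1, pathTree_minimalGraph hτ', h2]

lemma FinIso.measure_typ_eq (hτ' : IsLocallyFiniteFilt μ' τ') (h : FinIso μ τ μ' τ') (n : ℕ)
    (t : MTree n) : μ {x | τ.typ μ n x = t} = μ' {y | τ'.typ μ' n y = t} := by
  obtain ⟨f, g, hf, hc⟩ := h n
  rw [← hf.measure_preimage (τ'.nullMeasurableSet_of_algMod (measurableSet_typ hτ' n t))]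
  refine measure_congr ?_
  filter_upwards [ae_typ_eq_of_iso hτ' hf hc] with x hx
  refine propext ?_
  change _ = t ↔ _ = t
  rw [hx]

/-- Equal measures of types give the same graph, and the transported path measure satisfies the
conditions that determine it uniquely. -/
lemma sameMinimalModel_of_measure_typ (hτ : IsLocallyFiniteFilt μ τ)
    (hτ' : IsLocallyFiniteFilt μ' τ')
    (h : ∀ n t, μ {x | τ.typ μ n x = t} = μ' {y | τ'.typ μ' n y = t}) :
    SameMinimalModel μ τ μ' τ' := by
  obtain ⟨φ, hφ⟩ := GradedMultigraph.exists_iso_ofTypes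
    (P := fun n t => μ {x | τ.typ μ n x = t} ≠ 0) (Q := fun n t => μ' {x | τ'.typ μ' n x = t} ≠ 0)
    (fun n t => by rw [h])
  change GradedMultigraph.Iso (minimalGraph μ τ) (minimalGraph μ' τ') at φ
  refine ⟨φ, minimalMeasure_unique hτ' ⟨?_, ?_, ?_⟩⟩
  · have := (isMinimalMeasure_minimalMeasure hτ).prob
    exact Measure.isProbabilityMeasure_map
      (φ.measurable_onPath (countable_minimalGraph_E hτ')).aemeasurable
  · exact φ.agrees_map (countable_minimalGraph_E hτ') (isMinimalMeasure_minimalMeasure hτ).agrees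
  · intro n a
    obtain ⟨b, rfl⟩ := (φ.onV n).surjective a
    rw [φ.map_vertex (countable_minimalGraph_E hτ'), Equiv.symm_apply_apply,
      (isMinimalMeasure_minimalMeasure hτ).vertex, h]
    have := hφ n b
    change (φ.onV n b).1 = b.1 at this
    rw [this]

lemma FinIso.of_sameMinimalModel [NullSingletonClass μ] [NullSingletonClass μ']
    (hτ : IsLocallyFiniteFilt μ τ) (hτ' : IsLocallyFiniteFilt μ' τ')
    (h : SameMinimalModel μ τ μ' τ') : FinIso μ τ μ' τ' := by
  obtain ⟨φ, hφ⟩ := h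
  intro N
  refine ((isCoding_minimalGraph hτ N).comp_graphIso φ).exists_iso (countable_minimalGraph_V hτ')
    (countable_minimalGraph_E hτ') (isCoding_minimalGraph hτ' N) fun a => ?_
  rw [minVertex_preimage_eq, ← hφ, φ.map_vertex (countable_minimalGraph_E hτ'),
    ← minVertex_preimage_eq hτ]
  congr 1
  ext x
  exact (Equiv.eq_symm_apply _).symm

lemma finIso_iff_sameMinimalModel [NullSingletonClass μ] [NullSingletonClass μ']
    (hτ : IsLocallyFiniteFilt μ τ) (hτ' : IsLocallyFiniteFilt μ' τ') :
    FinIso μ τ μ' τ' ↔ SameMinimalModel μ τ μ' τ' :=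
  ⟨fun h => sameMinimalModel_of_measure_typ hτ hτ' (FinIso.measure_typ_eq hτ' h),
    FinIso.of_sameMinimalModel hτ hτ'⟩

end

end DecFiltration

/-! ### Multigraphs with one vertex at every level -/

namespace IsCoding

section

variable {X : Type*} [mX : MeasurableSpace X] {μ : Measure X} {τ : DecFiltration X}
  {Γ : GradedMultigraph} {N : ℕ} {v : (n : ℕ) → X → Γ.V n} {e : (n : ℕ) → X → Γ.E n}

/-- With a single vertex at level `n + 1` the conditional law of the edge is constant, which is
independence of the next σ-algebra. -/
lemma measure_inter_edge [IsProbabilityMeasure μ] (h : IsCoding μ τ Γ N v e) {n : ℕ} (hn : n < N)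
    [Countable (Γ.E n)] [Subsingleton (Γ.V (n + 1))] {A : Set X}
    (hA : MeasurableSet[τ.algMod μ (n + 1)] A) (s : Set (Γ.E n)) :
    μ (A ∩ e n ⁻¹' s) = μ (e n ⁻¹' s) * μ A := by
  have key : ∀ B : Set X, MeasurableSet[τ.algMod μ (n + 1)] B →
      μ (B ∩ e n ⁻¹' s) = (∑' a : s, Γ.cot a.1) * μ B := by
    intro B hB
    have e1 : B ∩ e n ⁻¹' s = ⋃ a : s, B ∩ e n ⁻¹' {a.1} := by ext x; simp
    rw [e1, measure_iUnion₀]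
    · rw [← ENNReal.tsum_mul_right]
      refine tsum_congr fun a => ?_
      rw [h.law n hn _ B hB]
      have : v (n + 1) ⁻¹' {Γ.tgt a.1} = Set.univ :=
        Set.eq_univ_of_forall fun x => Subsingleton.elim _ _
      rw [this, Set.inter_univ]
    · intro a b hab
      refine Disjoint.aedisjoint (Set.disjoint_left.2 ?_)
      rintro x ⟨_, hx⟩ ⟨_, hx'⟩
      exact hab (Subtype.ext (hx.symm.trans hx'))
    · exact fun a => (τ.nullMeasurableSet_of_algMod hB).inter
        (τ.nullMeasurableSet_of_algMod (h.meas_e n hn _))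
  have h1 := key Set.univ MeasurableSet.univ
  rw [Set.univ_inter, measure_univ, mul_one] at h1
  rw [key A hA, h1]

end

end IsCoding

lemma comap_injective_eq_top {α : Type*} [Countable α] {ι : α → ℝ} (hι : ι.Injective) :
    MeasurableSpace.comap ι inferInstance = (⊤ : MeasurableSpace α) := by
  refine top_le_iff.1 fun s _ => ⟨ι '' s, (s.to_countable.image ι).measurableSet, ?_⟩
  exact Set.preimage_image_eq s hι

namespace GradedMultigraph

lemma isBernoulliFilt_tail {Γ : GradedMultigraph} (hE : ∀ n, Countable (Γ.E n))
    (hV : ∀ n, Subsingleton (Γ.V n)) {ν : Measure Γ.Path} [IsProbabilityMeasure ν]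
    (h : ∀ N, IsCoding ν Γ.tail Γ N (fun n p => Γ.src (p.1 n)) (fun n p => p.1 n)) :
    IsBernoulliFilt ν Γ.tail := by
  have hι : ∀ n, ∃ ι : Γ.E n → ℝ, ι.Injective := fun n => by
    obtain ⟨f, hf⟩ := Countable.exists_injective_nat (Γ.E n)
    exact ⟨fun a => (f a : ℝ), fun a b hab => hf (Nat.cast_injective hab)⟩
  choose ι hι using hι
  have hcomap : ∀ k, MeasurableSpace.comap (fun p : Γ.Path => ι k (p.1 k)) inferInstance =
      MeasurableSpace.comap (fun p : Γ.Path => p.1 k) ⊤ := by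
    intro k
    rw [← comap_injective_eq_top (hι k), MeasurableSpace.comap_comp]
    rfl
  refine ⟨fun k p => ι k (p.1 k), fun k => ?_, ?_, fun n => ?_⟩
  · rw [measurable_iff_comap_le, hcomap]
    rintro _ ⟨s, -, rfl⟩
    exact measurableSet_edge' k s
  · rw [iIndepFun_iff_measure_inter_preimage_eq_mul]
    intro S B hB
    -- The least index is split off, because the remaining coordinates are then measurable with
    -- respect to the tail beyond it.
    induction S using Finset.induction_on_min with
    | empty => simp
    | insert a S ha ih =>
      have haS : a ∉ S := fun h => lt_irrefl _ (ha a h)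
      have hA : MeasurableSet[Γ.tail.algMod ν (a + 1)]
          (⋂ i ∈ S, (fun p : Γ.Path => ι i (p.1 i)) ⁻¹' B i) := by
        refine Finset.measurableSet_biInter _ fun i hi => Γ.tail.alg_le_algMod ν _ _ ?_
        exact measurableSet_edge (ha i hi) (ι i ⁻¹' B i)
      have := hV (a + 1)
      have := hE a
      rw [Finset.set_biInter_insert, Finset.prod_insert haS,
        ← ih fun i hi => hB i (Finset.mem_insert_of_mem hi), Set.inter_comm]
      exact (h (a + 1)).measure_inter_edge (Nat.lt_succ_self a) hA (ι a ⁻¹' B a)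
  · simp only [hcomap]
    exact ⟨fun s hs => ⟨s, hs, EventuallyEq.rfl⟩, fun s hs => ⟨s, hs, EventuallyEq.rfl⟩⟩

lemma measure_singleton_le_prod_cot {Γ : GradedMultigraph} {ν : Measure Γ.Path} [IsProbabilityMeasure ν]
    (h : Γ.Agrees ν) (p : Γ.Path) (n : ℕ) : ν {p} ≤ ∏ i ∈ Finset.range n, Γ.cot (p.1 i) := by
  have h1 : ν {p} ≤ ν {q | ∀ i < n, q.1 i = p.1 i} := measure_mono (by
    rintro q hq i _
    rw [Set.mem_singleton_iff.1 hq])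
  rw [h p n] at h1
  exact h1.trans (mul_le_of_le_one_right' prob_le_one)

end GradedMultigraph

namespace DecFiltration

section

variable {X : Type*} [mX : MeasurableSpace X] [StandardBorelSpace X]
  {μ : Measure X} [IsProbabilityMeasure μ] {τ : DecFiltration X}

lemma isBernoulliFilt_minimalModel (hτ : IsLocallyFiniteFilt μ τ)
    (hV : ∀ n, Subsingleton ((minimalGraph μ τ).V n)) :
    IsBernoulliFilt (minimalMeasure μ τ) (minimalModel μ τ) :=
  have := (isMinimalMeasure_minimalMeasure hτ).prob
  GradedMultigraph.isBernoulliFilt_tail (countable_minimalGraph_E hτ) hV (isCoding_minimalModel hτ)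

lemma subsingleton_minimalGraph_V {n : ℕ} {t : MTree n} (h : ∀ᵐ x ∂μ, τ.typ μ n x = t) :
    Subsingleton ((minimalGraph μ τ).V n) := by
  have key : ∀ a : (minimalGraph μ τ).V n, a.1 = t := by
    intro a
    by_contra hc
    refine a.2 (measure_mono_null (t := {x | ¬ τ.typ μ n x = t}) (fun x hx hx' => hc ?_) h)
    have hx : τ.typ μ n x = a.1 := hx
    rw [← hx, hx']
  exact ⟨fun a b => Subtype.ext ((key a).trans (key b).symm)⟩

/-! ### Adic filtrations -/

lemma adic_ae_cond_self {r : ℕ → ℕ} (h : IsAdicFilt μ τ r) (n : ℕ) :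
    ∀ᵐ x ∂μ, (∏ i ∈ Finset.range n, r i) ≠ 0 ∧
      τ.cond μ n x {x} = ((∏ i ∈ Finset.range n, r i : ℕ) : ℝ≥0∞)⁻¹ := by
  filter_upwards [h.2 n, (h.1 n).1, ae_cond_self_ne_zero h.1 n] with x h1 h2 h3
  rw [massType, dif_pos h2.1] at h1
  have hmem : τ.cond μ n x {x} ∈ h2.1.toFinset.val.map (fun y => τ.cond μ n x {y}) :=
    Multiset.mem_map.2 ⟨x, h2.1.mem_toFinset.2 h3, rfl⟩
  rw [h1] at hmem
  exact ⟨(Multiset.mem_replicate.1 hmem).1, (Multiset.mem_replicate.1 hmem).2⟩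

lemma adic_ne_zero {r : ℕ → ℕ} (h : IsAdicFilt μ τ r) (n : ℕ) : r n ≠ 0 := by
  obtain ⟨x, hx⟩ := (adic_ae_cond_self h (n + 1)).exists
  have := hx.1
  rw [Finset.prod_range_succ] at this
  exact right_ne_zero_of_mul this

lemma adic_ae_weight {r : ℕ → ℕ} (h : IsAdicFilt μ τ r) (n : ℕ) :
    ∀ᵐ x ∂μ, τ.weight μ n x = (r n : ℝ≥0∞)⁻¹ := by
  filter_upwards [adic_ae_cond_self h n, adic_ae_cond_self h (n + 1), ae_cond_succ_singleton τ μ n]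
    with x h1 h2 h3
  rw [h2.2, h1.2, Finset.prod_range_succ, Nat.cast_mul, ENNReal.mul_inv, mul_comm] at h3
  · have hne : ((∏ i ∈ Finset.range n, r i : ℕ) : ℝ≥0∞)⁻¹ ≠ 0 :=
      ENNReal.inv_ne_zero.2 (ENNReal.natCast_ne_top _)
    have hnt : ((∏ i ∈ Finset.range n, r i : ℕ) : ℝ≥0∞)⁻¹ ≠ ⊤ :=
      ENNReal.inv_ne_top.2 (Nat.cast_ne_zero.2 h1.1)
    exact ((ENNReal.mul_left_inj hne hnt).1 h3).symm
  · exact Or.inr (ENNReal.natCast_ne_top _)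
  · exact Or.inl (ENNReal.natCast_ne_top _)

lemma adic_cot {r : ℕ → ℕ} (h : IsAdicFilt μ τ r) (n : ℕ) (a : (minimalGraph μ τ).E n) :
    (minimalGraph μ τ).cot a = (r n : ℝ≥0∞)⁻¹ := by
  have hc := isCoding_minimalGraph h.1 (n + 1)
  have hpos : μ (minEdge h.1 n ⁻¹' {a}) ≠ 0 := by
    have := hc.law n (Nat.lt_succ_self n) a Set.univ MeasurableSet.univ
    rw [Set.univ_inter, Set.univ_inter] at this
    rw [this, measure_minVertex_preimage]
    exact mul_ne_zero (minimalGraph_cot_ne h.1 n a) ((minimalGraph μ τ).tgt a).2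
  have hfreq : ∃ᵐ x ∂μ, minEdge h.1 n x = a := by
    rw [frequently_ae_iff]; exact hpos
  obtain ⟨x, hx, h1, h2⟩ := (hfreq.and_eventually ((adic_ae_weight h n).and
    (hc.ae_weight_eq (isFinitePos_minimalGraph h.1) (Nat.lt_succ_self n)))).exists
  rw [← hx, ← h2, h1]

/-- The cotransition probabilities into a vertex all equal the inverse of `r n` and sum to 1, so
exactly `r n` edges arrive, all from the only vertex of level `n`. The trees of paths coincide, and
minimality identifies the vertices. -/
lemma adic_subsingleton {r : ℕ → ℕ} (h : IsAdicFilt μ τ r) (n : ℕ) :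
    Subsingleton ((minimalGraph μ τ).V n) := by
  classical
  induction n with
  | zero => exact ⟨minimalGraph_V_zero⟩
  | succ n ih =>
    have hfE := finite_minimalGraph_E h.1 n
    have := Fintype.ofFinite ((minimalGraph μ τ).E n)
    obtain ⟨u⟩ := nonempty_minimalGraph_V h.1 n
    have key : ∀ a : (minimalGraph μ τ).V (n + 1),
        (minimalGraph μ τ).pathTree (n + 1) a =
          (Multiset.replicate (r n) ((r n : ℝ≥0∞)⁻¹, (minimalGraph μ τ).pathTree n u) :
            Multiset (ℝ≥0∞ × MTree n)) := by
      intro a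
      have hfin : {e : (minimalGraph μ τ).E n | (minimalGraph μ τ).tgt e = a}.Finite :=
        Set.toFinite _
      refine (dif_pos hfin).trans ?_
      refine (Multiset.eq_replicate (α := ℝ≥0∞ × MTree n)).2 ?_
      constructor
      · rw [Multiset.card_map]
        have hs := (isEquipped_minimalGraph h.1).cot_sum n a
        simp only [adic_cot h] at hs
        rw [tsum_fintype, Finset.sum_const, Finset.card_univ, nsmul_eq_mul,
          Fintype.card_of_subtype (p := fun e => (minimalGraph μ τ).tgt e = a) hfin.toFinset
            (fun e => hfin.mem_toFinset), ← div_eq_mul_inv,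
          ENNReal.div_eq_one_iff (Nat.cast_ne_zero.2 (adic_ne_zero h n))
            (ENNReal.natCast_ne_top _), Nat.cast_inj] at hs
        exact hs
      · intro b hb
        obtain ⟨e, he, rfl⟩ := Multiset.mem_map.1 hb
        rw [adic_cot h, Subsingleton.elim ((minimalGraph μ τ).src e) u]
    refine ⟨fun a b => isMinimal_minimalGraph h.1 (n + 1) ?_⟩
    rw [key a, key b]

/-- The measure of a path is at most the inverse of a product of the first `r i`, and these products
are unbounded. -/
lemma adic_nullSingleton {r : ℕ → ℕ} (h : IsAdicFilt μ τ r) (hr : ∃ᶠ n in atTop, 2 ≤ r n) :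
    NullSingletonClass (minimalMeasure μ τ) := by
  have hm := isMinimalMeasure_minimalMeasure h.1
  have := hm.prob
  have hgrow : ∀ K : ℕ, ∃ n, K ≤ ∏ i ∈ Finset.range n, r i := by
    have hpos : ∀ i, 1 ≤ r i := fun i => Nat.one_le_iff_ne_zero.2 (adic_ne_zero h i)
    intro K
    induction K with
    | zero => exact ⟨0, Nat.zero_le _⟩
    | succ K ih =>
      obtain ⟨n, hn⟩ := ih
      obtain ⟨m, hm, hm2⟩ := frequently_atTop.1 hr n
      refine ⟨m + 1, ?_⟩
      have h1 : ∏ i ∈ Finset.range n, r i ≤ ∏ i ∈ Finset.range m, r i :=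
        Finset.prod_le_prod_of_subset_of_one_le' (Finset.range_mono hm) fun i _ _ => hpos i
      have h2 : 1 ≤ ∏ i ∈ Finset.range m, r i := Finset.one_le_prod' fun i _ => hpos i
      rw [Finset.prod_range_succ]
      nlinarith
  refine ⟨fun p => ?_⟩
  have hle : ∀ K : ℕ, minimalMeasure μ τ {p} ≤ (K : ℝ≥0∞)⁻¹ := by
    intro K
    obtain ⟨n, hn⟩ := hgrow K
    refine (GradedMultigraph.measure_singleton_le_prod_cot hm.agrees p n).trans ?_
    have e1 : ∏ i ∈ Finset.range n, (minimalGraph μ τ).cot (p.1 i) =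
        ((∏ i ∈ Finset.range n, r i : ℕ) : ℝ≥0∞)⁻¹ := by
      simp only [adic_cot h]
      rw [Nat.cast_prod, ENNReal.prod_inv_distrib]
      intro i _ j _ _
      exact Or.inr (ENNReal.natCast_ne_top _)
    rw [e1]
    exact ENNReal.inv_le_inv.2 (Nat.cast_le.2 hn)
  exact le_antisymm (ge_of_tendsto' ENNReal.tendsto_inv_nat_nhds_zero hle) zero_le

end

end DecFiltration

/-! ### Bernoulli filtrations -/

/-- The fibres of `f` and `g` over each value have equal cardinalities; bijections between fibres
are glued. -/
lemma exists_equiv_of_map_eq {α β γ : Type*} {s : Finset α} {t : Finset β} (hs : ∀ a, a ∈ s)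
    (ht : ∀ b, b ∈ t) {f : α → γ} {g : β → γ} (h : s.val.map f = t.val.map g) :
    ∃ φ : α ≃ β, ∀ a, g (φ a) = f a := by
  classical
  have hα : Fintype α := ⟨s, hs⟩
  have hβ : Fintype β := ⟨t, ht⟩
  have hcard : ∀ c, Nonempty ({a // f a = c} ≃ {b // g b = c}) := by
    intro c
    rw [← Fintype.card_eq, Fintype.card_of_subtype (s.filter fun a => f a = c) (by simp [hs]),
      Fintype.card_of_subtype (t.filter fun b => g b = c) (by simp [ht])]
    have := congrArg (Multiset.count c) h
    rw [Multiset.count_map, Multiset.count_map] at this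
    simp only [eq_comm (a := c)] at this
    exact this
  let ψ := fun c => Classical.choice (hcard c)
  refine ⟨(Equiv.sigmaFiberEquiv f).symm.trans
    ((Equiv.sigmaCongrRight ψ).trans (Equiv.sigmaFiberEquiv g)), fun a => ?_⟩
  exact (ψ (f a) ⟨a, rfl⟩).2

section

variable {X : Type*} [mX : MeasurableSpace X] {μ : Measure X} {τ : DecFiltration X}
  {η : ℕ → X → ℝ}

lemma indep_tail (hη : ∀ k, Measurable (η k)) (hi : iIndepFun η μ) {n : ℕ} {A : Set X}
    (hA : MeasurableSet[⨆ (k : ℕ) (_ : n + 1 ≤ k), MeasurableSpace.comap (η k) inferInstance] A)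
    {C : Set ℝ} (hC : MeasurableSet C) : μ (A ∩ η n ⁻¹' C) = μ (η n ⁻¹' C) * μ A := by
  have h := indep_iSup_of_disjoint (fun k => (hη k).comap_le) hi (S := {n}) (T := Set.Ici (n + 1))
    (by simp)
  have h2 := (Indep_iff _ _ μ).1 h (η n ⁻¹' C) A
    ((le_iSup₂ (f := fun (i : ℕ) (_ : i ∈ ({n} : Set ℕ)) => MeasurableSpace.comap (η i) inferInstance)
      n rfl) _ ⟨C, hC, rfl⟩) hA
  rw [Set.inter_comm, h2]

/-- The set `s` agrees with a set `t n` of each tail only mod 0. The upper limit of the `t n` lies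
in the tail σ-algebra itself, so Kolmogorov's zero-one law applies to it. -/
lemma isErgodicFilt_of_isBernoulliFilt [IsProbabilityMeasure μ] (h : IsBernoulliFilt μ τ) : IsErgodicFilt μ τ := by
  obtain ⟨η, hη, hi, hc⟩ := h
  intro s hs
  choose t ht hst using fun n => (hc n).2 s (hs n)
  have hts : ∀ᵐ x ∂μ, ∀ n, x ∈ t n ↔ x ∈ s := ae_all_iff.2 fun n => (hst n).mem_iff
  have hanti : Antitone fun n : ℕ =>
      (⨆ (k : ℕ) (_ : n ≤ k), MeasurableSpace.comap (η k) inferInstance : MeasurableSpace X) :=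
    fun m n hmn => iSup₂_le fun k hk =>
      le_iSup₂ (f := fun (k : ℕ) (_ : m ≤ k) => MeasurableSpace.comap (η k) inferInstance) k
        (hmn.trans hk)
  have hL : MeasurableSet[limsup (fun k => MeasurableSpace.comap (η k) inferInstance) atTop]
      {x | ∃ᶠ n in atTop, x ∈ t n} := by
    rw [limsup_eq_iInf_iSup_of_nat, MeasurableSpace.measurableSet_iInf]
    intro m
    have e1 : {x | ∃ᶠ n in atTop, x ∈ t n} = ⋂ k : ℕ, ⋃ n : ℕ, t (max m k + n) := by
      ext x
      simp only [Set.mem_ofPred_eq, frequently_atTop, Set.mem_iInter, Set.mem_iUnion]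
      refine ⟨fun h k => ?_, fun h k => ?_⟩
      · obtain ⟨n, hn, hx⟩ := h (max m k)
        exact ⟨n - max m k, by rwa [Nat.add_sub_cancel' hn]⟩
      · obtain ⟨n, hx⟩ := h k
        exact ⟨_, by omega, hx⟩
    rw [e1]
    exact MeasurableSet.iInter fun k => MeasurableSet.iUnion fun n =>
      hanti (by omega : m ≤ max m k + n) _ (ht (max m k + n))
  have hLs : {x | ∃ᶠ n in atTop, x ∈ t n} =ᵐ[μ] s := by
    filter_upwards [hts] with x hx
    refine propext ?_
    change (∃ᶠ n in atTop, x ∈ t n) ↔ x ∈ s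
    simp [hx]
  rcases measure_zero_or_one_of_measurableSet_limsup_atTop (fun k => (hη k).comap_le) hi hL with h | h
  · left; rw [← measure_congr hLs, h]
  · right
    rw [measure_congr hLs] at h
    rw [prob_compl_eq_zero_iff₀ (MeasurableSet.nullMeasurableSet (τ.alg_le 0 _ (hs 0)))]
    exact h

end

section

variable {X : Type*} [mX : MeasurableSpace X] [StandardBorelSpace X]
  {μ : Measure X} [IsProbabilityMeasure μ] {τ : DecFiltration X} {η : ℕ → X → ℝ}

/-- By independence, `η n` has its own distribution as conditional distribution on almost every
element of level `n + 1`. Such an element has finitely many atoms, so the distribution has finite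
support. -/
lemma bernoulli_atoms (hτ : IsLocallyFiniteFilt μ τ) (hη : ∀ k, Measurable (η k))
    (hi : iIndepFun η μ)
    (hc : ∀ n, CarriesMod0 μ id (τ.alg n)
      (⨆ (k : ℕ) (_ : n ≤ k), MeasurableSpace.comap (η k) inferInstance)) (n : ℕ) :
    {c : ℝ | μ (η n ⁻¹' {c}) ≠ 0}.Finite ∧ ∀ᵐ x ∂μ, μ (η n ⁻¹' {η n x}) ≠ 0 := by
  have hlaw : ∀ q : ℚ, ∀ᵐ x ∂μ, τ.cond μ (n + 1) x (η n ⁻¹' Set.Iic (q : ℝ)) =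
      μ (η n ⁻¹' Set.Iic (q : ℝ)) := by
    intro q
    have := DecFiltration.ae_cond_eq_of_forall (τ := τ) (n := n + 1) (C := Set.univ)
      (c := μ (η n ⁻¹' Set.Iic (q : ℝ)))
      (hη n measurableSet_Iic).nullMeasurableSet MeasurableSet.univ (fun A hA => by
        obtain ⟨B, hB, hAB⟩ := hA
        obtain ⟨D, hD, hDB⟩ := (hc (n + 1)).2 B hB
        have hAD : A =ᵐ[μ] D := hAB.trans hDB.symm
        rw [measure_congr (hAD.inter (EventuallyEq.refl _ (η n ⁻¹' Set.Iic (q : ℝ)))), Set.inter_univ,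
          measure_congr hAD]
        exact indep_tail hη hi hD measurableSet_Iic)
    simpa using this
  have hmap : ∀ᵐ x ∂μ, (τ.cond μ (n + 1) x).map (η n) = μ.map (η n) := by
    filter_upwards [ae_all_iff.2 hlaw] with x hx
    have := Measure.isProbabilityMeasure_map (μ := τ.cond μ (n + 1) x) (hη n).aemeasurable
    have := Measure.isProbabilityMeasure_map (μ := μ) (hη n).aemeasurable
    refine ext_of_generate_finite _ (BorelSpace.measurable_eq.trans Real.borel_eq_generateFrom_Iic_rat)
      Real.isPiSystem_Iic_rat ?_ (by simp)
    intro s hs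
    obtain ⟨q, hq⟩ := Set.mem_iUnion.1 hs
    rw [Set.mem_singleton_iff.1 hq, Measure.map_apply (hη n) measurableSet_Iic,
      Measure.map_apply (hη n) measurableSet_Iic, hx]
  obtain ⟨x, hx, hfin, h0⟩ := (hmap.and (hτ (n + 1)).1).exists
  have hF : (η n '' atomSet (τ.cond μ (n + 1) x)).Finite := hfin.image _
  have hnull : μ (η n ⁻¹' (η n '' atomSet (τ.cond μ (n + 1) x))ᶜ) = 0 := by
    rw [← Measure.map_apply (hη n) hF.measurableSet.compl, ← hx,
      Measure.map_apply (hη n) hF.measurableSet.compl]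
    refine measure_mono_null (fun y hy hy' => hy ⟨y, hy', rfl⟩) h0
  refine ⟨hF.subset fun c hc' => ?_, ?_⟩
  · by_contra hcn
    refine hc' (measure_mono_null (fun y hy => ?_) hnull)
    have hy : η n y = c := hy
    change ¬ _
    rwa [hy]
  · have h1 : ∀ᵐ y ∂μ, η n y ∈ η n '' atomSet (τ.cond μ (n + 1) x) := by
      filter_upwards [show ∀ᵐ y ∂μ, ¬ (y ∈ η n ⁻¹' (η n '' atomSet (τ.cond μ (n + 1) x))ᶜ) from
        measure_eq_zero_iff_ae_notMem.1 hnull] with y hy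
      by_contra hc; exact hy hc
    have h2 : ∀ᵐ y ∂μ, ∀ c ∈ η n '' atomSet (τ.cond μ (n + 1) x), μ (η n ⁻¹' {c}) = 0 → η n y ≠ c := by
      refine (ae_ball_iff hF.countable).2 fun c _ => ?_
      by_cases hc0 : μ (η n ⁻¹' {c}) = 0
      · filter_upwards [measure_eq_zero_iff_ae_notMem.1 hc0] with y hy _ using hy
      · exact ae_of_all _ fun y hy => absurd hy hc0
    filter_upwards [h1, h2] with y h1 h2 h3
    exact h2 _ h1 h3 rfl

/-- The multigraph of a sequence of independent discrete random variables. -/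
def bernoulliGraph (μ : Measure X) (η : ℕ → X → ℝ) : GradedMultigraph where
  V _ := Unit
  E n := {c : ℝ // μ (η n ⁻¹' {c}) ≠ 0}
  src _ := ()
  tgt _ := ()
  cot {n} c := μ (η n ⁻¹' {c.1})

/-- The values of the variables serve as edges: `law` is independence of `η n` from the later
variables, and `gen` holds because level `n` is generated by `η n` and level `n + 1`. -/
lemma exists_bernoulli_edge (hτ : IsLocallyFiniteFilt μ τ) (hη : ∀ k, Measurable (η k))
    (hi : iIndepFun η μ)
    (hc : ∀ n, CarriesMod0 μ id (τ.alg n)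
      (⨆ (k : ℕ) (_ : n ≤ k), MeasurableSpace.comap (η k) inferInstance)) :
    ∃ e : (n : ℕ) → X → (bernoulliGraph μ η).E n,
      (∀ n, ∀ᵐ x ∂μ, (e n x).1 = η n x) ∧
      ∀ N, IsCoding μ τ (bernoulliGraph μ η) N (fun _ _ => ()) e := by
  classical
  have hpos := fun n => (bernoulli_atoms hτ hη hi hc n).2
  choose x₀ hx₀ using fun n => (hpos n).exists
  -- Values of probability zero are not edges; the points with such values form a null set and
  -- receive a default edge.
  let e : (n : ℕ) → X → (bernoulliGraph μ η).E n := fun n x =>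
    if hx : μ (η n ⁻¹' {η n x}) ≠ 0 then ⟨η n x, hx⟩ else ⟨η n (x₀ n), hx₀ n⟩
  have he : ∀ n, ∀ᵐ x ∂μ, (e n x).1 = η n x := by
    intro n
    filter_upwards [hpos n] with x hx
    have : e n x = ⟨η n x, hx⟩ := dif_pos hx
    rw [this]
  have hpre : ∀ n (a : (bernoulliGraph μ η).E n), e n ⁻¹' {a} =ᵐ[μ] η n ⁻¹' {a.1} := by
    intro n a
    filter_upwards [he n] with x hx
    refine propext ?_
    change e n x = a ↔ η n x = a.1
    rw [← hx]
    exact Subtype.ext_iff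
  have hm : ∀ n A, MeasurableSet[τ.algMod μ n] A ↔ ∃ B,
      MeasurableSet[⨆ (k : ℕ) (_ : n ≤ k), MeasurableSpace.comap (η k) inferInstance] B ∧
      A =ᵐ[μ] B := by
    intro n A
    constructor
    · rintro ⟨B, hB, hAB⟩
      obtain ⟨D, hD, hDB⟩ := (hc n).2 B hB
      exact ⟨D, hD, hAB.trans hDB.symm⟩
    · rintro ⟨B, hB, hAB⟩
      obtain ⟨D, hD, hDB⟩ := (hc n).1 B hB
      exact ⟨D, hD, hAB.trans hDB⟩
  refine ⟨e, he, fun N => ⟨fun n _ a => ?_, fun n _ a => ?_, fun n _ => ae_of_all _ fun _ => rfl,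
    fun n _ => ae_of_all _ fun _ => rfl, fun n _ a A hA => ?_, fun n _ a A hA => ?_⟩⟩
  · exact MeasurableSet.const _
  · refine (hm n _).2 ⟨_, ?_, hpre n a⟩
    exact (le_iSup₂ (f := fun (k : ℕ) (_ : n ≤ k) => MeasurableSpace.comap (η k) inferInstance)
      n le_rfl) _ ⟨{a.1}, measurableSet_singleton _, rfl⟩
  · obtain ⟨B, hB, hAB⟩ := (hm (n + 1) A).1 hA
    have e1 : μ (A ∩ e n ⁻¹' {a}) = μ (B ∩ η n ⁻¹' {a.1}) := measure_congr (hAB.inter (hpre n a))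
    have e2 : ∀ b : (bernoulliGraph μ η).V (n + 1),
        A ∩ (fun _ : X => (() : (bernoulliGraph μ η).V (n + 1))) ⁻¹' {b} = A := fun b =>
      Set.inter_eq_left.2 fun x _ => rfl
    have e3 : μ (A ∩ e n ⁻¹' {a}) = (bernoulliGraph μ η).cot a * μ A := by
      rw [e1, measure_congr hAB]
      exact indep_tail hη hi hB (measurableSet_singleton _)
    exact e3.trans (congrArg (fun S => (bernoulliGraph μ η).cot a * μ S) (e2 _).symm)
  · obtain ⟨B, hB, hAB⟩ := (hm n A).1 hA
    rw [iSup_tail_succ] at hB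
    obtain ⟨D, hD, hBD⟩ := exists_trace_of_sup (D := η n ⁻¹' {a.1})
      (fun s hs => comap_fibre (η n) a.1 hs) hB
    refine ⟨D, (hm (n + 1) D).2 ⟨D, hD, EventuallyEq.rfl⟩, ?_⟩
    refine (hAB.inter (hpre n a)).trans ?_
    rw [hBD]
    exact (EventuallyEq.refl _ D).inter (hpre n a).symm

lemma isFinitePos_bernoulliGraph (hτ : IsLocallyFiniteFilt μ τ) (hη : ∀ k, Measurable (η k))
    (hi : iIndepFun η μ)
    (hc : ∀ n, CarriesMod0 μ id (τ.alg n)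
      (⨆ (k : ℕ) (_ : n ≤ k), MeasurableSpace.comap (η k) inferInstance)) :
    (bernoulliGraph μ η).IsFinitePos where
  finite_E n := (bernoulli_atoms hτ hη hi hc n).1.to_subtype
  cot_ne _ a := a.2

lemma bernoulli_typ (hτ : IsLocallyFiniteFilt μ τ) (h : IsBernoulliFilt μ τ) (n : ℕ) :
    ∃ t, ∀ᵐ x ∂μ, τ.typ μ n x = t := by
  obtain ⟨η, hη, hi, hc⟩ := h
  obtain ⟨e, he, hcod⟩ := exists_bernoulli_edge hτ hη hi hc
  exact ⟨_, (hcod n).ae_typ_eq (isFinitePos_bernoulliGraph hτ hη hi hc) le_rfl⟩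

lemma bernoulli_subsingleton (hτ : IsLocallyFiniteFilt μ τ) (h : IsBernoulliFilt μ τ) (n : ℕ) :
    Subsingleton ((minimalGraph μ τ).V n) := by
  obtain ⟨t, ht⟩ := bernoulli_typ hτ h n
  exact DecFiltration.subsingleton_minimalGraph_V ht

end

namespace GradedMultigraph

/-- Multigraphs with one vertex at every level and the same trees of paths are isomorphic. -/
lemma nonempty_iso_of_subsingleton {Γ Δ : GradedMultigraph} (hV : ∀ n, Subsingleton (Γ.V n))
    (hW : ∀ n, Subsingleton (Δ.V n)) (v : ∀ n, Γ.V n) (w : ∀ n, Δ.V n)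
    (hE : ∀ n, Finite (Γ.E n)) (hF : ∀ n, Finite (Δ.E n))
    (h : ∀ n, Γ.pathTree n (v n) = Δ.pathTree n (w n)) : Nonempty (Iso Γ Δ) := by
  have key : ∀ n, ∃ φ : Γ.E n ≃ Δ.E n, ∀ a, Δ.cot (φ a) = Γ.cot a := by
    intro n
    have h1 : {e : Γ.E n | Γ.tgt e = v (n + 1)}.Finite := Set.toFinite _
    have h2 : {e : Δ.E n | Δ.tgt e = w (n + 1)}.Finite := Set.toFinite _
    have h3 : (h1.toFinset.val.map (fun e => (Γ.cot e, Γ.pathTree n (Γ.src e))) :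
        Multiset (ℝ≥0∞ × MTree n)) =
        h2.toFinset.val.map (fun e => (Δ.cot e, Δ.pathTree n (Δ.src e))) :=
      (dif_pos h1).symm.trans ((h (n + 1)).trans (dif_pos h2))
    obtain ⟨φ, hφ⟩ := exists_equiv_of_map_eq
      (fun a => h1.mem_toFinset.2 (Subsingleton.elim _ _))
      (fun a => h2.mem_toFinset.2 (Subsingleton.elim _ _)) h3
    exact ⟨φ, fun a => (Prod.mk.inj (hφ a)).1⟩
  choose φ hφ using key
  exact ⟨{ onV := fun n => ⟨fun _ => w n, fun _ => v n, fun _ => Subsingleton.elim _ _,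
            fun _ => Subsingleton.elim _ _⟩
           onE := φ
           src_comm := fun _ _ => Subsingleton.elim _ _
           tgt_comm := fun _ _ => Subsingleton.elim _ _
           cot_comm := hφ }⟩

end GradedMultigraph

section

variable {X : Type*} [mX : MeasurableSpace X] [StandardBorelSpace X]
  {μ : Measure X} [IsProbabilityMeasure μ] {τ : DecFiltration X}

/-- The graph of the variables and the minimal graph have the same trees, both being the type of
a.e. point, hence are isomorphic. This turns the variables into a coding by the minimal graph whose
path determines every `η k`; so the path map generates the filtration, which an arbitrary coding
need not do. -/
lemma bernoulli_filtIso (hτ : IsLocallyFiniteFilt μ τ) (h : IsBernoulliFilt μ τ) :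
    FiltIso μ τ (minimalMeasure μ τ) (minimalModel μ τ) := by
  have hsub := bernoulli_subsingleton hτ h
  obtain ⟨η, hη, hi, hc⟩ := h
  obtain ⟨e, he, hcod⟩ := exists_bernoulli_edge hτ hη hi hc
  have hfp := isFinitePos_bernoulliGraph hτ hη hi hc
  let w : ∀ n, (minimalGraph μ τ).V n := fun n =>
    Classical.choice (DecFiltration.nonempty_minimalGraph_V hτ n)
  have htree : ∀ n, (bernoulliGraph μ η).pathTree n () = (minimalGraph μ τ).pathTree n (w n) := by
    intro n
    obtain ⟨x, h1, h2⟩ := (((hcod n).ae_typ_eq hfp le_rfl).and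
      (DecFiltration.ae_minVertex hτ n)).exists
    rw [DecFiltration.pathTree_minimalGraph hτ, ← h1, ← h2,
      Subsingleton.elim (DecFiltration.minVertex hτ n x) (w n)]
  obtain ⟨φ⟩ := GradedMultigraph.nonempty_iso_of_subsingleton
    (Γ := bernoulliGraph μ η) (Δ := minimalGraph μ τ)
    (fun _ => inferInstanceAs (Subsingleton Unit)) hsub (fun _ => ()) w hfp.finite_E
    (DecFiltration.finite_minimalGraph_E hτ) htree
  have hcod' := fun N => (hcod N).comp_graphIso φ
  obtain ⟨Φ, hΦ, hΦe⟩ := IsCoding.exists_path (DecFiltration.countable_minimalGraph_E hτ) hcod'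
  have hmin := DecFiltration.minimalMeasure_unique hτ (DecFiltration.isMinimalMeasure_map hcod'
    (fun n => by
      filter_upwards [DecFiltration.ae_minVertex hτ n] with x hx
      rw [← hx, Subsingleton.elim (DecFiltration.minVertex hτ n x)]) hΦ hΦe)
  have hcar : ∀ n, CarriesMod0 μ Φ (τ.alg n) ((minimalModel μ τ).alg n) := by
    intro n
    refine carriesMod0_iff.2 ⟨fun s hs => IsCoding.measurableSet_preimage_tail
      (DecFiltration.countable_minimalGraph_E hτ) hcod' hΦe hs, ?_⟩
    rintro t ⟨t', ht', htt⟩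
    obtain ⟨A, hA, hAt⟩ := (hc n).2 t' ht'
    have key : (⨆ (k : ℕ) (_ : n ≤ k), MeasurableSpace.comap (η k) inferInstance) ≤
        eventuallyMeasurableSpace (MeasurableSpace.comap Φ ((minimalModel μ τ).alg n)) (ae μ) := by
      refine iSup₂_le fun k hk => ?_
      rintro _ ⟨C, hC, rfl⟩
      refine ⟨Φ ⁻¹' {p | ((φ.onE k).symm (p.1 k)).1 ∈ C}, ⟨_, ?_, rfl⟩, ?_⟩
      · exact GradedMultigraph.measurableSet_edge hk {a | ((φ.onE k).symm a).1 ∈ C}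
      · filter_upwards [hΦe, he k] with x h1 h2
        refine propext ?_
        change η k x ∈ C ↔ ((φ.onE k).symm ((Φ x).1 k)).1 ∈ C
        rw [h1, Equiv.symm_apply_apply, h2]
    obtain ⟨_, ⟨s, hs, rfl⟩, hsA⟩ := key A hA
    exact ⟨s, hs, hsA.symm.trans (hAt.trans htt.symm)⟩
  have := DecFiltration.standardBorelSpace_minPath hτ
  have := (DecFiltration.isMinimalMeasure_minimalMeasure hτ).prob
  obtain ⟨f, g, hfg, hiso⟩ := exists_iso_of_map_eq (a := τ.alg) (b := (minimalModel μ τ).alg)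
    (c := (minimalModel μ τ).alg) (ν := minimalMeasure μ τ) hΦ measurable_id
    (by rw [hmin, Measure.map_id])
    (fun t ht => (hcar 0).2 t (by rw [τ.alg_zero]; exact ht))
    (fun t ht => ⟨t, ht, EventuallyEq.rfl⟩)
  exact ⟨f, g, hfg, fun n => hiso n (hcar n)
    ⟨fun s hs => ⟨s, hs, EventuallyEq.rfl⟩, fun s hs => ⟨s, hs, EventuallyEq.rfl⟩⟩⟩

/-- The Bernoulli filtration `β` inherits continuity and local finiteness from `τ`, so both have the
same minimal model. Single vertices and, by ergodicity of `β`, continuity of the path measure are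
transferred back. -/
lemma finIso_bernoulli {Y : Type*} [mY : MeasurableSpace Y] [StandardBorelSpace Y]
    {μ' : Measure Y} [IsProbabilityMeasure μ'] {β : DecFiltration Y} [NullSingletonClass μ]
    (hτ : IsLocallyFiniteFilt μ τ) (hβ : IsBernoulliFilt μ' β) (h : FinIso μ τ μ' β) :
    IsBernoulliFilt (minimalMeasure μ τ) (minimalModel μ τ) ∧
      NullSingletonClass (minimalMeasure μ τ) := by
  have hY : NullSingletonClass μ' := by
    obtain ⟨f, g, hfg, -⟩ := h 0
    exact hfg.nullSingleton
  have hβl : IsLocallyFiniteFilt μ' β := by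
    refine IsCoding.isLocallyFiniteFilt (DecFiltration.isFinitePos_minimalGraph hτ) fun N => ?_
    obtain ⟨f, g, hfg, hc⟩ := h N
    exact ⟨_, _, (DecFiltration.isCoding_minimalGraph hτ N).comp_iso hfg.symm
      fun n hn => hfg.carries_symm (hc n hn)⟩
  have htyp := DecFiltration.FinIso.measure_typ_eq hβl h
  obtain ⟨φ, hφ⟩ := (DecFiltration.finIso_iff_sameMinimalModel hτ hβl).1 h
  have hν := DecFiltration.nullSingleton_minimalMeasure_of_ergodic hβl
    (isErgodicFilt_of_isBernoulliFilt hβ)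
  refine ⟨DecFiltration.isBernoulliFilt_minimalModel hτ fun n =>
    have := bernoulli_subsingleton hβl hβ n
    (φ.onV n).subsingleton, ⟨fun p => ?_⟩⟩
  have := DecFiltration.standardBorelSpace_minPath hβl
  have h0 : minimalMeasure μ' β {φ.onPath p} = 0 := measure_singleton _
  rw [← hφ, Measure.map_apply (φ.measurable_onPath (DecFiltration.countable_minimalGraph_E hβl))
    (measurableSet_singleton _)] at h0
  exact measure_mono_null (by rintro q hq; rw [Set.mem_singleton_iff.1 hq]; rfl) h0

end

/-! ### An ergodic filtration that is not isomorphic to its minimal model -/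

namespace SkewShift

/-- The probabilities of the letters. -/
noncomputable def prob : Fin 3 → ℝ≥0∞ := ![2⁻¹, 6⁻¹, 3⁻¹]

/-- The cocycle, a function of a letter. -/
def cocycle : Fin 3 → Bool := ![false, true, true]

lemma toReal_prob : (fun j => (prob j).toReal) = ![2⁻¹, 6⁻¹, 3⁻¹] := by
  ext j; fin_cases j <;> simp [prob]

lemma prob_ne_top (j : Fin 3) : prob j ≠ ⊤ := by fin_cases j <;> simp [prob]

lemma prob_ne_zero (j : Fin 3) : prob j ≠ 0 := by fin_cases j <;> simp [prob]

/-- Distinct probabilities make the edges recognizable by their weights. -/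
lemma prob_injective : Function.Injective prob := by
  intro i j h
  have h1 : (fun j => (prob j).toReal) i = (fun j => (prob j).toReal) j := by simp only [h]
  rw [toReal_prob] at h1
  fin_cases i <;> fin_cases j <;> first | rfl | (norm_num at h1)

/-- The two letters that flip the Boolean coordinate have total probability one half, so a single
letter makes this coordinate uniform. -/
lemma prob_one_add_prob_two : prob 1 + prob 2 = 2⁻¹ := by
  rw [← ENNReal.toReal_eq_toReal_iff' (by simp [prob_ne_top]) (by simp),
    ENNReal.toReal_add (prob_ne_top _) (prob_ne_top _)]
  simp [prob]
  norm_num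

lemma prob_zero : prob 0 = 2⁻¹ := rfl

lemma sum_prob : ∑ j, prob j = 1 := by
  rw [Fin.sum_univ_three, add_assoc, prob_one_add_prob_two, prob_zero, ENNReal.inv_two_add_inv_two]

lemma prob_le (j : Fin 3) : prob j ≤ 2⁻¹ := by
  fin_cases j
  · exact le_rfl
  · exact ENNReal.inv_le_inv.2 (by norm_num)
  · exact ENNReal.inv_le_inv.2 (by norm_num)

/-- The distribution of a letter. -/
noncomputable def letter : Measure (Fin 3) := ∑ j, prob j • Measure.dirac j

lemma letter_singleton (j : Fin 3) : letter {j} = prob j := by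
  simp [letter, Measure.finsetSum_apply, Set.indicator_apply]

instance : IsProbabilityMeasure letter := ⟨by
  simp [letter, Measure.finsetSum_apply, sum_prob]⟩

/-- The distribution of a sequence of independent letters. -/
noncomputable def seqLaw : Measure (ℕ → Fin 3) := Measure.infinitePi fun _ => letter

instance : IsProbabilityMeasure seqLaw := by unfold seqLaw; infer_instance

/-- The shift. -/
def shift (ω : ℕ → Fin 3) : ℕ → Fin 3 := fun n => ω (n + 1)

lemma measurable_shift : Measurable shift := measurable_pi_lambda _ fun n => measurable_pi_apply (n + 1)

lemma seqLaw_inter_shift (j : Fin 3) {B : Set (ℕ → Fin 3)} (hB : MeasurableSet B) :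
    seqLaw ({ω | ω 0 = j} ∩ shift ⁻¹' B) = prob j * seqLaw B := by
  have hm : MeasurableSet {ω : ℕ → Fin 3 | ω 0 = j} :=
    (measurable_pi_apply 0 : Measurable fun ω : ℕ → Fin 3 => ω 0) (measurableSet_singleton j)
  -- The law of the shifted sequence, conditioned on the first letter, is identified as the product
  -- measure by its values on cylinders.
  have key : (prob j)⁻¹ • (seqLaw.restrict {ω | ω 0 = j}).map shift = seqLaw := by
    refine Measure.eq_infinitePi _ fun s t ht => ?_
    have hpi : MeasurableSet (Set.pi s t) :=
      MeasurableSet.pi s.countable_toSet fun i _ => ht i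
    rw [Measure.smul_apply, Measure.map_apply measurable_shift hpi,
      Measure.restrict_apply (measurable_shift hpi)]
    set t' : ℕ → Set (Fin 3) := fun i => Nat.casesOn i {j} t
    have e1 : shift ⁻¹' (Set.pi s t) ∩ {ω | ω 0 = j} =
        Set.pi (insert 0 (s.map ⟨Nat.succ, Nat.succ_injective⟩) : Finset ℕ) t' := by
      ext ω
      simp [Set.mem_pi, shift, t', and_comm]
    have ht' : ∀ i ∈ (insert 0 (s.map ⟨Nat.succ, Nat.succ_injective⟩) : Finset ℕ),
        MeasurableSet (t' i) := fun i _ => MeasurableSet.of_discrete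
    rw [e1, seqLaw, Measure.infinitePi_pi _ ht', Finset.prod_insert (by simp), Finset.prod_map]
    change (prob j)⁻¹ * (letter {j} * ∏ i ∈ s, letter (t i)) = _
    rw [letter_singleton, ← mul_assoc, ENNReal.inv_mul_cancel (prob_ne_zero j) (prob_ne_top j), one_mul]
  have h1 := congrArg (fun m => m B) key
  simp only [Measure.smul_apply, Measure.map_apply measurable_shift hB,
    Measure.restrict_apply (measurable_shift hB), smul_eq_mul] at h1
  rw [← h1, ← mul_assoc, ENNReal.mul_inv_cancel (prob_ne_zero j) (prob_ne_top j), one_mul,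
    Set.inter_comm]

/-- The product of the uniform measure on two points and the law of the sequence. -/
noncomputable def law : Measure (Bool × (ℕ → Fin 3)) :=
  (2⁻¹ : ℝ≥0∞) • (seqLaw.map (Prod.mk false) + seqLaw.map (Prod.mk true))

lemma law_apply {A : Set (Bool × (ℕ → Fin 3))} (hA : MeasurableSet A) :
    law A = 2⁻¹ * (seqLaw {ω | (false, ω) ∈ A} + seqLaw {ω | (true, ω) ∈ A}) := by
  rw [law, Measure.smul_apply, Measure.add_apply, Measure.map_apply measurable_prodMk_left hA,
    Measure.map_apply measurable_prodMk_left hA]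
  rfl

instance : IsProbabilityMeasure law := ⟨by
  rw [law_apply MeasurableSet.univ]
  simp only [Set.mem_univ, Set.ofPred_true, measure_univ]
  rw [one_add_one_eq_two, ENNReal.inv_mul_cancel (by norm_num) (by norm_num)]⟩

/-- The skew shift. -/
def step (x : Bool × (ℕ → Fin 3)) : Bool × (ℕ → Fin 3) := (xor x.1 (cocycle (x.2 0)), shift x.2)

lemma measurable_step : Measurable step := by
  refine Measurable.prodMk ?_ (measurable_shift.comp measurable_snd)
  exact (measurable_from_prod_countable_left (f := fun z : Bool × Fin 3 => xor z.1 (cocycle z.2))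
    fun _ => measurable_of_countable _).comp
    (measurable_fst.prodMk ((measurable_pi_apply 0).comp measurable_snd))

lemma measurableSet_letter (n : ℕ) (j : Fin 3) :
    MeasurableSet {x : Bool × (ℕ → Fin 3) | x.2 n = j} :=
  ((measurable_pi_apply n).comp measurable_snd : Measurable fun x : Bool × (ℕ → Fin 3) => x.2 n)
    (measurableSet_singleton j)

/-- Given the first letter, the step is the shift combined with a fixed permutation of the two
Boolean values, which preserves the uniform measure. -/
lemma law_inter_step (j : Fin 3) {A : Set (Bool × (ℕ → Fin 3))} (hA : MeasurableSet A) :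
    law (step ⁻¹' A ∩ {x | x.2 0 = j}) = prob j * law A := by
  have hs : ∀ b : Bool, MeasurableSet {ω | (b, ω) ∈ A} := fun b => measurable_prodMk_left hA
  have key : ∀ b : Bool, seqLaw {ω | (b, ω) ∈ step ⁻¹' A ∩ {x | x.2 0 = j}} =
      prob j * seqLaw {ω | (xor b (cocycle j), ω) ∈ A} := by
    intro b
    rw [← seqLaw_inter_shift j (hs _)]
    congr 1
    ext ω
    simp only [Set.mem_inter_iff, Set.mem_preimage, Set.mem_ofPred_eq, step]
    constructor
    · rintro ⟨h1, h2⟩; rw [h2] at h1; exact ⟨h2, h1⟩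
    · rintro ⟨h1, h2⟩; rw [h1]; exact ⟨h2, rfl⟩
  rw [law_apply ((measurable_step hA).inter (measurableSet_letter 0 j)), law_apply hA, key, key]
  cases cocycle j
  · simp only [Bool.xor_false]; ring
  · simp only [Bool.xor_true, Bool.not_false, Bool.not_true]; ring

lemma measurePreserving_step : MeasurePreserving step law law := by
  refine ⟨measurable_step, Measure.ext fun A hA => ?_⟩
  rw [Measure.map_apply measurable_step hA]
  have : step ⁻¹' A = ⋃ j, step ⁻¹' A ∩ {x | x.2 0 = j} := by ext x; simp
  rw [this, measure_iUnion, tsum_fintype]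
  · simp only [law_inter_step _ hA]
    rw [← Finset.sum_mul, sum_prob, one_mul]
  · intro i j hij
    refine Set.disjoint_left.2 ?_
    rintro x ⟨_, hx⟩ ⟨_, hx'⟩
    exact hij (hx.symm.trans hx')
  · exact fun j => (measurable_step hA).inter (measurableSet_letter 0 j)

/-- The filtration of the preimages of the σ-algebra under the powers of the skew shift. -/
def filt : DecFiltration (Bool × (ℕ → Fin 3)) where
  alg n := MeasurableSpace.comap step^[n] inferInstance
  alg_zero := by simp [MeasurableSpace.comap_id]
  anti := antitone_nat_of_succ_le fun n => by
    rw [Function.iterate_succ', ← MeasurableSpace.comap_comp]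
    exact MeasurableSpace.comap_mono measurable_step.comap_le

/-- The multigraph with one vertex and three edges at every level. -/
noncomputable def graph : GradedMultigraph where
  V _ := Unit
  E _ := Fin 3
  src _ := ()
  tgt _ := ()
  cot j := prob j

lemma isFinitePos_graph : graph.IsFinitePos where
  finite_E _ := inferInstanceAs (Finite (Fin 3))
  cot_ne _ j := prob_ne_zero j

lemma iterate_step_snd (n : ℕ) (x : Bool × (ℕ → Fin 3)) : (step^[n] x).2 0 = x.2 n := by
  have : ∀ k, (step^[n] x).2 k = x.2 (n + k) := by
    induction n with
    | zero => intro k; rw [Nat.zero_add]; rfl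
    | succ n ih =>
      intro k
      rw [Function.iterate_succ_apply']
      exact (ih (k + 1)).trans (congrArg x.2 (by omega))
  exact this 0

/-- The inverse branches of the skew shift. -/
def branch (j : Fin 3) (x : Bool × (ℕ → Fin 3)) : Bool × (ℕ → Fin 3) :=
  (xor x.1 (cocycle j), fun n => Nat.casesOn n j x.2)

lemma measurable_branch (j : Fin 3) : Measurable (branch j) := by
  refine Measurable.prodMk ?_ (measurable_pi_lambda _ fun n => ?_)
  · exact (measurable_of_countable fun b : Bool => xor b (cocycle j)).comp measurable_fst
  · cases n with
    | zero => exact measurable_const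
    | succ n => exact (measurable_pi_apply n).comp measurable_snd

lemma branch_step (x : Bool × (ℕ → Fin 3)) : branch (x.2 0) (step x) = x := by
  refine Prod.ext ?_ (funext fun n => ?_)
  · simp [branch, step]
  · cases n <;> rfl

/-- The letters code the filtration although they do not determine the Boolean coordinate: an
inverse branch recovers the `n`-th iterate from the next one and the letter `x.2 n`. -/
lemma isCoding (N : ℕ) :
    IsCoding law filt graph N (fun _ _ => ()) (fun n x => x.2 n) := by
  have hmp : ∀ n, MeasurePreserving step^[n] law law := fun n => measurePreserving_step.iterate n
  have hpre : ∀ n (j : graph.E n), (fun x : Bool × (ℕ → Fin 3) => x.2 n) ⁻¹' {j} =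
      step^[n] ⁻¹' {x | x.2 0 = j} := by
    intro n j; ext x
    exact (by rw [← iterate_step_snd n x] : x.2 n = j ↔ (step^[n] x).2 0 = j)
  refine ⟨fun n _ a => MeasurableSet.const _, fun n _ a => filt.alg_le_algMod law n _ ?_,
    fun n _ => ae_of_all _ fun _ => rfl,
    fun n _ => ae_of_all _ fun _ => rfl, fun n _ a A hA => ?_, fun n _ a A hA => ?_⟩
  · exact ⟨_, measurableSet_letter 0 a, (hpre n a).symm⟩
  · obtain ⟨_, ⟨B, hB, rfl⟩, hAB⟩ := hA
    have e1 : law (A ∩ (fun x : Bool × (ℕ → Fin 3) => x.2 n) ⁻¹' {a}) = prob a * law B := by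
      rw [measure_congr (hAB.inter (EventuallyEq.refl _
        ((fun x : Bool × (ℕ → Fin 3) => x.2 n) ⁻¹' {a}))), hpre, Function.iterate_succ',
        Set.preimage_comp, ← Set.preimage_inter, (hmp n).measure_preimage
        ((measurable_step hB).inter (measurableSet_letter 0 a)).nullMeasurableSet, 
        show law (step ⁻¹' B ∩ {x | x.2 0 = a}) = _ from law_inter_step a hB]
    have e2 : ∀ b : graph.V (n + 1),
        A ∩ (fun _ => (() : graph.V (n + 1))) ⁻¹' {b} = A := fun b =>
      Set.inter_eq_left.2 fun x _ => rfl
    have e3 : law A = law B := by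
      rw [measure_congr hAB, (hmp (n + 1)).measure_preimage hB.nullMeasurableSet]
    rw [← e3] at e1
    exact e1.trans (congrArg (fun S => prob a * law S) (e2 _).symm)
  · obtain ⟨_, ⟨B, hB, rfl⟩, hAB⟩ := hA
    refine ⟨step^[n + 1] ⁻¹' (branch a ⁻¹' B), filt.alg_le_algMod law (n + 1) _
      ⟨_, measurable_branch a hB, rfl⟩, ?_⟩
    refine (hAB.inter (EventuallyEq.refl _
      ((fun x : Bool × (ℕ → Fin 3) => x.2 n) ⁻¹' {a}))).trans (EventuallyEq.of_eq ?_)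
    ext x
    refine and_congr_left fun hx => ?_
    have hx : x.2 n = a := hx
    change step^[n] x ∈ B ↔ branch a (step^[n + 1] x) ∈ B
    rw [Function.iterate_succ_apply', ← hx, ← iterate_step_snd n x, branch_step]

instance : NullSingletonClass law := by
  refine ⟨fun x => ?_⟩
  have hle : ∀ n : ℕ, law {x} ≤ (2⁻¹ : ℝ≥0∞) ^ n := by
    intro n
    have h := (isCoding n).law_cyl le_rfl (fun i => x.2 i) (fun _ => ()) (fun _ _ => rfl)
      (fun _ _ => rfl) (A := Set.univ) MeasurableSet.univ (fun _ => ae_of_all _ fun _ => rfl)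
    have h1 : law {x} ≤ law (Set.univ ∩ {y : Bool × (ℕ → Fin 3) | ∀ i < n, y.2 i = x.2 i}) :=
      measure_mono (by
        rintro y hy
        rw [Set.mem_singleton_iff.1 hy]
        exact ⟨trivial, fun _ _ => rfl⟩)
    refine h1.trans (h.le.trans ((mul_le_of_le_one_right' prob_le_one).trans ?_))
    have : ∏ i ∈ Finset.range n, graph.cot (n := i) (x.2 i) ≤ ∏ _i ∈ Finset.range n, (2⁻¹ : ℝ≥0∞) :=
      Finset.prod_le_prod' fun i _ => prob_le _
    simpa using this
  exact le_antisymm (ge_of_tendsto' (ENNReal.tendsto_pow_atTop_nhds_zero_of_lt_one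
    (by norm_num)) hle) zero_le

lemma isLocallyFiniteFilt : IsLocallyFiniteFilt law filt :=
  IsCoding.isLocallyFiniteFilt isFinitePos_graph fun N => ⟨_, _, isCoding N⟩

/-- The initial segment of length `k` of a sequence. -/
def segment (k : ℕ) (x : Bool × (ℕ → Fin 3)) : Bool × (Fin k → Fin 3) := (x.1, fun i => x.2 i)

lemma measurable_segment (k : ℕ) : Measurable (segment k) :=
  measurable_fst.prodMk (measurable_pi_lambda _ fun i =>
    (measurable_pi_apply (i : ℕ)).comp measurable_snd)

/-- The segment determines the Boolean coordinate after `k` steps. One more letter flips it with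
probability one half and so makes it uniform and independent of the segment; hence the exponent `k +
1`. -/
lemma law_segment_inter (k : ℕ) (b : Bool) (q : ℕ → Fin 3) {A : Set (Bool × (ℕ → Fin 3))}
    (hA : MeasurableSet A) :
    law ({x | x.1 = b ∧ ∀ i < k, x.2 i = q i} ∩ step^[k + 1] ⁻¹' A) =
      2⁻¹ * (∏ i ∈ Finset.range k, prob (q i)) * law A := by
  have hcyl : ∀ (k : ℕ) (b : Bool) (q : ℕ → Fin 3),
      MeasurableSet {x : Bool × (ℕ → Fin 3) | x.1 = b ∧ ∀ i < k, x.2 i = q i} := by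
    intro k b q
    have : {x : Bool × (ℕ → Fin 3) | x.1 = b ∧ ∀ i < k, x.2 i = q i} =
        segment k ⁻¹' {((b, fun i => q i) : Bool × (Fin k → Fin 3))} := by
      ext x
      simp [segment, funext_iff, Fin.forall_iff]
    rw [this]
    exact measurable_segment k (measurableSet_singleton _)
  induction k generalizing b q with
  | zero =>
    have hs : ∀ b : Bool, MeasurableSet {ω | (b, ω) ∈ A} := fun b => measurable_prodMk_left hA
    have hm : MeasurableSet ({x : Bool × (ℕ → Fin 3) | x.1 = b ∧ ∀ i < 0, x.2 i = q i} ∩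
        step^[0 + 1] ⁻¹' A) := (hcyl 0 b q).inter (measurable_step hA)
    have e1 : ∀ b' : Bool, {ω | (b', ω) ∈ {x : Bool × (ℕ → Fin 3) | x.1 = b ∧ ∀ i < 0, x.2 i = q i} ∩
        step^[0 + 1] ⁻¹' A} = if b' = b then
          ⋃ j, {ω | ω 0 = j} ∩ shift ⁻¹' {ω | (xor b (cocycle j), ω) ∈ A} else ∅ := by
      intro b'
      split_ifs with h
      · subst h; ext ω; simp [step]
      · ext ω; simp [h]
    have e2 : seqLaw (⋃ j, {ω | ω 0 = j} ∩ shift ⁻¹' {ω | (xor b (cocycle j), ω) ∈ A}) = law A := by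
      rw [measure_iUnion, tsum_fintype, Fin.sum_univ_three]
      · simp only [seqLaw_inter_shift _ (hs _)]
        rw [law_apply hA]
        have c0 : cocycle 0 = false := rfl
        have c1 : cocycle 1 = true := rfl
        have c2 : cocycle 2 = true := rfl
        rw [c0, c1, c2, add_assoc, ← add_mul, prob_one_add_prob_two, prob_zero, ← mul_add]
        cases b
        · rfl
        · simp only [Bool.xor_false, Bool.xor_true, Bool.not_true]
          rw [add_comm]
      · intro i j hij
        refine Set.disjoint_left.2 ?_
        rintro ω ⟨hx, _⟩ ⟨hx', _⟩
        exact hij (hx.symm.trans hx')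
      · exact fun j => ((measurable_pi_apply 0 : Measurable fun ω : ℕ → Fin 3 => ω 0)
          (measurableSet_singleton j)).inter (measurable_shift (hs _))
    rw [law_apply hm, e1, e1]
    cases b
    · rw [if_pos rfl, if_neg (by simp), e2, measure_empty, add_zero]; simp
    · rw [if_pos rfl, if_neg (by simp), e2, measure_empty, zero_add]; simp
  | succ k ih =>
    have e1 : {x : Bool × (ℕ → Fin 3) | x.1 = b ∧ ∀ i < k + 1, x.2 i = q i} ∩ step^[k + 1 + 1] ⁻¹' A =
        step ⁻¹' ({x | x.1 = xor b (cocycle (q 0)) ∧ ∀ i < k, x.2 i = q (i + 1)} ∩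
          step^[k + 1] ⁻¹' A) ∩ {x | x.2 0 = q 0} := by
      ext x
      simp only [Set.mem_inter_iff, Set.mem_preimage, Set.mem_ofPred_eq, Function.iterate_succ_apply]
      have h1 : (step x).1 = xor x.1 (cocycle (x.2 0)) := rfl
      have h2 : ∀ i, (step x).2 i = x.2 (i + 1) := fun _ => rfl
      constructor
      · rintro ⟨⟨hb, hq⟩, hxA⟩
        have h0 := hq 0 (Nat.succ_pos k)
        refine ⟨⟨⟨?_, fun i hi => hq (i + 1) (Nat.succ_lt_succ hi)⟩, hxA⟩, h0⟩
        rw [h1, hb, h0]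
      · rintro ⟨⟨⟨hb, hq⟩, hxA⟩, h0⟩
        refine ⟨⟨?_, fun i hi => ?_⟩, hxA⟩
        · rw [h1, h0] at hb
          exact Bool.xor_left_inj.1 hb
        · cases i with
          | zero => exact h0
          | succ i => exact hq i (Nat.lt_of_succ_lt_succ hi)
    rw [e1, law_inter_step _ ((hcyl _ _ _).inter ((measurable_step.iterate (k + 1)) hA)),
      ih, Finset.prod_range_succ']
    ring

lemma law_inter_of_tail {s : Set (Bool × (ℕ → Fin 3))} (hs : ∀ n, MeasurableSet[filt.alg n] s)
    (k : ℕ) (S : Set (Bool × (Fin k → Fin 3))) :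
    law (segment k ⁻¹' S ∩ s) = law (segment k ⁻¹' S) * law s := by
  have hmap : (law.restrict s).map (segment k) = law s • law.map (segment k) := by
    refine Measure.ext_of_singleton fun z => ?_
    have hz : MeasurableSet (segment k ⁻¹' {z}) := measurable_segment k (measurableSet_singleton z)
    rw [Measure.smul_apply, Measure.map_apply (measurable_segment k) (measurableSet_singleton z),
      Measure.map_apply (measurable_segment k) (measurableSet_singleton z),
      Measure.restrict_apply hz]
    have e1 : segment k ⁻¹' {z} = {x | x.1 = z.1 ∧ ∀ i < k, x.2 i =
        (fun i => if hi : i < k then z.2 ⟨i, hi⟩ else 0) i} := by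
      ext x
      obtain ⟨b, r⟩ := z
      simp only [segment, Set.mem_preimage, Set.mem_singleton_iff, Prod.mk.injEq, funext_iff,
        Fin.forall_iff, Set.mem_ofPred_eq]
      refine and_congr_right fun _ => forall_congr' fun i => forall_congr' fun hi => ?_
      rw [dif_pos hi]
    obtain ⟨A, hA, rfl⟩ := hs (k + 1)
    have h1 := law_segment_inter k z.1 (fun i => if hi : i < k then z.2 ⟨i, hi⟩ else 0)
      (A := Set.univ) MeasurableSet.univ
    rw [Set.preimage_univ, Set.inter_univ, measure_univ, mul_one] at h1
    rw [e1, law_segment_inter k _ _ hA, h1,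
      (measurePreserving_step.iterate (k + 1)).measure_preimage hA.nullMeasurableSet, smul_eq_mul,
      mul_comm]
  have h1 := congrArg (fun m => m S) hmap
  have hS : MeasurableSet S := S.to_countable.measurableSet
  simp only [Measure.smul_apply, Measure.map_apply (measurable_segment k) hS,
    Measure.restrict_apply (measurable_segment k hS), smul_eq_mul] at h1
  rw [h1, mul_comm]

/-- A tail set is independent of every initial segment, hence of the σ-algebra generated by all of
them. That σ-algebra contains every measurable set, so a tail set is independent of itself. -/
lemma isErgodicFilt : IsErgodicFilt law filt := by
  intro s hs
  have hms : MeasurableSet s := filt.alg_le 0 _ (hs 0)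
  have hle : (⨅ n, filt.alg n) ≤ (inferInstance : MeasurableSpace (Bool × (ℕ → Fin 3))) :=
    (iInf_le _ 0).trans (filt.alg_le 0)
  have hind : ∀ k, Indep (MeasurableSpace.comap (segment k) inferInstance) (⨅ n, filt.alg n) law := by
    intro k
    rw [Indep_iff]
    rintro _ t ⟨S, -, rfl⟩ ht
    exact law_inter_of_tail (MeasurableSpace.measurableSet_iInf.1 ht) k S
  have hmono : Monotone fun k => MeasurableSpace.comap (segment k) inferInstance := by
    intro k l hkl
    have : segment k = (fun z : Bool × (Fin l → Fin 3) => (z.1, fun i => z.2 (Fin.castLE hkl i))) ∘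
      segment l := rfl
    change MeasurableSpace.comap (segment k) inferInstance ≤ _
    rw [this, ← MeasurableSpace.comap_comp]
    exact MeasurableSpace.comap_mono (measurable_iff_comap_le.1 (measurable_of_countable _))
  have hsup := indep_iSup_of_directed_le hind (fun k => (measurable_segment k).comap_le) hle
    hmono.directed_le
  have htop : (⨅ n, filt.alg n) ≤ ⨆ k, MeasurableSpace.comap (segment k) inferInstance := by
    refine hle.trans (sup_le ?_ ?_)
    · have : (Prod.fst : Bool × (ℕ → Fin 3) → Bool) = Prod.fst ∘ segment 0 := rfl
      rw [this, ← MeasurableSpace.comap_comp]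
      exact (MeasurableSpace.comap_mono measurable_fst.comap_le).trans
        (le_iSup (fun k => MeasurableSpace.comap (segment k) inferInstance) 0)
    · rw [MeasurableSpace.pi, MeasurableSpace.comap_iSup]
      refine iSup_le fun n => ?_
      rw [MeasurableSpace.comap_comp]
      have : (fun ω : ℕ → Fin 3 => ω n) ∘ (Prod.snd : Bool × (ℕ → Fin 3) → _) =
        (fun z : Bool × (Fin (n + 1) → Fin 3) => z.2 (Fin.last n)) ∘ segment (n + 1) := rfl
      rw [this, ← MeasurableSpace.comap_comp]
      exact (MeasurableSpace.comap_mono (measurable_iff_comap_le.1 (measurable_of_countable _))).trans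
        (le_iSup (fun k => MeasurableSpace.comap (segment k) inferInstance) (n + 1))
  rcases measure_eq_zero_or_one_of_indep_self (indep_of_indep_of_le_left hsup htop)
    (MeasurableSpace.measurableSet_iInf.2 hs) with h | h
  · exact Or.inl h
  · exact Or.inr ((prob_compl_eq_zero_iff hms).2 h)

/-- The involution that exchanges the two points of the first factor. -/
def flip (x : Bool × (ℕ → Fin 3)) : Bool × (ℕ → Fin 3) := (!x.1, x.2)

lemma measurePreserving_flip : MeasurePreserving flip law law := by
  have hm : Measurable flip :=
    ((measurable_of_countable Bool.not).comp measurable_fst).prodMk measurable_snd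
  refine ⟨hm, Measure.ext fun A hA => ?_⟩
  rw [Measure.map_apply hm hA, law_apply (hm hA), law_apply hA, add_comm]
  rfl

/-- An isomorphism `f` would pull the edges of the model back to a coding of the skew shift, whose
weights are the probabilities of the letters. In the minimal graph an edge is determined by its
level and cotransition probability, so `f` takes the same value at `x` and `flip x` for a.e. `x`,
contrary to its invertibility mod 0. -/
lemma not_filtIso : ¬ FiltIso law filt (minimalMeasure law filt) (minimalModel law filt) := by
  rintro ⟨f, g, hf, hc⟩
  have hτ := isLocallyFiniteFilt
  have hsub : ∀ n, Subsingleton ((minimalGraph law filt).V n) := fun n =>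
    DecFiltration.subsingleton_minimalGraph_V
      ((isCoding n).ae_typ_eq isFinitePos_graph le_rfl)
  let w : ∀ n, (minimalGraph law filt).V n := fun n =>
    Classical.choice (DecFiltration.nonempty_minimalGraph_V hτ n)
  have htree : ∀ n, graph.pathTree n () = (minimalGraph law filt).pathTree n (w n) := by
    intro n
    obtain ⟨x, h1, h2⟩ := (((isCoding n).ae_typ_eq isFinitePos_graph le_rfl).and
      (DecFiltration.ae_minVertex hτ n)).exists
    rw [DecFiltration.pathTree_minimalGraph hτ, ← h1, ← h2,
      Subsingleton.elim (DecFiltration.minVertex hτ n x) (w n)]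
  obtain ⟨φ⟩ := GradedMultigraph.nonempty_iso_of_subsingleton
    (Γ := graph) (Δ := minimalGraph law filt)
    (fun _ => inferInstanceAs (Subsingleton Unit)) hsub (fun _ => ()) w isFinitePos_graph.finite_E
    (DecFiltration.finite_minimalGraph_E hτ) htree
  have hinj : ∀ n (a b : (minimalGraph law filt).E n),
      (minimalGraph law filt).cot a = (minimalGraph law filt).cot b → a = b := by
    intro n a b hab
    obtain ⟨i, rfl⟩ := (φ.onE n).surjective a
    obtain ⟨j, rfl⟩ := (φ.onE n).surjective b
    rw [φ.cot_comm, φ.cot_comm] at hab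
    exact congrArg _ (prob_injective hab)
  have hcot : ∀ᵐ x ∂law, ∀ n, (minimalGraph law filt).cot ((f x).1 n) = prob (x.2 n) := by
    refine ae_all_iff.2 fun n => ?_
    filter_upwards [((DecFiltration.isCoding_minimalModel hτ (n + 1)).comp_iso hf
      fun m _ => hc m).ae_weight_eq (DecFiltration.isFinitePos_minimalGraph hτ) (Nat.lt_succ_self n),
      (isCoding (n + 1)).ae_weight_eq isFinitePos_graph (Nat.lt_succ_self n)] with x h1 h2
    exact h1.symm.trans h2
  obtain ⟨x, h1, h2, h3, h4⟩ := (hcot.and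
    ((measurePreserving_flip.quasiMeasurePreserving.ae hcot).and (hf.left_inv.and
      (measurePreserving_flip.quasiMeasurePreserving.ae hf.left_inv)))).exists
  have h5 : f (flip x) = f x := Subtype.ext (funext fun n => hinj n _ _ ((h2 n).trans (h1 n).symm))
  rw [h5, h3] at h4
  have h6 := congrArg Prod.fst h4
  simp [flip] at h6

end SkewShift

theorem proposition4 :
    -- the minimal model is well defined
    (∀ (X : Type*) [MeasurableSpace X] [StandardBorelSpace X] (μ : Measure X)
        [IsProbabilityMeasure μ] [NullSingletonClass μ] (τ : DecFiltration X), IsLocallyFiniteFilt μ τ →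
      (minimalGraph μ τ).IsEquipped ∧ (minimalGraph μ τ).IsMinimal ∧
      (∀ n (v : (minimalGraph μ τ).V n), (minimalGraph μ τ).pathTree n v = v.1) ∧
      IsMinimalMeasure μ τ (minimalMeasure μ τ) ∧
      (∀ ν, IsMinimalMeasure μ τ ν → ν = minimalMeasure μ τ)) ∧
    -- 1) finite isomorphism with the minimal model
    (∀ (X : Type*) [MeasurableSpace X] [StandardBorelSpace X] (μ : Measure X)
        [IsProbabilityMeasure μ] [NullSingletonClass μ] (τ : DecFiltration X), IsLocallyFiniteFilt μ τ →
      (FinIso μ τ (minimalMeasure μ τ) (minimalModel μ τ) ↔ NullSingletonClass (minimalMeasure μ τ)) ∧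
      (IsErgodicFilt μ τ → FinIso μ τ (minimalMeasure μ τ) (minimalModel μ τ))) ∧
    -- in general, even for ergodic filtrations, there is no isomorphism
    (∃ (X : Type) (_ : MeasurableSpace X) (_ : StandardBorelSpace X) (μ : Measure X)
        (_ : IsProbabilityMeasure μ) (_ : NullSingletonClass μ) (τ : DecFiltration X),
      IsLocallyFiniteFilt μ τ ∧ IsErgodicFilt μ τ ∧
      ¬ FiltIso μ τ (minimalMeasure μ τ) (minimalModel μ τ)) ∧
    -- 2) the minimal model is a complete invariant of finite isomorphism
    (∀ (X Y : Type*) [MeasurableSpace X] [StandardBorelSpace X]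
        [MeasurableSpace Y] [StandardBorelSpace Y]
        (μ : Measure X) [IsProbabilityMeasure μ] [NullSingletonClass μ] (τ : DecFiltration X)
        (μ' : Measure Y) [IsProbabilityMeasure μ'] [NullSingletonClass μ'] (τ' : DecFiltration Y),
      IsLocallyFiniteFilt μ τ → IsLocallyFiniteFilt μ' τ' →
      (FinIso μ τ μ' τ' ↔ SameMinimalModel μ τ μ' τ')) ∧
    -- 3) minimal models of adic filtrations
    (∀ (X : Type*) [MeasurableSpace X] [StandardBorelSpace X] (μ : Measure X)
        [IsProbabilityMeasure μ] [NullSingletonClass μ] (τ : DecFiltration X) (r : ℕ → ℕ),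
      IsAdicFilt μ τ r →
      IsBernoulliFilt (minimalMeasure μ τ) (minimalModel μ τ) ∧
      ((∃ᶠ n in atTop, 2 ≤ r n) → NullSingletonClass (minimalMeasure μ τ))) ∧
    -- minimal models of finitely Bernoulli filtrations
    (∀ (X Y : Type*) [MeasurableSpace X] [StandardBorelSpace X]
        [MeasurableSpace Y] [StandardBorelSpace Y]
        (μ : Measure X) [IsProbabilityMeasure μ] [NullSingletonClass μ] (τ : DecFiltration X)
        (μ' : Measure Y) [IsProbabilityMeasure μ'] (β : DecFiltration Y),
      IsLocallyFiniteFilt μ τ → IsBernoulliFilt μ' β → FinIso μ τ μ' β →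
      IsBernoulliFilt (minimalMeasure μ τ) (minimalModel μ τ) ∧
      NullSingletonClass (minimalMeasure μ τ)) ∧
    -- Bernoulli filtrations are ergodic and are realized by their minimal models
    (∀ (X : Type*) [MeasurableSpace X] [StandardBorelSpace X] (μ : Measure X)
        [IsProbabilityMeasure μ] [NullSingletonClass μ] (τ : DecFiltration X),
      IsLocallyFiniteFilt μ τ → IsBernoulliFilt μ τ →
      IsErgodicFilt μ τ ∧ FiltIso μ τ (minimalMeasure μ τ) (minimalModel μ τ)) := by
  refine ⟨fun X _ _ μ _ _ τ hτ => ⟨DecFiltration.isEquipped_minimalGraph hτ,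
      DecFiltration.isMinimal_minimalGraph hτ, DecFiltration.pathTree_minimalGraph hτ,
      DecFiltration.isMinimalMeasure_minimalMeasure hτ,
      fun ν hν => DecFiltration.minimalMeasure_unique hτ hν⟩,
    fun X _ _ μ _ _ τ hτ => ⟨DecFiltration.finIso_minimalModel_iff hτ, fun he =>
      (DecFiltration.finIso_minimalModel_iff hτ).2
        (DecFiltration.nullSingleton_minimalMeasure_of_ergodic hτ he)⟩,
    ⟨Bool × (ℕ → Fin 3), inferInstance, inferInstance, SkewShift.law, inferInstance, inferInstance,
      SkewShift.filt, SkewShift.isLocallyFiniteFilt, SkewShift.isErgodicFilt,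
      SkewShift.not_filtIso⟩,
    fun X Y _ _ _ _ μ _ _ τ μ' _ _ τ' hτ hτ' => DecFiltration.finIso_iff_sameMinimalModel hτ hτ',
    fun X _ _ μ _ _ τ r h => ⟨DecFiltration.isBernoulliFilt_minimalModel h.1
      (DecFiltration.adic_subsingleton h), DecFiltration.adic_nullSingleton h⟩,
    fun X Y _ _ _ _ μ _ _ τ μ' _ β hτ hβ h => finIso_bernoulli hτ hβ h,
    fun X _ _ μ _ _ τ hτ h => ⟨isErgodicFilt_of_isBernoulliFilt h, bernoulli_filtIso hτ h⟩⟩
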